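/- \textbf{Model.} Let $Q\ge 1$, let $\{g_{0,t}: t\in\mathcal T_0\}$ and $\{g_t: t\in\mathcal T\}$ be families of probability densities on $\mathbb R$ indexed by non-empty open sets $\mathcal T_0\subset\mathbb R^{d_0}$, $\mathcal T\subset\mathbb R^{d_1}$. A parameter is $\theta=(\pi,w,\nu_0,\nu)$ with $\pi_q>0$, $\sum_q\pi_q=1$, $w=(w_{q,\ell})$ symmetric with entries in $(0,1)$, $\nu_0\in\mathcal T_0$, $\nu=(\nu_{q,\ell})$ symmetric with entries in $\mathcal T$. For a permutation $\sigma$ of $\{1,\dots,Q\}$ put $\theta^\sigma=((\pi_{\sigma(q)})_q,(w_{\sigma(q),\sigma(\ell)})_{q,\ell},\nu_0,(\nu_{\sigma(q),\sigma(\ell)})_{q,\ell})$. The parameter set $\Theta$ is a set of such parameters with $\theta^\sigma\in\Theta$ for all $\theta\in\Theta$ and all $\sigma$. For $n\ge 2$, $n\ge Q$, let $\mathcal A=\{(i,j):1\le i<j\le n\}$, $m=n(n-1)/2$. Under $\mathbb P_\theta$: $Z_1,\dots,Z_n$ are i.i.d. with law $\pi$ on $\{1,\dots,Q\}$; given $Z$,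 the $A_{i,j}$, $(i,j)\in\mathcal A$, are independent Bernoulli$(w_{Z_i,Z_j})$; given $(Z,A)$, the observations $X_{i,j}$, $(i,j)\in\mathcal A$, are independent with density $g_{0,\nu_0}$ if $A_{i,j}=0$ and $g_{\nu_{Z_i,Z_j}}$ if $A_{i,j}=1$. Throughout $0/0=0$. \textbf{Notation.} Let $\boldsymbol\ell(x,q,\ell,\theta)=\frac{(1-w_{q,\ell})g_{0,\nu_0}(x)}{(1-w_{q,\ell})g_{0,\nu_0}(x)+w_{q,\ell}\,g_{\nu_{q,\ell}}(x)}$ and, for $\delta\in\{0,1\}$, $\boldsymbol q_\delta(t,q,\ell;\theta',\theta)=\mathbb P_{\theta'}(\boldsymbol\ell(X_{i,j},q,\ell,\theta)\le t\mid Z_i=q,Z_j=\ell,A_{i,j}=\delta)$. With $\theta'=(\pi',w',\nu_0',\nu')$ put $F_{\theta'}(\theta,t)=\sum_{q,\ell}\pi'_q\pi'_\ell[(1-w'_{q,\ell})\boldsymbol q_0(t,q,\ell;\theta',\theta)+w'_{q,\ell}\boldsymbol q_1(t,q,\ell;\theta',\theta)]$ and $\mathrm Q_{\theta'}(\theta,t)=\sum_{q,\ell}\pi'_q\pi'_\ell(1-w'_{q,\ell})\boldsymbol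 q_0(t,q,\ell;\theta',\theta)/F_{\theta'}(\theta,t)$. Let $T_\theta(y)=\max\{t\in[0,1]:\mathrm Q_\theta(\theta,t)\le y\}$. For an estimator $\hat\theta=\hat\theta(X)\in\Theta$ and a clustering $\hat Z=\hat Z(X)\in\{1,\dots,Q\}^n$ (for instance those produced by a variational EM algorithm), the plug-in $q$-value procedure at level $\alpha$ is $\varphi^{\rm VEM}_{i,j}=\mathbf 1\{\mathrm Q_{\hat\theta}(\hat\theta,\boldsymbol\ell(X_{i,j},\hat Z_i,\hat Z_j,\hat\theta))\le\alpha\}$, and $\mathrm{FDR}(\theta_0,\varphi)=\mathbb E_{\theta_0}\big[\sum_{\mathcal A}(1-A_{i,j})\varphi_{i,j}/\max(\sum_{\mathcal A}\varphi_{i,j},1)\big]$. Let $\|\cdot\|_\infty$ be the maximum of the absolute values of the coordinates and $\|(\theta',Z')-(\theta,Z)\|=\min_\sigma\max\{\|(\theta')^\sigma-\theta\|_\infty,\ \max_i|Z'_i-\sigma(Z_i)|\}$. \textbf{Assumption 1 (regularity).} For all $q,\ell$ and $\delta$: $(t,\theta,\theta_0)\mapsto\boldsymbol q_\delta(t,q,\ell;\theta_0,\theta)$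 is continuous on $[0,1]\times\Theta^2$; and there are functions $t_{1,q,\ell}<t_{2,q,\ell}$ from $\Theta$ to $[0,1]$ such that for all $\theta,\theta_0\in\Theta$ the map $t\mapsto\boldsymbol q_\delta(t,q,\ell;\theta_0,\theta)$ is $0$ on $[0,t_{1,q,\ell}(\theta)]$, strictly increasing on $[t_{1,q,\ell}(\theta),t_{2,q,\ell}(\theta)]$ and $1$ on $[t_{2,q,\ell}(\theta),1]$. \textbf{Assumption 2 (complexity, for an integer $K\ge1$).} For all $t\in[0,1]$, $\theta\in\Theta$, $q,\ell$, the set $\{x\in\mathbb R:\boldsymbol\ell(x,q,\ell,\theta)\le t\}$ is a union of $K$ pairwise disjoint (possibly empty, possibly unbounded) intervals. \textbf{Theorem.} There exist universal constants $c_1,c_1',c_2,c_2'>0$ such that the following holds. Suppose that Assumption 1 holds. Let $\theta_0=(\pi,w,\nu_0,\nu)\in\Theta$, $\boldsymbol\pi_0=\sum_{q,\ell}\pi_q\pi_\ell(1-w_{q,\ell})$, and $\alpha_*=\lim_{t\downarrow t_1}\mathrm Q_{\theta_0}(\theta_0,t)$ with $t_1=\min_{q,\ell}t_{1,q,\ell}(\theta_0)$.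 Let $\mathcal K\subset(\alpha_*,\boldsymbol\pi_0)$ be a compact interval and let $\alpha$ be an interior point of $\mathcal K$. Put $\kappa=F_{\theta_0}(\theta_0,T_{\theta_0}(\min\mathcal K))$ and $$\mathcal W_{\theta_0,\boldsymbol q}(u)=\sup\big\{|\boldsymbol q_\delta(t,q,\ell;\theta',\theta)-\boldsymbol q_\delta(t,q,\ell;\theta_0,\theta_0)|: q,\ell,\ \delta\in\{0,1\},\ t\in T_{\theta_0}(\mathcal K),\ \theta,\theta'\in\Theta,\ \|\theta-\theta_0\|_\infty\le u,\ \|\theta'-\theta_0\|_\infty\le u\big\},$$ $\pi_{\min}=\min_q\pi_q$, $w_{\max}=\max_{q,\ell}w_{q,\ell}$. Then there is $e\in(0,1)$, depending only on the model ($Q$, the two density families and $\Theta$), $\theta_0$, $\alpha$ and $\mathcal K$, such that for all $\varepsilon\in(0,e)$, all $x$ with $0<x<\min(\pi_{\min}^2,1-w_{\max})$, all $K\geq 1$ for which Assumption 2 holds, all $n\ge\max(2,Q)$ and all estimators $\hat\theta$ and clusterings $\hat Z$ as above, $$\mathrm{FDR}(\theta_0,\varphi^{\rm VEM})\le\alpha+x+16\kappa^{-1}\big(\mathcal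 W_{\theta_0,\boldsymbol q}(\varepsilon)+3Q^2\varepsilon\big)+\mathbb P_{\theta_0}\big(\|(\hat\theta,\hat Z)-(\theta_0,Z)\|>\varepsilon\big)+c_1Q^2e^{-c_1'\lfloor n/2\rfloor\kappa^2x^2/Q^4}+c_2KQ^2e^{-c_2'm\,\pi_{\min}^2(1-w_{\max})\kappa^2x^2/K^2}.$$ -/

import Mathlib

open MeasureTheory Set Filter Topology

noncomputable section

namespace NSBM

/-- A parametric family of probability densities on `ℝ` (with respect to the Lebesgue measure),
indexed by a non-empty open subset of `ℝ^d`. -/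
structure DensityFamily (d : ℕ) where
  index : Set (Fin d → ℝ)
  isOpen_index : IsOpen index
  index_nonempty : index.Nonempty
  density : (Fin d → ℝ) → ℝ → ℝ
  measurable_density : ∀ t ∈ index, Measurable (density t)
  density_nonneg : ∀ t ∈ index, ∀ x, 0 ≤ density t x
  lintegral_density : ∀ t ∈ index, ∫⁻ x, ENNReal.ofReal (density t x) = 1

/-- Parameters `θ = (π, w, ν₀, ν)` with `Q` groups. The norm and the topology are those of the
product, so `‖θ‖` is the maximum of the absolute values of all coordinates. -/
abbrev Param (Q d₀ d₁ : ℕ) : Type :=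
  (Fin Q → ℝ) × (Fin Q → Fin Q → ℝ) × (Fin d₀ → ℝ) × (Fin Q → Fin Q → Fin d₁ → ℝ)

variable {Q d₀ d₁ : ℕ}

/-- Group proportions `π`. -/
def Param.prob (θ : Param Q d₀ d₁) : Fin Q → ℝ := θ.1

/-- Connection probabilities `w`. -/
def Param.conn (θ : Param Q d₀ d₁) : Fin Q → Fin Q → ℝ := θ.2.1

/-- Null parameter `ν₀`. -/
def Param.null (θ : Param Q d₀ d₁) : Fin d₀ → ℝ := θ.2.2.1

/-- Effect parameters `ν`. -/
def Param.alt (θ : Param Q d₀ d₁) : Fin Q → Fin Q → Fin d₁ → ℝ := θ.2.2.2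

/-- The relabelled parameter `θ^σ`. -/
def Param.relabel (θ : Param Q d₀ d₁) (σ : Equiv.Perm (Fin Q)) : Param Q d₀ d₁ :=
  (fun q => θ.prob (σ q), fun q l => θ.conn (σ q) (σ l), θ.null, fun q l => θ.alt (σ q) (σ l))

/-- The largest parameter set: `π` is a probability vector with positive entries, `w` is symmetric
with entries in `(0,1)`, `ν₀` and the entries of the symmetric array `ν` index densities. -/
def fullParamSet (Q : ℕ) (g₀ : DensityFamily d₀) (g : DensityFamily d₁) :
    Set (Param Q d₀ d₁) :=
  {θ | (∀ q, 0 < θ.prob q) ∧ ∑ q, θ.prob q = 1 ∧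
    (∀ q l, θ.conn q l ∈ Ioo (0 : ℝ) 1) ∧ (∀ q l, θ.conn q l = θ.conn l q) ∧
    θ.null ∈ g₀.index ∧
    (∀ q l, θ.alt q l ∈ g.index) ∧ (∀ q l, θ.alt q l = θ.alt l q)}

/-- Potential edges `(i,j)`, `i < j`. -/
abbrev Edge (n : ℕ) : Type := {p : Fin n × Fin n // p.1 < p.2}

/-- Conditional density of `X_{i,j}` given `Z_i = q`, `Z_j = l` and `A_{i,j} = δ`
(`true` stands for `1`). -/
def condDensity (g₀ : DensityFamily d₀) (g : DensityFamily d₁) (θ : Param Q d₀ d₁)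
    (δ : Bool) (q l : Fin Q) : ℝ → ℝ :=
  if δ then g.density (θ.alt q l) else g₀.density θ.null

/-- Conditional law of `X_{i,j}` given `Z_i = q`, `Z_j = l` and `A_{i,j} = δ`. -/
def condLaw (g₀ : DensityFamily d₀) (g : DensityFamily d₁) (θ : Param Q d₀ d₁)
    (δ : Bool) (q l : Fin Q) : Measure ℝ :=
  volume.withDensity fun x => ENNReal.ofReal (condDensity g₀ g θ δ q l x)

/-- Probability of `(A, Z) = (a, z)` in the stochastic block model: the labels are i.i.d. with
law `π` and, given them, the edge indicators are independent Bernoulli variables. -/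
def sbmWeight {n : ℕ} (θ : Param Q d₀ d₁) (a : Edge n → Bool) (z : Fin n → Fin Q) : ℝ :=
  (∏ i, θ.prob (z i)) *
    ∏ e : Edge n, if a e then θ.conn (z e.1.1) (z e.1.2) else 1 - θ.conn (z e.1.1) (z e.1.2)

/-- The noisy stochastic block model: the joint law of `(X, A, Z)`. Given `(A, Z)`, the
observations `X_{i,j}` are independent. -/
def law (n : ℕ) (g₀ : DensityFamily d₀) (g : DensityFamily d₁) (θ : Param Q d₀ d₁) :
    Measure ((Edge n → ℝ) × (Edge n → Bool) × (Fin n → Fin Q)) :=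
  ∑ a : Edge n → Bool, ∑ z : Fin n → Fin Q,
    ENNReal.ofReal (sbmWeight θ a z) •
      (Measure.pi fun e : Edge n => condLaw g₀ g θ (a e) (z e.1.1) (z e.1.2)).map
        fun x => (x, a, z)

/-- Expected proportion of null edges. -/
def nullProp (θ : Param Q d₀ d₁) : ℝ :=
  ∑ q, ∑ l, θ.prob q * θ.prob l * (1 - θ.conn q l)

/-- The false discovery rate of a procedure `φ` (with `φ x e ∈ {0,1}`) under the parameter `θ`. -/
def FDR {n : ℕ} (g₀ : DensityFamily d₀) (g : DensityFamily d₁) (θ : Param Q d₀ d₁)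
    (φ : (Edge n → ℝ) → Edge n → ℝ) : ℝ :=
  ∫ ω, (∑ e, (if ω.2.1 e then 0 else φ ω.1 e)) / max (∑ e, φ ω.1 e) 1 ∂(law n g₀ g θ)

/-- The functional `ℓ(x, q, l, θ)` giving the `ℓ`-values. -/
def lValue (g₀ : DensityFamily d₀) (g : DensityFamily d₁) (θ : Param Q d₀ d₁)
    (x : ℝ) (q l : Fin Q) : ℝ :=
  (1 - θ.conn q l) * g₀.density θ.null x /
    ((1 - θ.conn q l) * g₀.density θ.null x + θ.conn q l * g.density (θ.alt q l) x)

/-- `q_δ(t, q, l; θ', θ)`: the conditional probability under `θ'` that the `ℓ`-value at `θ` is at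
most `t`, given `Z_i = q`, `Z_j = l` and `A_{i,j} = δ`. -/
def qFun (g₀ : DensityFamily d₀) (g : DensityFamily d₁) (δ : Bool) (t : ℝ) (q l : Fin Q)
    (θ' θ : Param Q d₀ d₁) : ℝ :=
  (condLaw g₀ g θ' δ q l).real {x | lValue g₀ g θ x q l ≤ t}

/-- Expected proportion, under `θ'`, of edges whose `ℓ`-value at `θ` is at most `t`. -/
def rejProp (g₀ : DensityFamily d₀) (g : DensityFamily d₁) (θ' θ : Param Q d₀ d₁) (t : ℝ) : ℝ :=
  ∑ q, ∑ l, θ'.prob q * θ'.prob l *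
    ((1 - θ'.conn q l) * qFun g₀ g false t q l θ' θ + θ'.conn q l * qFun g₀ g true t q l θ' θ)

/-- `Q_{θ'}(θ, t)`: the marginal false discovery rate under `θ'` of the procedure that rejects
when the `ℓ`-value at `θ` is at most `t` (with `0 / 0 = 0`). -/
def mFDR (g₀ : DensityFamily d₀) (g : DensityFamily d₁) (θ' θ : Param Q d₀ d₁) (t : ℝ) : ℝ :=
  (∑ q, ∑ l, θ'.prob q * θ'.prob l * (1 - θ'.conn q l) * qFun g₀ g false t q l θ' θ) /
    rejProp g₀ g θ' θ t

/-- The plug-in `q`-value procedure at level `α` built on an estimator `θhat` of the parameter and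
a clustering `Zhat`. -/
def plugIn {n : ℕ} (g₀ : DensityFamily d₀) (g : DensityFamily d₁)
    (θhat : (Edge n → ℝ) → Param Q d₀ d₁) (Zhat : (Edge n → ℝ) → Fin n → Fin Q) (α : ℝ) :
    (Edge n → ℝ) → Edge n → ℝ :=
  fun x e =>
    if mFDR g₀ g (θhat x) (θhat x)
        (lValue g₀ g (θhat x) (x e) (Zhat x e.1.1) (Zhat x e.1.2)) ≤ α then 1 else 0

/-- The regularity condition on the parameter set `Θ`, with boundary functions `t₁`, `t₂`. -/
structure Regularity (g₀ : DensityFamily d₀) (g : DensityFamily d₁) (Θ : Set (Param Q d₀ d₁))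
    (t₁ t₂ : Param Q d₀ d₁ → Fin Q → Fin Q → ℝ) : Prop where
  continuousOn : ∀ (δ : Bool) (q l : Fin Q),
    ContinuousOn (fun p : ℝ × Param Q d₀ d₁ × Param Q d₀ d₁ => qFun g₀ g δ p.1 q l p.2.2 p.2.1)
      (Icc 0 1 ×ˢ Θ ×ˢ Θ)
  t₁_mem : ∀ θ ∈ Θ, ∀ q l, t₁ θ q l ∈ Icc (0 : ℝ) 1
  t₂_mem : ∀ θ ∈ Θ, ∀ q l, t₂ θ q l ∈ Icc (0 : ℝ) 1
  t₁_lt_t₂ : ∀ θ ∈ Θ, ∀ q l, t₁ θ q l < t₂ θ q l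
  continuousOn_t : ∀ θ ∈ Θ, ∀ θ₀ ∈ Θ, ∀ (δ : Bool) (q l : Fin Q),
    ContinuousOn (fun t => qFun g₀ g δ t q l θ₀ θ) (Icc 0 1)
  eq_zero : ∀ θ ∈ Θ, ∀ θ₀ ∈ Θ, ∀ (δ : Bool) (q l : Fin Q), ∀ t ∈ Icc 0 (t₁ θ q l),
    qFun g₀ g δ t q l θ₀ θ = 0
  strictMonoOn : ∀ θ ∈ Θ, ∀ θ₀ ∈ Θ, ∀ (δ : Bool) (q l : Fin Q),
    StrictMonoOn (fun t => qFun g₀ g δ t q l θ₀ θ) (Icc (t₁ θ q l) (t₂ θ q l))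
  eq_one : ∀ θ ∈ Θ, ∀ θ₀ ∈ Θ, ∀ (δ : Bool) (q l : Fin Q), ∀ t ∈ Icc (t₂ θ q l) 1,
    qFun g₀ g δ t q l θ₀ θ = 1

/-- Unions of `K` pairwise disjoint intervals of `ℝ` (open, closed or half-open, bounded or not,
possibly empty). -/
def intervalUnions (K : ℕ) : Set (Set ℝ) :=
  {S | ∃ I : Fin K → Set ℝ, (∀ k, (I k).OrdConnected) ∧ Pairwise (fun k k' => Disjoint (I k) (I k')) ∧
    S = ⋃ k, I k}

/-- The complexity condition: every rejection region is a union of `K` intervals. -/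
def Complexity (g₀ : DensityFamily d₀) (g : DensityFamily d₁) (Θ : Set (Param Q d₀ d₁))
    (K : ℕ) : Prop :=
  ∀ t ∈ Icc (0 : ℝ) 1, ∀ θ ∈ Θ, ∀ q l : Fin Q,
    {x | lValue g₀ g θ x q l ≤ t} ∈ intervalUnions K

/-- The threshold `T_θ(α)`, the largest `t ∈ [0,1]` with `Q_θ(θ, t) ≤ α`. -/
def threshold (g₀ : DensityFamily d₀) (g : DensityFamily d₁) (θ : Param Q d₀ d₁) (α : ℝ) : ℝ :=
  sSup {t | t ∈ Icc (0 : ℝ) 1 ∧ mFDR g₀ g θ θ t ≤ α}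

/-- The critical level `α_*(θ)`: the limit of `Q_θ(θ, t)` as `t` decreases to
`min_{q,l} t₁(θ)_{q,l}`. -/
def criticalLevel (g₀ : DensityFamily d₀) (g : DensityFamily d₁)
    (t₁ : Param Q d₀ d₁ → Fin Q → Fin Q → ℝ) (θ : Param Q d₀ d₁) : ℝ :=
  Function.rightLim (fun t => mFDR g₀ g θ θ t) (⨅ p : Fin Q × Fin Q, t₁ θ p.1 p.2)

/-- `κ`, for a compact interval whose minimum is `a`. -/
def kappa (g₀ : DensityFamily d₀) (g : DensityFamily d₁) (θ₀ : Param Q d₀ d₁) (a : ℝ) : ℝ :=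
  rejProp g₀ g θ₀ θ₀ (threshold g₀ g θ₀ a)

/-- The modulus `W_{θ₀,q}(u)` over the compact interval `𝒦`. -/
def modulus (g₀ : DensityFamily d₀) (g : DensityFamily d₁) (Θ : Set (Param Q d₀ d₁))
    (θ₀ : Param Q d₀ d₁) (𝒦 : Set ℝ) (u : ℝ) : ℝ :=
  sSup {r | ∃ (q l : Fin Q) (δ : Bool), ∃ t ∈ threshold g₀ g θ₀ '' 𝒦, ∃ θ ∈ Θ, ∃ θ' ∈ Θ,
    ‖θ - θ₀‖ ≤ u ∧ ‖θ' - θ₀‖ ≤ u ∧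
      r = |qFun g₀ g δ t q l θ' θ - qFun g₀ g δ t q l θ₀ θ₀|}

/-- The discrepancy `‖(θ', Z') - (θ, Z)‖`, up to a permutation of the labels. -/
def discrepancy {n : ℕ} (θ' : Param Q d₀ d₁) (Z' : Fin n → Fin Q) (θ : Param Q d₀ d₁)
    (Z : Fin n → Fin Q) : ℝ :=
  ⨅ σ : Equiv.Perm (Fin Q),
    max ‖θ'.relabel σ - θ‖ ‖fun i => ((Z' i : ℕ) : ℝ) - ((σ (Z i) : ℕ) : ℝ)‖

end NSBM

end

/-!
If the estimation error is at most `ε < 1`, the clustering is exact up to a relabelling, so the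
plug-in procedure rejects exactly the edges with `ℓ(X_{i,j}, Z_i, Z_j, θ) ≤ t`, for the true labels
`Z` and data-dependent `θ` within `ε` of `θ₀` and `t = T_θ(α)` (`Regularity.plugIn_eq`). It remains
to bound the false discovery proportion of these procedures uniformly in `θ` and `t`.

*Analysis.* An `ℓ`-value is the posterior probability of the null. Hence `Q_θ(θ, ·)` is the mean of
the `ℓ`-values below a level: it is nondecreasing, and strictly increasing where the rejection
proportion is (`mFDR_mono`, `mFDR_lt_mFDR`). Continuity in `θ` at the two end points of the compact
interval of levels then places `T_θ(α)` between the corresponding thresholds of `θ₀`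
(`Regularity.exists_threshold_mem`). As `T_{θ₀}` may jump, its range need not be an interval, but on
a jump all functions `q_δ` are constant at `θ₀`, and monotonicity extends the control by the modulus
to the gaps (`Regularity.abs_qFun_sub_le_modulus`).

*Probability.* Three deviations are bounded. The numbers of edges with given labels are handled by a
Hoeffding-type decomposition and Jensen's inequality (`law_real_not_typicalLabels_le`). Given the
labels, the numbers of non-null edges satisfy Hoeffding's inequality. Given labels and edges, the
observations are independent but not identically distributed, and the numbers that fall into a
half-line obey a Dvoretzky–Kiefer–Wolfowitz inequality (`measureReal_exists_centredCount_le`),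
proved by symmetrization with a ghost sample and random signs: for fixed observations the half-lines
select an increasing chain of index sets, and Ville's inequality for the Rademacher walk along this
chain (`rademacher_maximal_exp`) costs no factor depending on its length. A union of `K` disjoint
intervals is built from `2K` lower sets, which gives the bound for all rejection regions.

*Conclusion.* On the typical event, the numbers of false and of all rejections are close to their
expectations, which differ from those at `θ₀` by at most the modulus plus `3 Q² ε`
(`false_discovery_proportion_le`); off it, the false discovery proportion is at most `1`.
-/

noncomputable section

namespace NSBM

/-! ### Exponential inequalities for finite product weights -/

section FiniteProduct

variable {ι κ : Type*} [Fintype ι] [DecidableEq ι] [Fintype κ]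

lemma sum_prod_mul_exp (p h : ι → κ → ℝ) :
    ∑ z : ι → κ, (∏ i, p i (z i)) * Real.exp (∑ i, h i (z i))
      = ∏ i, ∑ k, p i k * Real.exp (h i k) := by
  rw [Finset.prod_univ_sum, Fintype.piFinset_univ]
  refine Finset.sum_congr rfl fun z _ => ?_
  rw [Real.exp_sum, Finset.prod_mul_distrib]

lemma sum_prod_eq_one {p : ι → κ → ℝ} (hp : ∀ i, ∑ k, p i k = 1) :
    ∑ z : ι → κ, ∏ i, p i (z i) = 1 := by
  have := sum_prod_mul_exp p (fun _ _ => 0)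
  simpa [hp] using this

/-- The chord of the exponential over `[-c, c]`. -/
lemma exp_mul_le_cosh_add_mul_sinh (c : ℝ) {y : ℝ} (hy : |y| ≤ 1) :
    Real.exp (c * y) ≤ Real.cosh c + y * Real.sinh c := by
  obtain ⟨h1, h2⟩ := abs_le.1 hy
  have := convexOn_exp.2 (mem_univ c) (mem_univ (-c)) 
    (show 0 ≤ (1 + y) / 2 by linarith) (show 0 ≤ (1 - y) / 2 by linarith) (by ring)
  simp only [smul_eq_mul] at this
  rw [Real.cosh_eq, Real.sinh_eq]
  calc Real.exp (c * y) = Real.exp ((1 + y) / 2 * c + (1 - y) / 2 * -c) := by congr 1; ring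
    _ ≤ _ := this
    _ = _ := by ring

/-- A sum of independent centred variables with values in `[-1, 1]` is sub-Gaussian. -/
lemma sum_prod_mul_exp_le {p h : ι → κ → ℝ} (hp : ∀ i k, 0 ≤ p i k) (hp1 : ∀ i, ∑ k, p i k = 1)
    (S : Finset ι) (hh : ∀ i ∈ S, ∀ k, |h i k| ≤ 1) (hc : ∀ i ∈ S, ∑ k, p i k * h i k = 0)
    {N : ℝ} (hN : (S.card : ℝ) ≤ N) (c : ℝ) :
    ∑ z : ι → κ, (∏ i, p i (z i)) * Real.exp (c * ∑ i ∈ S, h i (z i))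
      ≤ Real.exp (c ^ 2 * N / 2) := by
  have key := sum_prod_mul_exp p (fun i k => if i ∈ S then c * h i k else 0)
  simp only [Finset.sum_ite_mem, Finset.univ_inter, ← Finset.mul_sum] at key
  rw [key]
  have hfac : ∀ i, ∑ k, p i k * Real.exp (if i ∈ S then c * h i k else 0)
      ≤ if i ∈ S then Real.exp (c ^ 2 / 2) else 1 := by
    intro i
    split_ifs with hi
    · calc ∑ k, p i k * Real.exp (c * h i k)
          ≤ ∑ k, p i k * (Real.cosh c + h i k * Real.sinh c) :=
            Finset.sum_le_sum fun k _ =>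
              mul_le_mul_of_nonneg_left (exp_mul_le_cosh_add_mul_sinh c (hh i hi k)) (hp i k)
        _ = (∑ k, p i k) * Real.cosh c + (∑ k, p i k * h i k) * Real.sinh c := by
            rw [Finset.sum_mul, Finset.sum_mul, ← Finset.sum_add_distrib]
            exact Finset.sum_congr rfl fun k _ => by ring
        _ = Real.cosh c := by rw [hp1, hc i hi]; ring
        _ ≤ _ := Real.cosh_le_exp_half_sq c
    · simp [hp1]
  calc _ ≤ ∏ i, (if i ∈ S then Real.exp (c ^ 2 / 2) else 1) :=
        Finset.prod_le_prod
          (fun i _ => Finset.sum_nonneg fun k _ => mul_nonneg (hp i k) (Real.exp_pos _).le)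
          (fun i _ => hfac i)
    _ = Real.exp (S.card * (c ^ 2 / 2)) := by
        rw [Finset.prod_ite_mem, Finset.univ_inter, Finset.prod_const, Real.exp_nat_mul]
    _ ≤ _ := Real.exp_le_exp.2 (by nlinarith [sq_nonneg c])

lemma exp_mul_abs_le (c y : ℝ) : Real.exp (c * |y|) ≤ Real.exp (c * y) + Real.exp (-c * y) := by
  rcases abs_cases y with ⟨h, _⟩ | ⟨h, _⟩ <;> rw [h]
  · linarith [Real.exp_pos (-c * y)]
  · rw [mul_neg, ← neg_mul]; linarith [Real.exp_pos (c * y)]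

lemma sum_prod_mul_exp_abs_le {p h : ι → κ → ℝ} (hp : ∀ i k, 0 ≤ p i k)
    (hp1 : ∀ i, ∑ k, p i k = 1)
    (S : Finset ι) (hh : ∀ i ∈ S, ∀ k, |h i k| ≤ 1) (hc : ∀ i ∈ S, ∑ k, p i k * h i k = 0)
    {N : ℝ} (hN : (S.card : ℝ) ≤ N) (c : ℝ) :
    ∑ z : ι → κ, (∏ i, p i (z i)) * Real.exp (c * |∑ i ∈ S, h i (z i)|)
      ≤ 2 * Real.exp (c ^ 2 * N / 2) := by
  have h1 := sum_prod_mul_exp_le hp hp1 S hh hc hN c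
  have h2 := sum_prod_mul_exp_le hp hp1 S hh hc hN (-c)
  rw [neg_sq] at h2
  calc _ ≤ ∑ z : ι → κ, (∏ i, p i (z i)) *
        (Real.exp (c * ∑ i ∈ S, h i (z i)) + Real.exp (-c * ∑ i ∈ S, h i (z i))) :=
        Finset.sum_le_sum fun z _ => mul_le_mul_of_nonneg_left (exp_mul_abs_le _ _)
          (Finset.prod_nonneg fun i _ => hp i _)
    _ ≤ _ := by simp only [mul_add, Finset.sum_add_distrib]; linarith

/-- The sum over `J` of the absolute deviations of partial sums concentrates; by convexity of the
exponential, no relation between the index sets `S j` is needed. -/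
lemma sum_prod_sum_abs_tail {p h : ι → κ → ℝ} (hp : ∀ i k, 0 ≤ p i k)
    (hp1 : ∀ i, ∑ k, p i k = 1) {J : Type*} [Fintype J] [Nonempty J]
    (S : J → Finset ι) (hh : ∀ i k, |h i k| ≤ 1) (hc : ∀ i, ∑ k, p i k * h i k = 0)
    {N : ℝ} (hN : ∀ j, ((S j).card : ℝ) ≤ N) (hN0 : 0 < N) {u : ℝ} (hu : 0 ≤ u) :
    ∑ z : ι → κ, (∏ i, p i (z i)) * (if u < ∑ j, |∑ i ∈ S j, h i (z i)| then 1 else 0)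
      ≤ 2 * Real.exp (-(u ^ 2 / (2 * (Fintype.card J : ℝ) ^ 2 * N))) := by
  have hJ : (0 : ℝ) < Fintype.card J := by exact_mod_cast Fintype.card_pos
  set M : ℝ := (Fintype.card J : ℝ) with hM
  -- this `c` minimizes `c ^ 2 * M ^ 2 * N / 2 - c * u`
  set c : ℝ := u / (M ^ 2 * N) with hcdef
  have hc0 : 0 ≤ c := by positivity
  have jensen : ∀ y : J → ℝ, Real.exp (c * ∑ j, y j) ≤ ∑ j, M⁻¹ * Real.exp (c * M * y j) := by
    intro y
    have := convexOn_exp.map_sum_le (t := Finset.univ) (w := fun _ : J => M⁻¹)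
      (p := fun j => c * M * y j) (fun _ _ => by positivity)
      (by simp [← hM, hJ.ne']) (fun _ _ => mem_univ _)
    simp only [smul_eq_mul] at this
    refine le_trans (le_of_eq ?_) this
    congr 1
    rw [Finset.mul_sum]
    exact Finset.sum_congr rfl fun j _ => by field_simp
  have hw : ∀ z : ι → κ, 0 ≤ ∏ i, p i (z i) := fun z => Finset.prod_nonneg fun i _ => hp i _
  calc _ ≤ ∑ z : ι → κ, (∏ i, p i (z i)) *
        (Real.exp (-(c * u)) * ∑ j, M⁻¹ * Real.exp (c * M * |∑ i ∈ S j, h i (z i)|)) := by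
        refine Finset.sum_le_sum fun z _ => mul_le_mul_of_nonneg_left ?_ (hw z)
        split_ifs with hz
        · refine le_trans ?_ (mul_le_mul_of_nonneg_left (jensen _) (Real.exp_pos _).le)
          rw [← Real.exp_add, Real.one_le_exp_iff]
          nlinarith
        · positivity
    _ = Real.exp (-(c * u)) * ∑ j, M⁻¹ * ∑ z : ι → κ, (∏ i, p i (z i)) *
          Real.exp (c * M * |∑ i ∈ S j, h i (z i)|) := by
        simp only [Finset.mul_sum]
        rw [Finset.sum_comm]
        refine Finset.sum_congr rfl fun j _ => Finset.sum_congr rfl fun z _ => by ring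
    _ ≤ Real.exp (-(c * u)) * ∑ j : J, M⁻¹ * (2 * Real.exp ((c * M) ^ 2 * N / 2)) := by
        gcongr with j
        exact sum_prod_mul_exp_abs_le hp hp1 _ (fun i _ => hh i) (fun i _ => hc i) (hN j) _
    _ = 2 * Real.exp (-(u ^ 2 / (2 * M ^ 2 * N))) := by
        rw [Finset.sum_const, Finset.card_univ, nsmul_eq_mul, ← hM, ← mul_assoc M,
          mul_inv_cancel₀ hJ.ne', one_mul, mul_left_comm, ← Real.exp_add]
        congr 2
        rw [hcdef]; field_simp; ring

/-- Hoeffding's inequality for finite product weights. -/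
lemma sum_prod_abs_tail {p h : ι → κ → ℝ} (hp : ∀ i k, 0 ≤ p i k)
    (hp1 : ∀ i, ∑ k, p i k = 1)
    (S : Finset ι) (hh : ∀ i ∈ S, ∀ k, |h i k| ≤ 1) (hc : ∀ i ∈ S, ∑ k, p i k * h i k = 0)
    {N : ℝ} (hN : (S.card : ℝ) ≤ N) (hN0 : 0 < N) {u : ℝ} (hu : 0 ≤ u) :
    ∑ z : ι → κ, (∏ i, p i (z i)) * (if u < |∑ i ∈ S, h i (z i)| then 1 else 0)
      ≤ 2 * Real.exp (-(u ^ 2 / (2 * N))) := by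
  have hw : ∀ z : ι → κ, 0 ≤ ∏ i, p i (z i) := fun z => Finset.prod_nonneg fun i _ => hp i _
  set c : ℝ := u / N with hcdef
  have hc0 : 0 ≤ c := by positivity
  calc _ ≤ ∑ z : ι → κ, (∏ i, p i (z i)) *
        (Real.exp (-(c * u)) * Real.exp (c * |∑ i ∈ S, h i (z i)|)) := by
        refine Finset.sum_le_sum fun z _ => mul_le_mul_of_nonneg_left ?_ (hw z)
        split_ifs with hz
        · rw [← Real.exp_add, Real.one_le_exp_iff]
          nlinarith
        · positivity
    _ = Real.exp (-(c * u)) * ∑ z : ι → κ, (∏ i, p i (z i)) *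
          Real.exp (c * |∑ i ∈ S, h i (z i)|) := by
        rw [Finset.mul_sum]
        exact Finset.sum_congr rfl fun z _ => by ring
    _ ≤ Real.exp (-(c * u)) * (2 * Real.exp (c ^ 2 * N / 2)) := by
        gcongr
        exact sum_prod_mul_exp_abs_le hp hp1 _ hh hc hN _
    _ = _ := by
        rw [mul_left_comm, ← Real.exp_add]
        congr 2
        rw [hcdef]; field_simp; ring

end FiniteProduct

/-! ### A maximal inequality for Rademacher sums -/

section Rademacher

variable {ι : Type*} [Fintype ι] [DecidableEq ι]

/-- The sign `1` or `-1` encoded by a Boolean. -/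
def sgn (b : Bool) : ℝ := if b then 1 else -1

lemma sgn_not (b : Bool) : sgn (!b) = -sgn b := by cases b <;> simp [sgn]

lemma sum_bool_pi_eq_update (i : ι) (f : (ι → Bool) → ℝ) :
    ∑ ε, f ε = ∑ ε, (f (Function.update ε i true) + f (Function.update ε i false)) / 2 := by
  have hflip : Function.Involutive
      (fun ε : ι → Bool => Function.update ε i (!(ε i))) := fun ε => by simp
  have h1 : ∑ ε, f (Function.update ε i (!(ε i))) = ∑ ε, f ε :=
    Equiv.sum_comp hflip.toPerm f
  have h2 : ∀ ε : ι → Bool, f (Function.update ε i true) + f (Function.update ε i false)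
      = f ε + f (Function.update ε i (!(ε i))) := by
    intro ε
    cases h : ε i
    · have : Function.update ε i false = ε := by rw [← h, Function.update_eq_self]
      rw [this]; simp [add_comm]
    · have : Function.update ε i true = ε := by rw [← h, Function.update_eq_self]
      rw [this]; simp
  rw [← Finset.sum_div, Finset.sum_congr rfl fun ε _ => h2 ε, Finset.sum_add_distrib, h1]
  ring

open Classical in
/-- Ville's inequality for the Rademacher walk that discovers the indices of `S` in the order of
the values `x`: in the induction the smallest value is the first step. -/
lemma rademacher_maximal_exp (x : ι → ℝ) {c : ℝ} (hc : 0 ≤ c) (S : Finset ι) (r : ℝ) :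
    ∑ ε : ι → Bool, (if ∃ s : ℝ, r ≤ ∑ i ∈ S with x i ≤ s, sgn (ε i) then (1 : ℝ) else 0)
      ≤ 2 ^ Fintype.card ι * (Real.exp (-(c * r)) * Real.cosh c ^ S.card) := by
  have card : (∑ _ε : ι → Bool, (1 : ℝ)) = 2 ^ Fintype.card ι := by simp
  induction hn : S.card generalizing S r with
  | zero =>
    have hS : S = ∅ := Finset.card_eq_zero.1 hn
    subst hS
    rw [← card, Finset.sum_mul]
    refine Finset.sum_le_sum fun ε _ => ?_
    split_ifs with h
    · obtain ⟨s, hs⟩ := h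
      have hr : r ≤ 0 := by simpa using hs
      have : 0 ≤ -(c * r) := by nlinarith
      simpa using this
    · positivity
  | succ n ih =>
    rcases le_or_gt r 0 with hr | hr
    · rw [← card, Finset.sum_mul]
      refine Finset.sum_le_sum fun ε _ => ?_
      have h1 : 1 ≤ Real.exp (-(c * r)) := Real.one_le_exp_iff.2 (by nlinarith)
      have h2 : 1 ≤ Real.cosh c ^ (n + 1) := one_le_pow₀ (Real.one_le_cosh c)
      split_ifs <;> nlinarith
    · obtain ⟨i, hi, hmin⟩ := S.exists_min_image x (Finset.card_pos.1 (by omega))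
      have hcard : (S.erase i).card = n := by rw [Finset.card_erase_of_mem hi, hn]; rfl
      have hstep : ∀ (ε : ι → Bool) (b : Bool),
          (if ∃ s : ℝ, r ≤ ∑ j ∈ S with x j ≤ s, sgn (Function.update ε i b j) then (1 : ℝ) else 0)
          ≤ if ∃ s : ℝ, r - sgn b ≤ ∑ j ∈ S.erase i with x j ≤ s, sgn (ε j) then 1 else 0 := by
        intro ε b
        split_ifs with h1 h2 h2
        · exact le_rfl
        · exfalso
          obtain ⟨s, hs⟩ := h1
          refine h2 ⟨s, ?_⟩
          by_cases his : x i ≤ s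
          · rw [← Finset.insert_erase hi, Finset.filter_insert, if_pos his,
              Finset.sum_insert (by simp)] at hs
            have : ∑ j ∈ S.erase i with x j ≤ s, sgn (Function.update ε i b j)
                = ∑ j ∈ S.erase i with x j ≤ s, sgn (ε j) := by
              refine Finset.sum_congr rfl fun j hj => ?_
              rw [Function.update_of_ne (Finset.ne_of_mem_erase (Finset.mem_filter.1 hj).1)]
            rw [this, Function.update_self] at hs
            linarith
          · have : S.filter (fun j => x j ≤ s) = ∅ :=
              Finset.filter_eq_empty_iff.2 fun j hj hjs => his ((hmin j hj).trans hjs)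
            rw [this, Finset.sum_empty] at hs
            linarith
        · exact zero_le_one
        · exact le_rfl
      rw [sum_bool_pi_eq_update i]
      calc _ ≤ ∑ ε : ι → Bool,
            ((if ∃ s : ℝ, r - sgn true ≤ ∑ j ∈ S.erase i with x j ≤ s, sgn (ε j) then 1 else 0)
            + (if ∃ s : ℝ, r - sgn false ≤ ∑ j ∈ S.erase i with x j ≤ s, sgn (ε j)
                then 1 else 0)) / 2 := by
            refine Finset.sum_le_sum fun ε _ => ?_
            have := hstep ε true
            have := hstep ε false
            linarith
        _ ≤ (2 ^ Fintype.card ι * (Real.exp (-(c * (r - 1))) * Real.cosh c ^ n)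
            + 2 ^ Fintype.card ι * (Real.exp (-(c * (r + 1))) * Real.cosh c ^ n)) / 2 := by
            rw [← Finset.sum_div, Finset.sum_add_distrib]
            have h1 := ih (S.erase i) (r - sgn true) hcard
            have h2 := ih (S.erase i) (r - sgn false) hcard
            simp only [sgn, if_true, Bool.false_eq_true, if_false, sub_neg_eq_add] at h1 h2 ⊢
            linarith
        _ = _ := by
            rw [show -(c * (r - 1)) = -(c * r) + c by ring,
              show -(c * (r + 1)) = -(c * r) + -c by ring, Real.exp_add, Real.exp_add, pow_succ,
              Real.cosh_eq]
            ring

open Classical in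
lemma rademacher_maximal (x : ι → ℝ) (S : Finset ι) {N r : ℝ} (hN : (S.card : ℝ) ≤ N)
    (hN0 : 0 < N) (hr : 0 ≤ r) :
    ∑ ε : ι → Bool, (if ∃ s : ℝ, r ≤ |∑ i ∈ S with x i ≤ s, sgn (ε i)| then (1 : ℝ) else 0)
      ≤ 2 ^ Fintype.card ι * (2 * Real.exp (-(r ^ 2 / (2 * N)))) := by
  have one : ∑ ε : ι → Bool, (if ∃ s : ℝ, r ≤ ∑ i ∈ S with x i ≤ s, sgn (ε i) then (1 : ℝ) else 0)
      ≤ 2 ^ Fintype.card ι * Real.exp (-(r ^ 2 / (2 * N))) := by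
    refine (rademacher_maximal_exp x (c := r / N) (by positivity) S r).trans ?_
    gcongr
    calc Real.exp (-(r / N * r)) * Real.cosh (r / N) ^ S.card
        ≤ Real.exp (-(r / N * r)) * Real.exp ((r / N) ^ 2 / 2) ^ S.card := by
          gcongr
          exact Real.cosh_le_exp_half_sq _
      _ = Real.exp (-(r / N * r) + S.card * ((r / N) ^ 2 / 2)) := by
          rw [← Real.exp_nat_mul, Real.exp_add]
      _ ≤ Real.exp (-(r / N * r) + N * ((r / N) ^ 2 / 2)) := by gcongr
      _ = _ := by congr 1; field_simp; ring
  have hneg : Function.Involutive (fun (ε : ι → Bool) i => !(ε i)) := fun ε => by simp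
  have two := one
  rw [← Equiv.sum_comp hneg.toPerm] at two
  simp only [Function.Involutive.coe_toPerm, sgn_not, Finset.sum_neg_distrib] at two
  calc _ ≤ ∑ ε : ι → Bool,
        ((if ∃ s : ℝ, r ≤ ∑ i ∈ S with x i ≤ s, sgn (ε i) then (1 : ℝ) else 0)
        + (if ∃ s : ℝ, r ≤ -∑ i ∈ S with x i ≤ s, sgn (ε i) then (1 : ℝ) else 0)) := by
        refine Finset.sum_le_sum fun ε _ => ?_
        by_cases h : ∃ s : ℝ, r ≤ |∑ i ∈ S with x i ≤ s, sgn (ε i)|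
        · rw [if_pos h]
          obtain ⟨s, hs⟩ := h
          rcases le_abs.1 hs with h | h
          · rw [if_pos ⟨s, h⟩]; split_ifs <;> norm_num
          · rw [if_pos (⟨s, h⟩ : ∃ s : ℝ, r ≤ -∑ i ∈ S with x i ≤ s, sgn (ε i))]
            split_ifs <;> norm_num
        · rw [if_neg h]; split_ifs <;> norm_num
    _ ≤ _ := by rw [Finset.sum_add_distrib]; linarith

end Rademacher

/-! ### A Dvoretzky–Kiefer–Wolfowitz inequality for independent observations -/

section DKW

variable {ι : Type*}

/-- Centred number of the observations `x i`, `i ∈ S`, that fall into `C`, when `x i` has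
law `μ i`. -/
def centredCount (μ : ι → Measure ℝ) (S : Finset ι) (C : Set ℝ) (x : ι → ℝ) : ℝ :=
  ∑ i ∈ S, (C.indicator (fun _ => (1 : ℝ)) (x i) - (μ i).real C)

lemma centredCount_Iic (μ : ι → Measure ℝ) (S : Finset ι) (s : ℝ) (x : ι → ℝ) :
    centredCount μ S (Iic s) x = ∑ i ∈ S, ((if x i ≤ s then 1 else 0) - (μ i).real (Iic s)) := by
  simp [centredCount, indicator_apply]

lemma measurable_centredCount (μ : ι → Measure ℝ) (S : Finset ι) {C : Set ℝ} (hC : MeasurableSet C) :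
    Measurable (centredCount μ S C) := by
  unfold centredCount
  refine Finset.measurable_sum _ fun i _ => ?_
  exact ((measurable_const.indicator hC).comp (measurable_pi_apply i)).sub_const _

lemma measurableSet_signedCount (S : Finset ι) (ε : ι → Bool) (r : ℝ) :
    MeasurableSet {x : ι → ℝ | ∃ s : ℚ, r ≤ |∑ i ∈ S with x i ≤ s, sgn (ε i)|} := by
  simp only [Finset.sum_filter, ofPred_exists]
  refine MeasurableSet.iUnion fun s => measurableSet_le measurable_const ?_
  refine (Finset.measurable_sum _ fun i _ => ?_).abs
  exact Measurable.ite (measurableSet_le (measurable_pi_apply i) measurable_const)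
    measurable_const measurable_const

lemma measurableSet_pairedCount (S : Finset ι) (r : ℝ) :
    MeasurableSet {p : (ι → ℝ) × (ι → ℝ) | ∃ s : ℚ,
      r ≤ |∑ i ∈ S, ((if p.1 i ≤ s then (1 : ℝ) else 0) - if p.2 i ≤ s then 1 else 0)|} := by
  simp only [ofPred_exists]
  refine MeasurableSet.iUnion fun s => measurableSet_le measurable_const ?_
  refine (Finset.measurable_sum _ fun i _ => Measurable.sub ?_ ?_).abs
  · exact Measurable.ite (measurableSet_le (by fun_prop) measurable_const)
      measurable_const measurable_const
  · exact Measurable.ite (measurableSet_le (by fun_prop) measurable_const)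
      measurable_const measurable_const

/-- The two samples of a pair can be exchanged independently over the coordinates without
changing the joint law. -/
lemma measureReal_swap [Fintype ι] (μ : ι → Measure ℝ) [∀ i, IsProbabilityMeasure (μ i)]
    (ε : ι → Bool)
    {E : Set ((ι → ℝ) × (ι → ℝ))} (hE : MeasurableSet E) :
    ((Measure.pi μ).prod (Measure.pi μ)).real
        {p | ((fun i => if ε i then p.1 i else p.2 i), fun i => if ε i then p.2 i else p.1 i) ∈ E}
      = ((Measure.pi μ).prod (Measure.pi μ)).real E := by
  have hm := measurePreserving_arrowProdEquivProdArrow ℝ ℝ ι μ μ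
  have hs : MeasurePreserving (fun (w : ι → ℝ × ℝ) i => if ε i then w i else (w i).swap)
      (Measure.pi fun i => (μ i).prod (μ i)) (Measure.pi fun i => (μ i).prod (μ i)) := by
    refine measurePreserving_pi _ _ (f := fun i (v : ℝ × ℝ) => if ε i then v else v.swap)
      fun i => ?_
    cases ε i
    · simpa using Measure.measurePreserving_swap
    · exact MeasurePreserving.id _
  have h := (hm.comp hs).comp hm.symm
  have := h.measureReal_preimage hE.nullMeasurableSet
  rw [← this]
  congr 1
  ext p
  simp only [mem_ofPred_eq, mem_preimage, Function.comp]
  have : ∀ i, (MeasurableEquiv.arrowProdEquivProdArrow ℝ ℝ ι).symm p i = (p.1 i, p.2 i) :=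
    fun i => rfl
  have h2 : ∀ w : ι → ℝ × ℝ, MeasurableEquiv.arrowProdEquivProdArrow ℝ ℝ ι w
      = (fun i => (w i).1, fun i => (w i).2) := fun i => rfl
  rw [h2]
  simp only [this]
  have e1 : (fun i => (if ε i = true then (p.1 i, p.2 i) else (p.1 i, p.2 i).swap).1)
      = fun i => if ε i then p.1 i else p.2 i := by
    funext i; split_ifs <;> rfl
  have e2 : (fun i => (if ε i = true then (p.1 i, p.2 i) else (p.1 i, p.2 i).swap).2)
      = fun i => if ε i then p.2 i else p.1 i := by
    funext i; split_ifs <;> rfl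
  rw [e1, e2]

variable [Fintype ι] [DecidableEq ι] (μ : ι → Measure ℝ) [∀ i, IsProbabilityMeasure (μ i)]

/-- Chebyshev's inequality for the number of observations in `C`. -/
lemma measureReal_le_abs_centredCount_le (S : Finset ι) {C : Set ℝ} (hC : MeasurableSet C)
    {N c : ℝ} (hN : (S.card : ℝ) ≤ N) (hc : 0 < c) :
    (Measure.pi μ).real {x | c ≤ |centredCount μ S C x|} ≤ N / (4 * c ^ 2) := by
  set X : ι → ℝ → ℝ := fun i => if i ∈ S then C.indicator (fun _ => (1 : ℝ)) else 0 with hX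
  have hXm : ∀ i, Measurable (X i) := fun i => by
    simp only [hX]; split_ifs
    · exact measurable_const.indicator hC
    · exact measurable_const
  have hX01 : ∀ i y, X i y ∈ Icc (0 : ℝ) 1 := fun i y => by
    simp only [hX]
    split_ifs
    · by_cases hy : y ∈ C <;> simp [hy]
    · simp
  have hL : ∀ i, MemLp (X i) 2 (μ i) := fun i =>
    MemLp.of_bound (hXm i).aestronglyMeasurable 1 (ae_of_all _ fun y => by
      rw [Real.norm_eq_abs, abs_of_nonneg (hX01 i y).1]; exact (hX01 i y).2)
  have hLpi : ∀ i, MemLp (fun ω : ι → ℝ => X i (ω i)) 2 (Measure.pi μ) := fun i =>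
    (hL i).comp_measurePreserving (measurePreserving_eval μ i)
  have hvar := ProbabilityTheory.variance_sum_pi hL
  have hvar' : ProbabilityTheory.variance (∑ i, fun ω : ι → ℝ => X i (ω i)) (Measure.pi μ)
      ≤ N / 4 := by
    rw [hvar]
    calc ∑ i, ProbabilityTheory.variance (X i) (μ i) ≤ ∑ i, if i ∈ S then (1 / 4 : ℝ) else 0 := by
          refine Finset.sum_le_sum fun i _ => ?_
          split_ifs with hi
          · have := ProbabilityTheory.variance_le_sq_of_bounded (μ := μ i) (a := 0) (b := 1)
              (X := X i) (ae_of_all _ (hX01 i)) (hXm i).aemeasurable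
            norm_num at this ⊢
            exact this
          · have : X i = 0 := by simp [hX, hi]
            rw [this]; simp
      _ = S.card * (1 / 4) := by
          rw [Finset.sum_ite_mem, Finset.univ_inter, Finset.sum_const, nsmul_eq_mul]
      _ ≤ N / 4 := by linarith
  have hmean : ∫ ω, (∑ i, fun ω : ι → ℝ => X i (ω i)) ω ∂(Measure.pi μ)
      = ∑ i ∈ S, (μ i).real C := by
    simp only [Finset.sum_apply]
    rw [integral_finsetSum _ fun i _ => (hLpi i).integrable (by norm_num)]
    rw [← Finset.univ_inter S, ← Finset.sum_ite_mem]
    refine Finset.sum_congr rfl fun i _ => ?_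
    rw [integral_comp_eval (hXm i).aestronglyMeasurable]
    simp only [hX]
    split_ifs
    · rw [integral_indicator hC]; simp
    · simp
  have hcheb := ProbabilityTheory.meas_ge_le_variance_div_sq (μ := Measure.pi μ)
    (X := ∑ i, fun ω : ι → ℝ => X i (ω i)) (memLp_finsetSum' _ fun i _ => hLpi i) hc
  have heq : ∀ ω : ι → ℝ, (∑ i, fun ω : ι → ℝ => X i (ω i)) ω
      - ∫ ω, (∑ i, fun ω : ι → ℝ => X i (ω i)) ω ∂(Measure.pi μ) = centredCount μ S C ω := by
    intro ω
    have h0 : ∑ i, X i (ω i) = ∑ i ∈ S, C.indicator (fun _ => (1 : ℝ)) (ω i) := by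
      rw [← Finset.univ_inter S, ← Finset.sum_ite_mem]
      refine Finset.sum_congr rfl fun i _ => ?_
      simp only [hX]
      split_ifs <;> simp
    rw [hmean, centredCount, Finset.sum_sub_distrib, Finset.sum_apply, h0]
  simp only [heq] at hcheb
  refine (ENNReal.toReal_le_of_le_ofReal 
    (div_nonneg (ProbabilityTheory.variance_nonneg _ _) (sq_nonneg c)) hcheb).trans ?_
  rw [div_le_div_iff₀ (by positivity) (by positivity)]
  nlinarith [sq_nonneg c]

open Classical in
lemma sum_measureReal_signedCount_le (S : Finset ι) {N r : ℝ} (hN : (S.card : ℝ) ≤ N)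
    (hN0 : 0 < N) (hr : 0 ≤ r) :
    ∑ ε : ι → Bool, (Measure.pi μ).real {x | ∃ s : ℚ, r ≤ |∑ i ∈ S with x i ≤ s, sgn (ε i)|}
      ≤ 2 ^ Fintype.card ι * (2 * Real.exp (-(r ^ 2 / (2 * N)))) := by
  set G : (ι → Bool) → Set (ι → ℝ) :=
    fun ε => {x | ∃ s : ℚ, r ≤ |∑ i ∈ S with x i ≤ s, sgn (ε i)|} with hG
  have hGm : ∀ ε, MeasurableSet (G ε) := fun ε => measurableSet_signedCount S ε r
  have hGi : ∀ ε, Integrable ((G ε).indicator fun _ => (1 : ℝ)) (Measure.pi μ) := fun ε =>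
    (integrable_const 1).indicator (hGm ε)
  calc ∑ ε : ι → Bool, (Measure.pi μ).real (G ε)
      = ∫ x, ∑ ε, (G ε).indicator (fun _ => (1 : ℝ)) x ∂(Measure.pi μ) := by
        rw [integral_finsetSum _ fun ε _ => hGi ε]
        refine Finset.sum_congr rfl fun ε _ => ?_
        rw [integral_indicator (hGm ε)]; simp
    _ ≤ ∫ _x, 2 ^ Fintype.card ι * (2 * Real.exp (-(r ^ 2 / (2 * N)))) ∂(Measure.pi μ) := by
        refine integral_mono (integrable_finsetSum _ fun ε _ => hGi ε) (integrable_const _) ?_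
        intro x
        refine le_trans (Finset.sum_le_sum fun ε _ => ?_) (rademacher_maximal x S hN hN0 hr)
        by_cases h : x ∈ G ε
        · obtain ⟨s, hs⟩ := h
          rw [indicator_of_mem (show x ∈ G ε from ⟨s, hs⟩), if_pos ⟨(s : ℝ), hs⟩]
        · rw [indicator_of_notMem h]; split_ifs <;> norm_num
    _ = _ := by simp

/-- Random signs: a uniform deviation between two samples is controlled by the maximal
inequality for Rademacher sums. -/
lemma measureReal_pairedCount_le (S : Finset ι) {N r : ℝ} (hN : (S.card : ℝ) ≤ N)
    (hN0 : 0 < N) (hr : 0 ≤ r) :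
    ((Measure.pi μ).prod (Measure.pi μ)).real {p : (ι → ℝ) × (ι → ℝ) | ∃ s : ℚ,
      r ≤ |∑ i ∈ S, ((if p.1 i ≤ s then (1 : ℝ) else 0) - if p.2 i ≤ s then 1 else 0)|}
      ≤ 4 * Real.exp (-(r ^ 2 / (8 * N))) := by
  set E : Set ((ι → ℝ) × (ι → ℝ)) := {p | ∃ s : ℚ,
      r ≤ |∑ i ∈ S, ((if p.1 i ≤ s then (1 : ℝ) else 0) - if p.2 i ≤ s then 1 else 0)|} with hE
  have hEm : MeasurableSet E := measurableSet_pairedCount S r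
  set G : (ι → Bool) → Set (ι → ℝ) :=
    fun ε => {x | ∃ s : ℚ, r / 2 ≤ |∑ i ∈ S with x i ≤ s, sgn (ε i)|} with hG
  have hGm : ∀ ε, MeasurableSet (G ε) := fun ε => measurableSet_signedCount S ε _
  have hε : ∀ ε, ((Measure.pi μ).prod (Measure.pi μ)).real E ≤ 2 * (Measure.pi μ).real (G ε) := by
    intro ε
    rw [← measureReal_swap μ ε hEm]
    have hsub : {p : (ι → ℝ) × (ι → ℝ) |
        ((fun i => if ε i then p.1 i else p.2 i), fun i => if ε i then p.2 i else p.1 i) ∈ E}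
        ⊆ Prod.fst ⁻¹' G ε ∪ Prod.snd ⁻¹' G ε := by
      rintro p ⟨s, hs⟩
      have : ∑ i ∈ S, ((if (if ε i then p.1 i else p.2 i) ≤ (s : ℝ) then (1 : ℝ) else 0)
          - if (if ε i then p.2 i else p.1 i) ≤ (s : ℝ) then 1 else 0)
          = ∑ i ∈ S with p.1 i ≤ s, sgn (ε i) - ∑ i ∈ S with p.2 i ≤ s, sgn (ε i) := by
        rw [Finset.sum_filter, Finset.sum_filter, ← Finset.sum_sub_distrib]
        refine Finset.sum_congr rfl fun i _ => ?_
        cases ε i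
        · simp only [sgn, Bool.false_eq_true, if_false]; split_ifs <;> norm_num
        · simp [sgn]
      dsimp only at hs
      rw [this] at hs
      by_contra hcon
      simp only [mem_union, mem_preimage, not_or, hG, mem_ofPred_eq, not_exists, not_le] at hcon
      have := hcon.1 s
      have := hcon.2 s
      have := abs_sub (∑ i ∈ S with p.1 i ≤ s, sgn (ε i)) (∑ i ∈ S with p.2 i ≤ s, sgn (ε i))
      linarith
    refine (measureReal_mono hsub).trans ((measureReal_union_le _ _).trans ?_)
    rw [measurePreserving_fst.measureReal_preimage (hGm ε).nullMeasurableSet,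
      measurePreserving_snd.measureReal_preimage (hGm ε).nullMeasurableSet]
    linarith
  have hsum := Finset.sum_le_sum fun (ε : ι → Bool) (_ : ε ∈ Finset.univ) => hε ε
  have hsign := sum_measureReal_signedCount_le μ S hN hN0 (r := r / 2) (by positivity)
  rw [← Finset.mul_sum] at hsum
  have h2 : (0 : ℝ) < 2 ^ Fintype.card ι := by positivity
  have h3 : 2 ^ Fintype.card ι * ((Measure.pi μ).prod (Measure.pi μ)).real E
      ≤ 2 ^ Fintype.card ι * (4 * Real.exp (-((r / 2) ^ 2 / (2 * N)))) := by
    have h4 : ∑ _ε : ι → Bool, ((Measure.pi μ).prod (Measure.pi μ)).real E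
        = 2 ^ Fintype.card ι * ((Measure.pi μ).prod (Measure.pi μ)).real E := by simp
    rw [← h4]
    linarith
  refine (le_of_mul_le_mul_left h3 h2).trans (le_of_eq ?_)
  congr 3
  field_simp; ring

/-- A Dvoretzky–Kiefer–Wolfowitz inequality for independent, not necessarily identically
distributed, observations. -/
lemma measureReal_exists_centredCount_le (S : Finset ι) {N u : ℝ} (hN : (S.card : ℝ) ≤ N)
    (hN0 : 0 < N) (hu : 0 ≤ u) :
    (Measure.pi μ).real {x | ∃ s : ℚ, u < |centredCount μ S (Iic (s : ℝ)) x|}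
      ≤ 8 * Real.exp (-(u ^ 2 / (32 * N))) := by
  -- for small `u` the bound exceeds `1`; otherwise Chebyshev's inequality controls a ghost sample
  rcases le_or_gt (u ^ 2) (4 * N) with hsmall | hlarge
  · refine measureReal_le_one.trans ?_
    have h1 : u ^ 2 / (32 * N) ≤ 1 / 8 := by
      rw [div_le_div_iff₀ (by positivity) (by norm_num)]; linarith
    have h2 := Real.add_one_le_exp (-(u ^ 2 / (32 * N)))
    linarith
  have hu0 : 0 < u := lt_of_le_of_ne hu fun h => by rw [← h] at hlarge; nlinarith
  set B : Set (ι → ℝ) := {x | ∃ s : ℚ, u < |centredCount μ S (Iic (s : ℝ)) x|} with hB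
  have hBm : MeasurableSet B := by
    simp only [hB, ofPred_exists]
    exact MeasurableSet.iUnion fun s =>
      measurableSet_lt measurable_const (measurable_centredCount μ S measurableSet_Iic).abs
  set E : Set ((ι → ℝ) × (ι → ℝ)) := {p | ∃ s : ℚ,
      u / 2 ≤ |∑ i ∈ S, ((if p.1 i ≤ s then (1 : ℝ) else 0) - if p.2 i ≤ s then 1 else 0)|} with hE
  have hEm : MeasurableSet E := measurableSet_pairedCount S _
  have hsec : ∀ x ∈ B, (1 / 2 : ℝ) ≤ (Measure.pi μ).real (Prod.mk x ⁻¹' E) := by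
    rintro x ⟨s, hs⟩
    have hch := measureReal_le_abs_centredCount_le μ S (measurableSet_Iic (a := (s : ℝ))) hN
      (half_pos hu0)
    set H : Set (ι → ℝ) := {y | u / 2 ≤ |centredCount μ S (Iic (s : ℝ)) y|} with hH
    have hHm : MeasurableSet H :=
      measurableSet_le measurable_const (measurable_centredCount μ S measurableSet_Iic).abs
    have hsub : Hᶜ ⊆ Prod.mk x ⁻¹' E := by
      intro y hy
      have hy' : |centredCount μ S (Iic (s : ℝ)) y| < u / 2 := not_le.1 hy
      refine ⟨s, ?_⟩
      have : ∑ i ∈ S, ((if x i ≤ (s : ℝ) then (1 : ℝ) else 0) - if y i ≤ (s : ℝ) then 1 else 0)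
          = centredCount μ S (Iic (s : ℝ)) x - centredCount μ S (Iic (s : ℝ)) y := by
        rw [centredCount_Iic, centredCount_Iic, ← Finset.sum_sub_distrib]
        exact Finset.sum_congr rfl fun i _ => by ring
      dsimp only
      rw [this]
      have := abs_sub_abs_le_abs_sub (centredCount μ S (Iic (s : ℝ)) x)
        (centredCount μ S (Iic (s : ℝ)) y)
      linarith
    refine le_trans ?_ (measureReal_mono hsub)
    rw [probReal_compl_eq_one_sub hHm]
    have : N / (4 * (u / 2) ^ 2) ≤ 1 / 2 := by
      rw [div_le_div_iff₀ (by positivity) (by norm_num)]; nlinarith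
    linarith
  have hprod : (1 / 2 : ℝ) * (Measure.pi μ).real B
      ≤ ((Measure.pi μ).prod (Measure.pi μ)).real E := by
    rw [← integral_indicator_one (μ := (Measure.pi μ).prod (Measure.pi μ)) hEm,
      integral_prod _ (show Integrable (E.indicator (1 : (ι → ℝ) × (ι → ℝ) → ℝ)) _ from
        (integrable_const (1 : ℝ)).indicator hEm)]
    have hin : ∀ x, ∫ y, E.indicator 1 (x, y) ∂(Measure.pi μ)
        = (Measure.pi μ).real (Prod.mk x ⁻¹' E) := by
      intro x
      rw [← integral_indicator_one (measurable_prodMk_left hEm)]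
      rfl
    simp only [hin]
    have : (1 / 2 : ℝ) * (Measure.pi μ).real B
        = ∫ x, B.indicator (fun _ => (1 / 2 : ℝ)) x ∂(Measure.pi μ) := by
      rw [integral_indicator hBm]; simp [mul_comm]
    rw [this]
    refine integral_mono_of_nonneg (ae_of_all _ fun x => indicator_nonneg (by norm_num) _) ?_
      (ae_of_all _ fun x => ?_)
    · refine Integrable.of_bound (C := 1)
        (measurable_measure_prodMk_left hEm).ennreal_toReal.aestronglyMeasurable
        (ae_of_all _ fun x => ?_)
      rw [Real.norm_eq_abs, abs_of_nonneg measureReal_nonneg]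
      exact measureReal_le_one
    · by_cases hx : x ∈ B
      · rw [indicator_of_mem hx]; exact hsec x hx
      · rw [indicator_of_notMem hx]; exact measureReal_nonneg
  have hpair := measureReal_pairedCount_le μ S hN hN0 (r := u / 2) (by positivity)
  have : (u / 2) ^ 2 / (8 * N) = u ^ 2 / (32 * N) := by field_simp; ring
  rw [this] at hpair
  linarith

end DKW

/-! ### From half-lines to unions of intervals -/

section Intervals

variable {ι : Type*} (μ : ι → Measure ℝ) [∀ i, IsProbabilityMeasure (μ i)]

lemma tendsto_centredCount (S : Finset ι) (x : ι → ℝ) {C : ℕ → Set ℝ} {L : Set ℝ}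
    (hC : ∀ n, MeasurableSet (C n))
    (h : ∀ y, ∀ᶠ n in atTop, y ∈ C n ↔ y ∈ L) :
    Tendsto (fun n => centredCount μ S (C n) x) atTop (𝓝 (centredCount μ S L x)) := by
  refine tendsto_finsetSum _ fun i _ => Tendsto.sub ?_ ?_
  · refine tendsto_const_nhds.congr' ?_
    filter_upwards [h (x i)] with n hn
    by_cases hx : x i ∈ L
    · rw [indicator_of_mem hx, indicator_of_mem (hn.2 hx)]
    · rw [indicator_of_notMem hx, indicator_of_notMem (fun h' => hx (hn.1 h'))]
  · refine (ENNReal.tendsto_toReal (measure_ne_top _ _)).comp ?_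
    exact tendsto_measure_of_tendsto_indicator_of_isFiniteMeasure _ _ hC h

lemma abs_centredCount_le_of_isLowerSet {S : Finset ι} {x : ι → ℝ} {u : ℝ}
    (h : ∀ s : ℚ, |centredCount μ S (Iic (s : ℝ)) x| ≤ u) {L : Set ℝ} (hL : IsLowerSet L) :
    |centredCount μ S L x| ≤ u := by
  suffices H : ∃ s : ℕ → ℚ, ∀ y, ∀ᶠ n in atTop, y ∈ Iic (s n : ℝ) ↔ y ∈ L by
    obtain ⟨s, hs⟩ := H
    exact le_of_tendsto' (tendsto_centredCount μ S x (fun n => measurableSet_Iic) hs).abs fun n => h (s n)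
  rcases L.eq_empty_or_nonempty with rfl | hne
  · refine ⟨fun n => -(n : ℚ), fun y => ?_⟩
    filter_upwards [tendsto_natCast_atTop_atTop.eventually (eventually_gt_atTop (-y))] with n hn
    simp; linarith
  by_cases hb : BddAbove L
  · by_cases hm : sSup L ∈ L
    · obtain ⟨s, -, h1, h2⟩ := Real.exists_seq_rat_strictAnti_tendsto (sSup L)
      refine ⟨s, fun y => ?_⟩
      rcases le_or_gt y (sSup L) with hy | hy
      · exact Eventually.of_forall fun n => by simp [hL hy hm, hy.trans (h1 n).le]
      · filter_upwards [h2.eventually (gt_mem_nhds hy)] with n hn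
        have : y ∉ L := fun hyL => not_le.2 hy (le_csSup hb hyL)
        simp [this, hn]
    · obtain ⟨s, -, h1, h2⟩ := Real.exists_seq_rat_strictMono_tendsto (sSup L)
      refine ⟨s, fun y => ?_⟩
      rcases lt_or_ge y (sSup L) with hy | hy
      · obtain ⟨z, hz, hyz⟩ := exists_lt_of_lt_csSup hne hy
        filter_upwards [h2.eventually (lt_mem_nhds hy)] with n hn
        simp [hL hyz.le hz, hn.le]
      · have : y ∉ L := fun hyL => hm ((le_antisymm hy (le_csSup hb hyL)) ▸ hyL)
        exact Eventually.of_forall fun n => by simp [this, (h1 n).trans_le hy]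
  · refine ⟨fun n => (n : ℚ), fun y => ?_⟩
    have : y ∈ L := by
      obtain ⟨z, hz, hyz⟩ := not_bddAbove_iff.1 hb y
      exact hL hyz.le hz
    filter_upwards [tendsto_natCast_atTop_atTop.eventually (eventually_ge_atTop y)] with n hn
    simp [this, hn]

/-- An interval is the difference of two nested lower sets. -/
lemma abs_centredCount_le_of_ordConnected {S : Finset ι} {x : ι → ℝ} {u : ℝ}
    (h : ∀ s : ℚ, |centredCount μ S (Iic (s : ℝ)) x| ≤ u) {I : Set ℝ} (hI : I.OrdConnected) :
    |centredCount μ S I x| ≤ 2 * u := by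
  set U : Set ℝ := {y | ∃ w ∈ I, y ≤ w} with hU
  have hUl : IsLowerSet U := fun y z hzy ⟨w, hw, hyw⟩ => ⟨w, hw, hzy.trans hyw⟩
  have hIU : I ⊆ U := fun y hy => ⟨y, hy, le_rfl⟩
  have hLl : IsLowerSet (U \ I) := by
    rintro y z hzy ⟨hyU, hyI⟩
    refine ⟨hUl hzy hyU, fun hzI => hyI ?_⟩
    obtain ⟨w, hw, hyw⟩ := hyU
    exact hI.out hzI hw ⟨hzy, hyw⟩
  have heq : centredCount μ S I x = centredCount μ S U x - centredCount μ S (U \ I) x := by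
    rw [centredCount, centredCount, centredCount, ← Finset.sum_sub_distrib]
    refine Finset.sum_congr rfl fun i _ => ?_
    rw [measureReal_sdiff hIU hI.measurableSet, indicator_sdiff hIU]
    simp only [Pi.sub_apply]
    ring
  have h1 := abs_centredCount_le_of_isLowerSet μ h hUl
  have h2 := abs_centredCount_le_of_isLowerSet μ h hLl
  rw [heq]
  linarith [abs_sub (centredCount μ S U x) (centredCount μ S (U \ I) x)]

lemma abs_centredCount_le_of_mem_intervalUnions {S : Finset ι} {x : ι → ℝ} {u : ℝ}
    (h : ∀ s : ℚ, |centredCount μ S (Iic (s : ℝ)) x| ≤ u) {K : ℕ} {C : Set ℝ}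
    (hC : C ∈ intervalUnions K) :
    |centredCount μ S C x| ≤ 2 * K * u := by
  obtain ⟨I, hI, hd, rfl⟩ := hC
  have heq : centredCount μ S (⋃ k, I k) x = ∑ k, centredCount μ S (I k) x := by
    simp only [centredCount]
    rw [Finset.sum_comm]
    refine Finset.sum_congr rfl fun i _ => ?_
    rw [Finset.sum_sub_distrib, measureReal_iUnion_fintype hd fun k => (hI k).measurableSet]
    congr 1
    have := Finset.indicator_biUnion_apply (Finset.univ : Finset (Fin K)) I (f := fun _ => (1 : ℝ))
      (fun k _ l _ hkl => hd hkl) (x i)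
    simpa using this
  rw [heq]
  calc _ ≤ ∑ k, |centredCount μ S (I k) x| := Finset.abs_sum_le_sum_abs _ _
    _ ≤ ∑ _k : Fin K, 2 * u :=
        Finset.sum_le_sum fun k _ => abs_centredCount_le_of_ordConnected μ h (hI k)
    _ = _ := by simp; ring

end Intervals

variable {Q d₀ d₁ n : ℕ}

/-! ### The law of the noisy stochastic block model -/

lemma isProbabilityMeasure_condLaw {g₀ : DensityFamily d₀} {g : DensityFamily d₁}
    {θ : Param Q d₀ d₁} (hθ : θ ∈ fullParamSet Q g₀ g) (δ : Bool) (q l : Fin Q) :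
    IsProbabilityMeasure (condLaw g₀ g θ δ q l) := by
  obtain ⟨-, -, -, -, h0, h1, -⟩ := hθ
  constructor
  rw [condLaw, withDensity_apply _ MeasurableSet.univ, Measure.restrict_univ]
  cases δ
  · simpa [condDensity] using g₀.lintegral_density _ h0
  · simpa [condDensity] using g.lintegral_density _ (h1 q l)

lemma sbmWeight_nonneg {g₀ : DensityFamily d₀} {g : DensityFamily d₁}
    {θ : Param Q d₀ d₁} (hθ : θ ∈ fullParamSet Q g₀ g) (a : Edge n → Bool) (z : Fin n → Fin Q) :
    0 ≤ sbmWeight θ a z := by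
  obtain ⟨hp, -, hw, -⟩ := hθ
  refine mul_nonneg (Finset.prod_nonneg fun i _ => (hp _).le) (Finset.prod_nonneg fun e _ => ?_)
  have := hw (z e.1.1) (z e.1.2)
  split_ifs
  · exact this.1.le
  · linarith [this.2]

/-- The law of an edge indicator given the labels. -/
def edgeWeight (θ : Param Q d₀ d₁) (z : Fin n → Fin Q) (e : Edge n) (b : Bool) : ℝ :=
  if b then θ.conn (z e.1.1) (z e.1.2) else 1 - θ.conn (z e.1.1) (z e.1.2)

lemma sbmWeight_eq (θ : Param Q d₀ d₁) (a : Edge n → Bool) (z : Fin n → Fin Q) :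
    sbmWeight θ a z = (∏ i, θ.prob (z i)) * ∏ e, edgeWeight θ z e (a e) := rfl

lemma edgeWeight_nonneg {g₀ : DensityFamily d₀} {g : DensityFamily d₁}
    {θ : Param Q d₀ d₁} (hθ : θ ∈ fullParamSet Q g₀ g) (z : Fin n → Fin Q) (e : Edge n)
    (b : Bool) : 0 ≤ edgeWeight θ z e b := by
  have := hθ.2.2.1 (z e.1.1) (z e.1.2)
  unfold edgeWeight
  split_ifs
  · exact this.1.le
  · linarith [this.2]

lemma sum_edgeWeight (θ : Param Q d₀ d₁) (z : Fin n → Fin Q) (e : Edge n) :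
    ∑ b, edgeWeight θ z e b = 1 := by
  simp [edgeWeight]

lemma law_real_apply {g₀ : DensityFamily d₀} {g : DensityFamily d₁}
    {θ : Param Q d₀ d₁} (hθ : θ ∈ fullParamSet Q g₀ g)
    (B : Set ((Edge n → ℝ) × (Edge n → Bool) × (Fin n → Fin Q))) :
    (law n g₀ g θ).real B = ∑ a : Edge n → Bool, ∑ z : Fin n → Fin Q, sbmWeight θ a z *
      (Measure.pi fun e : Edge n => condLaw g₀ g θ (a e) (z e.1.1) (z e.1.2)).real
        {x | (x, a, z) ∈ B} := by
  have := fun δ q l => isProbabilityMeasure_condLaw hθ δ q l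
  have hfin : ∀ (a : Edge n → Bool) (z : Fin n → Fin Q), ENNReal.ofReal (sbmWeight θ a z) *
      (Measure.pi fun e : Edge n => condLaw g₀ g θ (a e) (z e.1.1) (z e.1.2))
        {x | (x, a, z) ∈ B} ≠ ⊤ := fun a z =>
    ENNReal.mul_ne_top ENNReal.ofReal_ne_top (measure_ne_top _ _)
  rw [law, measureReal_def]
  simp only [Measure.coe_finsetSum, Finset.sum_apply, Measure.smul_apply, smul_eq_mul]
  have hmap : ∀ (a : Edge n → Bool) (z : Fin n → Fin Q),
      ((Measure.pi fun e : Edge n => condLaw g₀ g θ (a e) (z e.1.1) (z e.1.2)).map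
        fun x => (x, a, z)) B
      = (Measure.pi fun e : Edge n => condLaw g₀ g θ (a e) (z e.1.1) (z e.1.2))
        {x | (x, a, z) ∈ B} := fun a z => (measurableEmbedding_prod_mk_right (a, z)).map_apply _ _
  simp only [hmap]
  rw [ENNReal.toReal_sum fun a _ => ENNReal.sum_ne_top.2 fun z _ => hfin a z]
  refine Finset.sum_congr rfl fun a _ => ?_
  rw [ENNReal.toReal_sum fun z _ => hfin a z]
  refine Finset.sum_congr rfl fun z _ => ?_
  rw [ENNReal.toReal_mul, ENNReal.toReal_ofReal (sbmWeight_nonneg hθ a z), measureReal_def]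

lemma sum_sum_sbmWeight_mul (θ : Param Q d₀ d₁)
    (F : (Edge n → Bool) → (Fin n → Fin Q) → ℝ) :
    ∑ a : Edge n → Bool, ∑ z : Fin n → Fin Q, sbmWeight θ a z * F a z
      = ∑ z : Fin n → Fin Q, (∏ i, θ.prob (z i)) *
          ∑ a : Edge n → Bool, (∏ e, edgeWeight θ z e (a e)) * F a z := by
  rw [Finset.sum_comm]
  refine Finset.sum_congr rfl fun z _ => ?_
  rw [Finset.mul_sum]
  exact Finset.sum_congr rfl fun a _ => by rw [sbmWeight_eq, mul_assoc]

lemma sum_prod_edgeWeight (θ : Param Q d₀ d₁) (z : Fin n → Fin Q) :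
    ∑ a : Edge n → Bool, ∏ e, edgeWeight θ z e (a e) = 1 :=
  sum_prod_eq_one (sum_edgeWeight θ z)

lemma sum_prod_prob {g₀ : DensityFamily d₀} {g : DensityFamily d₁}
    {θ : Param Q d₀ d₁} (hθ : θ ∈ fullParamSet Q g₀ g) :
    ∑ z : Fin n → Fin Q, ∏ i, θ.prob (z i) = 1 :=
  sum_prod_eq_one (p := fun _ => θ.prob) fun _ => hθ.2.1

lemma isProbabilityMeasure_law (g₀ : DensityFamily d₀) (g : DensityFamily d₁)
    {θ : Param Q d₀ d₁} (hθ : θ ∈ fullParamSet Q g₀ g) :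
    IsProbabilityMeasure (law n g₀ g θ) := by
  have := fun δ q l => isProbabilityMeasure_condLaw hθ δ q l
  have h := law_real_apply (n := n) hθ univ
  simp only [mem_univ, ofPred_true, probReal_univ] at h
  rw [sum_sum_sbmWeight_mul θ (fun _ _ => 1)] at h
  simp only [mul_one, sum_prod_edgeWeight, sum_prod_prob hθ] at h
  constructor
  rw [measureReal_def] at h
  exact (ENNReal.toReal_eq_one_iff _).1 h

/-! ### Counts of edges by type -/

/-- The potential edges `(i, j)` with labels `(q, l)`. -/
def edgesOfType (z : Fin n → Fin Q) (q l : Fin Q) : Finset (Edge n) :=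
  Finset.univ.filter fun e => z e.1.1 = q ∧ z e.1.2 = l

lemma sum_edge (f : Fin n → Fin n → ℝ) :
    ∑ e : Edge n, f e.1.1 e.1.2 = ∑ j, ∑ i ∈ Finset.Iio j, f i j := by
  have h : ∑ e : Edge n, f e.1.1 e.1.2
      = ∑ p : Fin n × Fin n with p.1 < p.2, f p.1 p.2 :=
    (Finset.sum_subtype _ (by simp) (fun p : Fin n × Fin n => f p.1 p.2)).symm
  rw [h, Finset.sum_filter, Fintype.sum_prod_type, Finset.sum_comm]
  refine Finset.sum_congr rfl fun j _ => ?_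
  rw [← Finset.sum_filter]
  exact Finset.sum_congr (by ext; simp) fun _ _ => rfl

lemma sum_edge' (f : Fin n → Fin n → ℝ) :
    ∑ e : Edge n, f e.1.1 e.1.2 = ∑ i, ∑ j ∈ Finset.Ioi i, f i j := by
  rw [sum_edge]
  exact Finset.sum_comm' fun i j => by simp

lemma card_edge : (Fintype.card (Edge n) : ℝ) = n * (n - 1) / 2 := by
  have h : (Fintype.card (Edge n) : ℝ) = ∑ _e : Edge n, (1 : ℝ) := by simp
  rw [h, sum_edge fun _ _ => 1]
  simp only [Finset.sum_const, Fin.card_Iio, nsmul_eq_mul, mul_one]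
  rw [Fin.sum_univ_eq_sum_range fun i => (i : ℝ)]
  have gauss : ∀ k : ℕ, ∑ i ∈ Finset.range k, (i : ℝ) = k * (k - 1) / 2 := by
    intro k
    induction k with
    | zero => simp
    | succ k ih => rw [Finset.sum_range_succ, ih]; push_cast; ring
  exact gauss n

/-- The numbers of edges of each type are close to their expectations. -/
def TypicalLabels (θ : Param Q d₀ d₁) (y : ℝ) (z : Fin n → Fin Q) : Prop :=
  ∀ q l, |((edgesOfType z q l).card : ℝ) - Fintype.card (Edge n) * (θ.prob q * θ.prob l)|
    ≤ Fintype.card (Edge n) * y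

/-- The deviation of the indicator of label `q` from its mean. -/
def labelDev (θ : Param Q d₀ d₁) (q k : Fin Q) : ℝ := (if k = q then 1 else 0) - θ.prob q

lemma prob_le_one {g₀ : DensityFamily d₀} {g : DensityFamily d₁}
    {θ : Param Q d₀ d₁} (hθ : θ ∈ fullParamSet Q g₀ g) (q : Fin Q) : θ.prob q ≤ 1 := by
  rw [← hθ.2.1]
  exact Finset.single_le_sum (fun k _ => (hθ.1 k).le) (Finset.mem_univ q)

lemma abs_labelDev_le {g₀ : DensityFamily d₀} {g : DensityFamily d₁}
    {θ : Param Q d₀ d₁} (hθ : θ ∈ fullParamSet Q g₀ g) (q k : Fin Q) :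
    |labelDev θ q k| ≤ 1 := by
  have h1 := prob_le_one hθ q
  have h0 := hθ.1 q
  unfold labelDev
  rw [abs_le]
  split_ifs <;> constructor <;> linarith

lemma sum_prob_mul_labelDev {g₀ : DensityFamily d₀} {g : DensityFamily d₁}
    {θ : Param Q d₀ d₁} (hθ : θ ∈ fullParamSet Q g₀ g) (q : Fin Q) :
    ∑ k, θ.prob k * labelDev θ q k = 0 := by
  simp only [labelDev, mul_sub, Finset.sum_sub_distrib, ← Finset.sum_mul, hθ.2.1]
  simp

/-- The Hoeffding-type decomposition
`1{z i = q} 1{z j = l} - p r = (1{z i = q} - p) 1{z j = l} + p (1{z j = l} - r)`, summed over the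
edges. -/
lemma abs_card_edgesOfType_sub_le {g₀ : DensityFamily d₀} {g : DensityFamily d₁}
    {θ : Param Q d₀ d₁} (hθ : θ ∈ fullParamSet Q g₀ g) (z : Fin n → Fin Q) (q l : Fin Q) :
    |((edgesOfType z q l).card : ℝ) - Fintype.card (Edge n) * (θ.prob q * θ.prob l)|
      ≤ (∑ j, |∑ i ∈ Finset.Iio j, labelDev θ q (z i)|)
        + ∑ i, |∑ j ∈ Finset.Ioi i, labelDev θ l (z j)| := by
  have hcard : ((edgesOfType z q l).card : ℝ) = ∑ e : Edge n,
      (if z e.1.1 = q then (1 : ℝ) else 0) * (if z e.1.2 = l then 1 else 0) := by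
    rw [edgesOfType, Finset.card_filter]
    push_cast
    refine Finset.sum_congr rfl fun e _ => ?_
    by_cases h1 : z e.1.1 = q <;> by_cases h2 : z e.1.2 = l <;> simp [h1, h2]
  have hconst : (Fintype.card (Edge n) : ℝ) * (θ.prob q * θ.prob l)
      = ∑ _e : Edge n, θ.prob q * θ.prob l := by simp
  have hdec : ((edgesOfType z q l).card : ℝ) - Fintype.card (Edge n) * (θ.prob q * θ.prob l)
      = (∑ e : Edge n, labelDev θ q (z e.1.1) * (if z e.1.2 = l then 1 else 0))
        + ∑ e : Edge n, θ.prob q * labelDev θ l (z e.1.2) := by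
    rw [hcard, hconst, ← Finset.sum_sub_distrib, ← Finset.sum_add_distrib]
    refine Finset.sum_congr rfl fun e _ => ?_
    simp only [labelDev]; ring
  rw [hdec, sum_edge fun i j => labelDev θ q (z i) * (if z j = l then 1 else 0),
    sum_edge' fun _ j => θ.prob q * labelDev θ l (z j)]
  refine (abs_add_le _ _).trans (add_le_add ?_ ?_)
  · refine (Finset.abs_sum_le_sum_abs _ _).trans (Finset.sum_le_sum fun j _ => ?_)
    rw [← Finset.sum_mul, abs_mul]
    refine mul_le_of_le_one_right (abs_nonneg _) ?_
    split_ifs <;> simp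
  · refine (Finset.abs_sum_le_sum_abs _ _).trans (Finset.sum_le_sum fun i _ => ?_)
    rw [← Finset.mul_sum, abs_mul, abs_of_pos (hθ.1 q)]
    exact mul_le_of_le_one_left (abs_nonneg _) (prob_le_one hθ q)

lemma sum_labels_tail {g₀ : DensityFamily d₀} {g : DensityFamily d₁}
    {θ : Param Q d₀ d₁} (hθ : θ ∈ fullParamSet Q g₀ g) (hn : 2 ≤ n) (q l : Fin Q)
    {y : ℝ} (hy : 0 ≤ y) :
    ∑ z : Fin n → Fin Q, (∏ i, θ.prob (z i)) *
      (if Fintype.card (Edge n) * y <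
        |((edgesOfType z q l).card : ℝ) - Fintype.card (Edge n) * (θ.prob q * θ.prob l)|
        then 1 else 0)
      ≤ 4 * Real.exp (-(n * y ^ 2 / 128)) := by
  have hn' : (2 : ℝ) ≤ n := by exact_mod_cast hn
  have : Nonempty (Fin n) := ⟨⟨0, by omega⟩⟩
  set m : ℝ := (Fintype.card (Edge n) : ℝ) with hm
  have hmn : m = n * (n - 1) / 2 := card_edge
  have hm0 : 0 ≤ m := by positivity
  have tail : ∀ (k : Fin Q) (S : Fin n → Finset (Fin n)),
      ∑ z : Fin n → Fin Q, (∏ i, θ.prob (z i)) *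
        (if m * y / 2 < ∑ j, |∑ i ∈ S j, labelDev θ k (z i)| then 1 else 0)
      ≤ 2 * Real.exp (-(n * y ^ 2 / 128)) := by
    intro k S
    refine (sum_prod_sum_abs_tail (p := fun _ => θ.prob) (h := fun _ => labelDev θ k)
      (fun _ q => (hθ.1 q).le) (fun _ => hθ.2.1) S (fun _ => abs_labelDev_le hθ k)
      (fun _ => sum_prob_mul_labelDev hθ k) (N := n)
      (fun j => by exact_mod_cast (Finset.card_le_univ (S j)).trans (by simp))
      (by linarith) (u := m * y / 2) (by positivity)).trans ?_
    refine mul_le_mul_of_nonneg_left (Real.exp_le_exp.2 (neg_le_neg ?_)) (by norm_num)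
    rw [Fintype.card_fin, hmn, div_le_div_iff₀ (by norm_num) (by positivity)]
    have h1 : (n : ℝ) ^ 2 ≤ 4 * (n - 1) ^ 2 := by nlinarith
    have h2 : 0 ≤ (n : ℝ) ^ 2 * y ^ 2 := by positivity
    nlinarith [mul_le_mul_of_nonneg_left h1 h2]
  calc _ ≤ ∑ z : Fin n → Fin Q, ((∏ i, θ.prob (z i)) *
          (if m * y / 2 < ∑ j, |∑ i ∈ Finset.Iio j, labelDev θ q (z i)| then 1 else 0)
        + (∏ i, θ.prob (z i)) *
          (if m * y / 2 < ∑ i, |∑ j ∈ Finset.Ioi i, labelDev θ l (z j)| then 1 else 0)) := by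
        refine Finset.sum_le_sum fun z _ => ?_
        rw [← mul_add]
        refine mul_le_mul_of_nonneg_left ?_ (Finset.prod_nonneg fun i _ => (hθ.1 _).le)
        have := abs_card_edgesOfType_sub_le hθ z q l
        rw [← hm] at this
        split_ifs <;> linarith
    _ ≤ _ := by
        rw [Finset.sum_add_distrib]
        linarith [tail q Finset.Iio, tail l Finset.Ioi]

lemma ite_le_sum_sum_ite {R : Prop} [Decidable R] {α β : Type*} [Fintype α] [Fintype β]
    {P : α → β → Prop} [∀ a b, Decidable (P a b)] (h : R → ∃ a b, P a b) :
    (if R then (1 : ℝ) else 0) ≤ ∑ a, ∑ b, if P a b then 1 else 0 := by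
  have h0 : ∀ a b, (0 : ℝ) ≤ if P a b then 1 else 0 := fun a b => by split_ifs <;> norm_num
  split_ifs with hR
  · obtain ⟨a, b, hab⟩ := h hR
    calc (1 : ℝ) = if P a b then 1 else 0 := by rw [if_pos hab]
      _ ≤ ∑ b, if P a b then 1 else 0 :=
          Finset.single_le_sum (f := fun b => if P a b then (1 : ℝ) else 0)
            (fun b _ => h0 a b) (Finset.mem_univ b)
      _ ≤ _ := Finset.single_le_sum (f := fun a => ∑ b, if P a b then (1 : ℝ) else 0)
            (fun a _ => Finset.sum_nonneg fun b _ => h0 a b) (Finset.mem_univ a)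
  · exact Finset.sum_nonneg fun a _ => Finset.sum_nonneg fun b _ => h0 a b

open Classical in
lemma law_real_not_typicalLabels_le {g₀ : DensityFamily d₀} {g : DensityFamily d₁}
    {θ : Param Q d₀ d₁} (hθ : θ ∈ fullParamSet Q g₀ g) (hn : 2 ≤ n) {y : ℝ} (hy : 0 ≤ y) :
    (law n g₀ g θ).real {ω | ¬ TypicalLabels θ y ω.2.2}
      ≤ 4 * (Q : ℝ) ^ 2 * Real.exp (-(n * y ^ 2 / 128)) := by
  have := fun δ q l => isProbabilityMeasure_condLaw hθ δ q l
  rw [law_real_apply hθ]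
  have hsec : ∀ (a : Edge n → Bool) (z : Fin n → Fin Q),
      (Measure.pi fun e : Edge n => condLaw g₀ g θ (a e) (z e.1.1) (z e.1.2)).real
        {x | (x, a, z) ∈ {ω : (Edge n → ℝ) × (Edge n → Bool) × (Fin n → Fin Q) |
          ¬ TypicalLabels θ y ω.2.2}}
      = if ¬ TypicalLabels θ y z then 1 else 0 := by
    intro a z
    by_cases h : TypicalLabels θ y z <;> simp [h]
  simp only [hsec]
  rw [sum_sum_sbmWeight_mul θ (fun _ z => if ¬ TypicalLabels θ y z then 1 else 0)]
  simp only [← Finset.sum_mul, sum_prod_edgeWeight, one_mul]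
  calc _ ≤ ∑ z : Fin n → Fin Q, (∏ i, θ.prob (z i)) * ∑ q, ∑ l,
        (if Fintype.card (Edge n) * y <
          |((edgesOfType z q l).card : ℝ) - Fintype.card (Edge n) * (θ.prob q * θ.prob l)|
          then 1 else 0) := by
        refine Finset.sum_le_sum fun z _ => mul_le_mul_of_nonneg_left ?_
          (Finset.prod_nonneg fun i _ => (hθ.1 _).le)
        refine ite_le_sum_sum_ite fun h => ?_
        simpa only [TypicalLabels, not_forall, not_le] using h
    _ = ∑ q : Fin Q, ∑ l : Fin Q, ∑ z : Fin n → Fin Q, (∏ i, θ.prob (z i)) *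
        (if Fintype.card (Edge n) * y <
          |((edgesOfType z q l).card : ℝ) - Fintype.card (Edge n) * (θ.prob q * θ.prob l)|
          then 1 else 0) := by
        simp only [Finset.mul_sum]
        rw [Finset.sum_comm]
        exact Finset.sum_congr rfl fun q _ => Finset.sum_comm
    _ ≤ ∑ _q : Fin Q, ∑ _l : Fin Q, 4 * Real.exp (-(n * y ^ 2 / 128)) :=
        Finset.sum_le_sum fun q _ => Finset.sum_le_sum fun l _ => sum_labels_tail hθ hn q l hy
    _ = _ := by simp; ring

/-! ### Edge indicators and observations given the labels -/

/-- Given the labels, the numbers of non-null edges of each type are close to their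
expectations. -/
def TypicalEdges (θ : Param Q d₀ d₁) (τ : ℝ) (z : Fin n → Fin Q) (a : Edge n → Bool) : Prop :=
  ∀ q l, |∑ e ∈ edgesOfType z q l, ((if a e then (1 : ℝ) else 0) - θ.conn q l)|
    ≤ (edgesOfType z q l).card * τ

/-- The null edges among those of type `(q, l)`. -/
def nullEdgesOfType (z : Fin n → Fin Q) (a : Edge n → Bool) (q l : Fin Q) : Finset (Edge n) :=
  (edgesOfType z q l).filter fun e => a e = false

/-- Given labels and edge indicators, the numbers of observations in half-lines are close to their
expectations, for the null edges and for all edges of each type. -/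
def TypicalObs (g₀ : DensityFamily d₀) (g : DensityFamily d₁) (θ : Param Q d₀ d₁) (τ : ℝ)
    (z : Fin n → Fin Q) (a : Edge n → Bool) (x : Edge n → ℝ) : Prop :=
  ∀ q l, (∀ s : ℚ, |centredCount (fun e => condLaw g₀ g θ (a e) (z e.1.1) (z e.1.2))
      (nullEdgesOfType z a q l) (Iic (s : ℝ)) x| ≤ (edgesOfType z q l).card * τ) ∧
    ∀ s : ℚ, |centredCount (fun e => condLaw g₀ g θ (a e) (z e.1.1) (z e.1.2))
      (edgesOfType z q l) (Iic (s : ℝ)) x| ≤ (edgesOfType z q l).card * τ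

open Classical in
lemma sum_not_typicalEdges_le {g₀ : DensityFamily d₀} {g : DensityFamily d₁}
    {θ : Param Q d₀ d₁} (hθ : θ ∈ fullParamSet Q g₀ g) {M τ : ℝ} (hM : 0 < M) (hτ : 0 ≤ τ)
    (z : Fin n → Fin Q) (hz : ∀ q l, M ≤ (edgesOfType z q l).card) :
    ∑ a : Edge n → Bool, (∏ e, edgeWeight θ z e (a e)) *
      (if ¬ TypicalEdges θ τ z a then 1 else 0) ≤ 2 * (Q : ℝ) ^ 2 * Real.exp (-(M * τ ^ 2 / 2)) := by
  have hw0 : ∀ a : Edge n → Bool, 0 ≤ ∏ e, edgeWeight θ z e (a e) := fun a =>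
    Finset.prod_nonneg fun e _ => edgeWeight_nonneg hθ z e _
  calc _ ≤ ∑ a : Edge n → Bool, (∏ e, edgeWeight θ z e (a e)) * ∑ q, ∑ l,
        (if (edgesOfType z q l).card * τ <
          |∑ e ∈ edgesOfType z q l, ((if a e then (1 : ℝ) else 0) - θ.conn q l)|
          then 1 else 0) := by
        refine Finset.sum_le_sum fun a _ => mul_le_mul_of_nonneg_left ?_ (hw0 a)
        refine ite_le_sum_sum_ite fun h => ?_
        simpa only [TypicalEdges, not_forall, not_le] using h
    _ = ∑ q : Fin Q, ∑ l : Fin Q, ∑ a : Edge n → Bool, (∏ e, edgeWeight θ z e (a e)) *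
        (if (edgesOfType z q l).card * τ <
          |∑ e ∈ edgesOfType z q l, ((if a e then (1 : ℝ) else 0) - θ.conn q l)|
          then 1 else 0) := by
        simp only [Finset.mul_sum]
        rw [Finset.sum_comm]
        exact Finset.sum_congr rfl fun q _ => Finset.sum_comm
    _ ≤ ∑ _q : Fin Q, ∑ _l : Fin Q, 2 * Real.exp (-(M * τ ^ 2 / 2)) := by
        refine Finset.sum_le_sum fun q _ => Finset.sum_le_sum fun l _ => ?_
        have hN := hM.trans_le (hz q l)
        have htype : ∀ e ∈ edgesOfType z q l, z e.1.1 = q ∧ z e.1.2 = l := fun e he =>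
          (Finset.mem_filter.1 he).2
        refine (sum_prod_abs_tail (p := edgeWeight θ z)
          (h := fun _ b => (if b then (1 : ℝ) else 0) - θ.conn q l)
          (edgeWeight_nonneg hθ z) (sum_edgeWeight θ z) (edgesOfType z q l) ?_ ?_ le_rfl hN
          (by positivity)).trans ?_
        · intro e _ b
          have := hθ.2.2.1 q l
          rw [abs_le]
          split_ifs <;> constructor <;> linarith [this.1, this.2]
        · intro e he
          obtain ⟨h1, h2⟩ := htype e he
          simp [edgeWeight, h1, h2]; ring
        · refine mul_le_mul_of_nonneg_left (Real.exp_le_exp.2 (neg_le_neg ?_)) (by norm_num)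
          rw [div_le_div_iff₀ (by norm_num) (by positivity)]
          have := mul_le_mul_of_nonneg_left (hz q l)
            (show 0 ≤ (edgesOfType z q l).card * τ ^ 2 by positivity)
          nlinarith
    _ = _ := by simp; ring

lemma measureReal_not_typicalObs_le {g₀ : DensityFamily d₀} {g : DensityFamily d₁}
    {θ : Param Q d₀ d₁} (hθ : θ ∈ fullParamSet Q g₀ g) {M τ : ℝ} (hM : 0 < M) (hτ : 0 ≤ τ)
    (z : Fin n → Fin Q) (hz : ∀ q l, M ≤ (edgesOfType z q l).card) (a : Edge n → Bool) :
    (Measure.pi fun e : Edge n => condLaw g₀ g θ (a e) (z e.1.1) (z e.1.2)).real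
      {x | ¬ TypicalObs g₀ g θ τ z a x} ≤ 16 * (Q : ℝ) ^ 2 * Real.exp (-(M * τ ^ 2 / 32)) := by
  have := fun δ q l => isProbabilityMeasure_condLaw hθ δ q l
  set μ : Edge n → Measure ℝ := fun e => condLaw g₀ g θ (a e) (z e.1.1) (z e.1.2) with hμ
  set D : Finset (Edge n) → ℝ → Set (Edge n → ℝ) := fun S u =>
    {x | ∃ s : ℚ, u < |centredCount μ S (Iic (s : ℝ)) x|} with hD
  have hsub : {x | ¬ TypicalObs g₀ g θ τ z a x} ⊆ ⋃ q, ⋃ l,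
      D (nullEdgesOfType z a q l) ((edgesOfType z q l).card * τ)
        ∪ D (edgesOfType z q l) ((edgesOfType z q l).card * τ) := by
    intro x hx
    simp only [TypicalObs, mem_ofPred_eq, not_forall, not_and_or, not_le] at hx
    obtain ⟨q, l, h⟩ := hx
    exact mem_iUnion.2 ⟨q, mem_iUnion.2 ⟨l, h⟩⟩
  refine (measureReal_mono hsub).trans ((measureReal_iUnion_fintype_le _).trans ?_)
  calc _ ≤ ∑ _q : Fin Q, ∑ _l : Fin Q, 16 * Real.exp (-(M * τ ^ 2 / 32)) := by
        refine Finset.sum_le_sum fun q _ => (measureReal_iUnion_fintype_le _).trans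
          (Finset.sum_le_sum fun l _ => (measureReal_union_le _ _).trans ?_)
        have hN := hM.trans_le (hz q l)
        have hu : 0 ≤ (edgesOfType z q l).card * τ := by positivity
        have hexp : Real.exp (-(((edgesOfType z q l).card * τ) ^ 2
            / (32 * (edgesOfType z q l).card))) ≤ Real.exp (-(M * τ ^ 2 / 32)) := by
          refine Real.exp_le_exp.2 (neg_le_neg ?_)
          rw [div_le_div_iff₀ (by norm_num) (by positivity)]
          have := mul_le_mul_of_nonneg_left (hz q l)
            (show 0 ≤ (edgesOfType z q l).card * τ ^ 2 by positivity)
          nlinarith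
        have h1 := measureReal_exists_centredCount_le μ (nullEdgesOfType z a q l)
          (N := (edgesOfType z q l).card)
          (by exact_mod_cast Finset.card_filter_le _ _) hN hu
        have h2 := measureReal_exists_centredCount_le μ (edgesOfType z q l) le_rfl hN hu
        linarith
    _ = _ := by simp; ring

open Classical in
/-- `τ` and `τ'` are the precisions required of the edge indicators and of the observations. -/
lemma law_real_not_typical_le {g₀ : DensityFamily d₀} {g : DensityFamily d₁}
    {θ : Param Q d₀ d₁} (hθ : θ ∈ fullParamSet Q g₀ g) {M y τ τ' : ℝ} (hM : 0 < M)
    (hτ : 0 ≤ τ') (hττ : τ' ≤ τ)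
    (hz : ∀ z : Fin n → Fin Q, TypicalLabels θ y z → ∀ q l, M ≤ (edgesOfType z q l).card) :
    (law n g₀ g θ).real {ω | TypicalLabels θ y ω.2.2 ∧
        ¬ (TypicalEdges θ τ ω.2.2 ω.2.1 ∧ TypicalObs g₀ g θ τ' ω.2.2 ω.2.1 ω.1)}
      ≤ 18 * (Q : ℝ) ^ 2 * Real.exp (-(M * τ' ^ 2 / 32)) := by
  have := fun δ q l => isProbabilityMeasure_condLaw hθ δ q l
  have hw0 : ∀ (z : Fin n → Fin Q) (a : Edge n → Bool), 0 ≤ ∏ e, edgeWeight θ z e (a e) :=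
    fun z a => Finset.prod_nonneg fun e _ => edgeWeight_nonneg hθ z e _
  set E := Real.exp (-(M * τ' ^ 2 / 32)) with hE
  have hexp : Real.exp (-(M * τ ^ 2 / 2)) ≤ E := by
    refine Real.exp_le_exp.2 (neg_le_neg ?_)
    have : τ' ^ 2 ≤ τ ^ 2 := by gcongr
    nlinarith [mul_le_mul_of_nonneg_left this hM.le, mul_nonneg hM.le (sq_nonneg τ)]
  rw [law_real_apply hθ, sum_sum_sbmWeight_mul θ (fun a z =>
    (Measure.pi fun e : Edge n => condLaw g₀ g θ (a e) (z e.1.1) (z e.1.2)).real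
      {x | (x, a, z) ∈ {ω : (Edge n → ℝ) × (Edge n → Bool) × (Fin n → Fin Q) |
        TypicalLabels θ y ω.2.2 ∧
        ¬ (TypicalEdges θ τ ω.2.2 ω.2.1 ∧ TypicalObs g₀ g θ τ' ω.2.2 ω.2.1 ω.1)}})]
  calc _ ≤ ∑ z : Fin n → Fin Q, (∏ i, θ.prob (z i)) * (18 * (Q : ℝ) ^ 2 * E) := by
        refine Finset.sum_le_sum fun z _ => mul_le_mul_of_nonneg_left ?_
          (Finset.prod_nonneg fun i _ => (hθ.1 _).le)
        by_cases hT : TypicalLabels θ y z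
        · have hN := hz z hT
          have hE1 := sum_not_typicalEdges_le hθ hM (hτ.trans hττ) z hN
          calc _ ≤ ∑ a : Edge n → Bool, (∏ e, edgeWeight θ z e (a e)) *
                ((if ¬ TypicalEdges θ τ z a then 1 else 0) + 16 * (Q : ℝ) ^ 2 * E) := by
                refine Finset.sum_le_sum fun a _ => mul_le_mul_of_nonneg_left ?_ (hw0 z a)
                by_cases hA : TypicalEdges θ τ z a
                · simpa [hT, hA] using measureReal_not_typicalObs_le hθ hM hτ z hN a
                · refine measureReal_le_one.trans ?_
                  rw [if_pos hA]
                  have : 0 ≤ 16 * (Q : ℝ) ^ 2 * E := by positivity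
                  linarith
            _ = ∑ a : Edge n → Bool, (∏ e, edgeWeight θ z e (a e)) *
                (if ¬ TypicalEdges θ τ z a then 1 else 0) + 16 * (Q : ℝ) ^ 2 * E := by
                simp only [mul_add, Finset.sum_add_distrib]
                rw [← Finset.sum_mul, sum_prod_edgeWeight, one_mul]
            _ ≤ _ := by
                have := mul_le_mul_of_nonneg_left hexp (show 0 ≤ 2 * (Q : ℝ) ^ 2 by positivity)
                linarith
        · simp only [mem_ofPred_eq, hT, false_and, ofPred_false, measureReal_empty, mul_zero,
            Finset.sum_const_zero]
          positivity
    _ = _ := by rw [← Finset.sum_mul, sum_prod_prob hθ, one_mul]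

/-! ### Monotonicity of the marginal false discovery rate -/

section Analysis

variable {g₀ : DensityFamily d₀} {g : DensityFamily d₁}

lemma condDensity_nonneg {θ : Param Q d₀ d₁} (hθ : θ ∈ fullParamSet Q g₀ g) (δ : Bool)
    (q l : Fin Q) (x : ℝ) : 0 ≤ condDensity g₀ g θ δ q l x := by
  obtain ⟨-, -, -, -, h0, h1, -⟩ := hθ
  cases δ
  · simpa [condDensity] using g₀.density_nonneg _ h0 x
  · simpa [condDensity] using g.density_nonneg _ (h1 q l) x

lemma measurable_condDensity {θ : Param Q d₀ d₁} (hθ : θ ∈ fullParamSet Q g₀ g) (δ : Bool)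
    (q l : Fin Q) : Measurable (condDensity g₀ g θ δ q l) := by
  obtain ⟨-, -, -, -, h0, h1, -⟩ := hθ
  cases δ
  · simpa [condDensity] using g₀.measurable_density _ h0
  · simpa [condDensity] using g.measurable_density _ (h1 q l)

lemma lintegral_condDensity {θ : Param Q d₀ d₁} (hθ : θ ∈ fullParamSet Q g₀ g) (δ : Bool)
    (q l : Fin Q) : ∫⁻ x, ENNReal.ofReal (condDensity g₀ g θ δ q l x) = 1 := by
  obtain ⟨-, -, -, -, h0, h1, -⟩ := hθ
  cases δ
  · simpa [condDensity] using g₀.lintegral_density _ h0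
  · simpa [condDensity] using g.lintegral_density _ (h1 q l)

lemma integrable_condDensity {θ : Param Q d₀ d₁} (hθ : θ ∈ fullParamSet Q g₀ g) (δ : Bool)
    (q l : Fin Q) : Integrable (condDensity g₀ g θ δ q l) := by
  refine ⟨(measurable_condDensity hθ δ q l).aestronglyMeasurable, ?_⟩
  rw [hasFiniteIntegral_iff_ofReal (ae_of_all _ (condDensity_nonneg hθ δ q l)),
    lintegral_condDensity hθ]
  exact ENNReal.one_lt_top

lemma condLaw_real_apply {θ : Param Q d₀ d₁} (hθ : θ ∈ fullParamSet Q g₀ g) (δ : Bool)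
    (q l : Fin Q) {C : Set ℝ} (hC : MeasurableSet C) :
    (condLaw g₀ g θ δ q l).real C = ∫ x in C, condDensity g₀ g θ δ q l x := by
  rw [measureReal_def, condLaw, withDensity_apply _ hC,
    integral_eq_lintegral_of_nonneg_ae (ae_of_all _ (condDensity_nonneg hθ δ q l))
      (measurable_condDensity hθ δ q l).aestronglyMeasurable]

lemma lValue_eq (θ : Param Q d₀ d₁) (x : ℝ) (q l : Fin Q) :
    lValue g₀ g θ x q l = (1 - θ.conn q l) * condDensity g₀ g θ false q l x /
      ((1 - θ.conn q l) * condDensity g₀ g θ false q l x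
        + θ.conn q l * condDensity g₀ g θ true q l x) := rfl

lemma measurable_lValue {θ : Param Q d₀ d₁} (hθ : θ ∈ fullParamSet Q g₀ g) (q l : Fin Q) :
    Measurable fun x => lValue g₀ g θ x q l := by
  simp only [lValue_eq]
  have h0 := measurable_condDensity hθ false q l
  have h1 := measurable_condDensity hθ true q l
  exact (h0.const_mul _).div ((h0.const_mul _).add (h1.const_mul _))

lemma lValue_mem_Icc {θ : Param Q d₀ d₁} (hθ : θ ∈ fullParamSet Q g₀ g) (x : ℝ) (q l : Fin Q) :
    lValue g₀ g θ x q l ∈ Icc (0 : ℝ) 1 := by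
  have h0 := condDensity_nonneg hθ false q l x
  have h1 := condDensity_nonneg hθ true q l x
  obtain ⟨hw0, hw1⟩ := hθ.2.2.1 q l
  have hf := mul_nonneg (sub_nonneg.2 hw1.le) h0
  have hh := mul_nonneg hw0.le h1
  rw [lValue_eq]
  exact ⟨by positivity, div_le_one_of_le₀ (by linarith) (by positivity)⟩

lemma measurableSet_lValue_le {θ : Param Q d₀ d₁} (hθ : θ ∈ fullParamSet Q g₀ g) (q l : Fin Q)
    (t : ℝ) : MeasurableSet {x | lValue g₀ g θ x q l ≤ t} :=
  measurableSet_le (measurable_lValue hθ q l) measurable_const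

lemma qFun_mono {θ' : Param Q d₀ d₁} (hθ' : θ' ∈ fullParamSet Q g₀ g) (θ : Param Q d₀ d₁)
    (δ : Bool) (q l : Fin Q) : Monotone fun t => qFun g₀ g δ t q l θ' θ := by
  have := isProbabilityMeasure_condLaw hθ' δ q l
  exact fun s t hst => measureReal_mono fun x (hx : lValue g₀ g θ x q l ≤ s) => hx.trans hst

lemma qFun_nonneg (δ : Bool) (t : ℝ) (q l : Fin Q) (θ' θ : Param Q d₀ d₁) :
    0 ≤ qFun g₀ g δ t q l θ' θ := measureReal_nonneg

lemma qFun_le_one {θ' : Param Q d₀ d₁} (hθ' : θ' ∈ fullParamSet Q g₀ g) (θ : Param Q d₀ d₁)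
    (δ : Bool) (t : ℝ) (q l : Fin Q) : qFun g₀ g δ t q l θ' θ ≤ 1 := by
  have := isProbabilityMeasure_condLaw hθ' δ q l
  exact measureReal_le_one

/-- Expected proportion, under `θ'`, of null edges whose `ℓ`-value at `θ` is at most `t`. -/
def nullRejProp (g₀ : DensityFamily d₀) (g : DensityFamily d₁) (θ' θ : Param Q d₀ d₁) (t : ℝ) :
    ℝ :=
  ∑ q, ∑ l, θ'.prob q * θ'.prob l * (1 - θ'.conn q l) * qFun g₀ g false t q l θ' θ

lemma mFDR_eq (θ' θ : Param Q d₀ d₁) (t : ℝ) :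
    mFDR g₀ g θ' θ t = nullRejProp g₀ g θ' θ t / rejProp g₀ g θ' θ t := rfl

/-- An `ℓ`-value is the posterior probability of the null, so the null mass of
`{s < ℓ}` is at least `s` times its total mass. -/
lemma mul_qFun_sub_le {θ : Param Q d₀ d₁} (hθ : θ ∈ fullParamSet Q g₀ g) (q l : Fin Q)
    {s t : ℝ} (hst : s ≤ t) :
    s * ((1 - θ.conn q l) * (qFun g₀ g false t q l θ θ - qFun g₀ g false s q l θ θ)
        + θ.conn q l * (qFun g₀ g true t q l θ θ - qFun g₀ g true s q l θ θ))
      ≤ (1 - θ.conn q l) * (qFun g₀ g false t q l θ θ - qFun g₀ g false s q l θ θ) := by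
  have := fun δ => isProbabilityMeasure_condLaw hθ δ q l
  have hms := measurableSet_lValue_le hθ q l s
  have hmt := measurableSet_lValue_le hθ q l t
  have hsub : {x | lValue g₀ g θ x q l ≤ s} ⊆ {x | lValue g₀ g θ x q l ≤ t} :=
    fun x (hx : lValue g₀ g θ x q l ≤ s) => hx.trans hst
  set C := {x | lValue g₀ g θ x q l ≤ t} \ {x | lValue g₀ g θ x q l ≤ s} with hC
  have hCm : MeasurableSet C := hmt.diff hms
  have hd : ∀ δ, qFun g₀ g δ t q l θ θ - qFun g₀ g δ s q l θ θ
      = ∫ x in C, condDensity g₀ g θ δ q l x := fun δ => by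
    rw [← condLaw_real_apply hθ δ q l hCm, hC, measureReal_sdiff hsub hms]; rfl
  rw [hd, hd]
  have hi := fun δ => (integrable_condDensity hθ δ q l).integrableOn (s := C)
  rw [← integral_const_mul, ← integral_const_mul, ← integral_add ((hi _).const_mul _)
    ((hi _).const_mul _), ← integral_const_mul]
  refine setIntegral_mono_on ((((hi _).const_mul _).add ((hi _).const_mul _)).const_mul _)
    ((hi _).const_mul _) hCm fun x hx => ?_
  have hx2 : s < lValue g₀ g θ x q l := not_le.1 hx.2
  rw [lValue_eq] at hx2
  have h0 := condDensity_nonneg hθ false q l x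
  have h1 := condDensity_nonneg hθ true q l x
  obtain ⟨hw0, hw1⟩ := hθ.2.2.1 q l
  have hf := mul_nonneg (sub_nonneg.2 hw1.le) h0
  have hh := mul_nonneg hw0.le h1
  rcases eq_or_lt_of_le (add_nonneg hf hh) with h | h
  · rw [← h]; simpa using hf
  · exact ((lt_div_iff₀ h).1 hx2).le

lemma qFun_false_le {θ : Param Q d₀ d₁} (hθ : θ ∈ fullParamSet Q g₀ g) (q l : Fin Q) (t : ℝ) :
    (1 - θ.conn q l) * qFun g₀ g false t q l θ θ
      ≤ t * ((1 - θ.conn q l) * qFun g₀ g false t q l θ θ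
        + θ.conn q l * qFun g₀ g true t q l θ θ) := by
  have hC := measurableSet_lValue_le hθ q l t
  have hd : ∀ δ, qFun g₀ g δ t q l θ θ
      = ∫ x in {x | lValue g₀ g θ x q l ≤ t}, condDensity g₀ g θ δ q l x :=
    fun δ => condLaw_real_apply hθ δ q l hC
  rw [hd, hd]
  have hi := fun δ => (integrable_condDensity hθ δ q l).integrableOn
    (s := {x | lValue g₀ g θ x q l ≤ t})
  rw [← integral_const_mul, ← integral_const_mul, ← integral_add ((hi _).const_mul _)
    ((hi _).const_mul _), ← integral_const_mul]
  refine setIntegral_mono_on ((hi _).const_mul _)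
    ((((hi _).const_mul _).add ((hi _).const_mul _)).const_mul _) hC fun x hx => ?_
  have hx2 : lValue g₀ g θ x q l ≤ t := hx
  rw [lValue_eq] at hx2
  have h0 := condDensity_nonneg hθ false q l x
  have h1 := condDensity_nonneg hθ true q l x
  obtain ⟨hw0, hw1⟩ := hθ.2.2.1 q l
  have hf := mul_nonneg (sub_nonneg.2 hw1.le) h0
  have hh := mul_nonneg hw0.le h1
  rcases eq_or_lt_of_le (add_nonneg hf hh) with h | h
  · rw [← h, mul_zero]; linarith
  · exact (div_le_iff₀ h).1 hx2

lemma mul_rejProp_sub_le {θ : Param Q d₀ d₁} (hθ : θ ∈ fullParamSet Q g₀ g) {s t : ℝ}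
    (hst : s ≤ t) :
    s * (rejProp g₀ g θ θ t - rejProp g₀ g θ θ s)
      ≤ nullRejProp g₀ g θ θ t - nullRejProp g₀ g θ θ s := by
  simp only [rejProp, nullRejProp, ← Finset.sum_sub_distrib, Finset.mul_sum]
  refine Finset.sum_le_sum fun q _ => Finset.sum_le_sum fun l _ => ?_
  have := mul_le_mul_of_nonneg_left (mul_qFun_sub_le hθ q l hst)
    (mul_nonneg (hθ.1 q).le (hθ.1 l).le)
  linarith

lemma nullRejProp_le_mul {θ : Param Q d₀ d₁} (hθ : θ ∈ fullParamSet Q g₀ g) (t : ℝ) :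
    nullRejProp g₀ g θ θ t ≤ t * rejProp g₀ g θ θ t := by
  simp only [rejProp, nullRejProp, Finset.mul_sum]
  refine Finset.sum_le_sum fun q _ => Finset.sum_le_sum fun l _ => ?_
  have := mul_le_mul_of_nonneg_left (qFun_false_le hθ q l t)
    (mul_nonneg (hθ.1 q).le (hθ.1 l).le)
  linarith

lemma nullRejProp_nonneg {θ' : Param Q d₀ d₁} (hθ' : θ' ∈ fullParamSet Q g₀ g)
    (θ : Param Q d₀ d₁) (t : ℝ) : 0 ≤ nullRejProp g₀ g θ' θ t :=
  Finset.sum_nonneg fun q _ => Finset.sum_nonneg fun l _ =>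
    mul_nonneg (mul_nonneg (mul_nonneg (hθ'.1 q).le (hθ'.1 l).le)
      (sub_nonneg.2 (hθ'.2.2.1 q l).2.le)) (qFun_nonneg _ _ _ _ _ _)

lemma rejProp_mono {θ' : Param Q d₀ d₁} (hθ' : θ' ∈ fullParamSet Q g₀ g)
    (θ : Param Q d₀ d₁) : Monotone (rejProp g₀ g θ' θ) := by
  intro s t hst
  refine Finset.sum_le_sum fun q _ => Finset.sum_le_sum fun l _ => ?_
  refine mul_le_mul_of_nonneg_left (add_le_add ?_ ?_) (mul_nonneg (hθ'.1 q).le (hθ'.1 l).le)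
  · exact mul_le_mul_of_nonneg_left (qFun_mono hθ' θ _ q l hst)
      (sub_nonneg.2 (hθ'.2.2.1 q l).2.le)
  · exact mul_le_mul_of_nonneg_left (qFun_mono hθ' θ _ q l hst) (hθ'.2.2.1 q l).1.le

lemma rejProp_nonneg {θ' : Param Q d₀ d₁} (hθ' : θ' ∈ fullParamSet Q g₀ g)
    (θ : Param Q d₀ d₁) (t : ℝ) : 0 ≤ rejProp g₀ g θ' θ t :=
  Finset.sum_nonneg fun q _ => Finset.sum_nonneg fun l _ =>
    mul_nonneg (mul_nonneg (hθ'.1 q).le (hθ'.1 l).le) (add_nonneg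
      (mul_nonneg (sub_nonneg.2 (hθ'.2.2.1 q l).2.le) (qFun_nonneg _ _ _ _ _ _))
      (mul_nonneg (hθ'.2.2.1 q l).1.le (qFun_nonneg _ _ _ _ _ _)))

lemma mFDR_nonneg {θ' : Param Q d₀ d₁} (hθ' : θ' ∈ fullParamSet Q g₀ g)
    (θ : Param Q d₀ d₁) (t : ℝ) : 0 ≤ mFDR g₀ g θ' θ t :=
  div_nonneg (nullRejProp_nonneg hθ' θ t) (rejProp_nonneg hθ' θ t)

lemma mFDR_mono {θ : Param Q d₀ d₁} (hθ : θ ∈ fullParamSet Q g₀ g) :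
    Monotone (mFDR g₀ g θ θ) := by
  intro s t hst
  rcases eq_or_lt_of_le (rejProp_nonneg hθ θ s) with hs | hs
  · rw [mFDR_eq, ← hs, div_zero]
    exact mFDR_nonneg hθ θ t
  · have hF := rejProp_mono hθ θ hst
    have h1 := mul_rejProp_sub_le hθ hst
    have h2 := nullRejProp_le_mul hθ s
    rw [mFDR_eq, mFDR_eq, div_le_div_iff₀ hs (hs.trans_le hF)]
    nlinarith [mul_le_mul_of_nonneg_right h2 (sub_nonneg.2 hF),
      mul_le_mul_of_nonneg_left h1 hs.le]

/-- The `q`-value strictly increases wherever the rejection proportion does. -/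
lemma mFDR_lt_mFDR {θ : Param Q d₀ d₁} (hθ : θ ∈ fullParamSet Q g₀ g) {s t : ℝ}
    (hst : s < t) (hs : 0 < rejProp g₀ g θ θ s) (hF : rejProp g₀ g θ θ s < rejProp g₀ g θ θ t)
    (hc : ContinuousWithinAt (rejProp g₀ g θ θ) (Ioo s t) s) :
    mFDR g₀ g θ θ s < mFDR g₀ g θ θ t := by
  obtain ⟨r, hr, hrs, hrt⟩ : ∃ r, rejProp g₀ g θ θ r < rejProp g₀ g θ θ t ∧ s < r ∧ r < t := by
    have hne : (𝓝[Ioo s t] s).NeBot := by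
      rw [nhdsWithin_Ioo_eq_nhdsGT hst]; infer_instance
    exact ((hc.eventually (gt_mem_nhds hF)).and self_mem_nhdsWithin).exists
  have h1 := mul_rejProp_sub_le hθ hrs.le
  have h2 := mul_rejProp_sub_le hθ hrt.le
  have h3 := nullRejProp_le_mul hθ s
  rw [mFDR_eq, mFDR_eq, div_lt_div_iff₀ hs (hs.trans hF)]
  have h4 := mul_pos hs (mul_pos (sub_pos.2 hrs) (sub_pos.2 hr))
  nlinarith [mul_le_mul_of_nonneg_left h3 (sub_pos.2 hF).le,
    mul_le_mul_of_nonneg_left (add_le_add h1 h2) hs.le]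

lemma nullRejProp_le_of_mFDR_le {θ : Param Q d₀ d₁} (hθ : θ ∈ fullParamSet Q g₀ g) {t y : ℝ}
    (h : mFDR g₀ g θ θ t ≤ y) : nullRejProp g₀ g θ θ t ≤ y * rejProp g₀ g θ θ t := by
  rcases eq_or_lt_of_le (rejProp_nonneg hθ θ t) with hs | hs
  · have := nullRejProp_le_mul hθ t
    rw [← hs] at this ⊢
    linarith
  · exact (div_le_iff₀ hs).1 h

/-- A flat piece of the rejection proportion is a flat piece of all conditional distribution
functions. -/
lemma qFun_eq_of_rejProp_eq {θ' : Param Q d₀ d₁} (hθ' : θ' ∈ fullParamSet Q g₀ g)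
    (θ : Param Q d₀ d₁) {s t : ℝ} (hst : s ≤ t)
    (h : rejProp g₀ g θ' θ s = rejProp g₀ g θ' θ t) (δ : Bool) (q l : Fin Q) :
    qFun g₀ g δ s q l θ' θ = qFun g₀ g δ t q l θ' θ := by
  have hq := fun δ q l => sub_nonneg.2 (qFun_mono (g₀ := g₀) (g := g) hθ' θ δ q l hst)
  dsimp only at hq
  have hw := hθ'.2.2.1
  set D : Fin Q → Fin Q → ℝ := fun q l => θ'.prob q * θ'.prob l *
    ((1 - θ'.conn q l) * (qFun g₀ g false t q l θ' θ - qFun g₀ g false s q l θ' θ)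
      + θ'.conn q l * (qFun g₀ g true t q l θ' θ - qFun g₀ g true s q l θ' θ)) with hD
  have hD0 : ∀ q l, 0 ≤ D q l := fun q l => mul_nonneg (mul_nonneg (hθ'.1 q).le (hθ'.1 l).le)
    (add_nonneg (mul_nonneg (sub_nonneg.2 (hw q l).2.le) (hq _ _ _))
      (mul_nonneg (hw q l).1.le (hq _ _ _)))
  have hsum : ∑ q, ∑ l, D q l = 0 := by
    have : ∑ q, ∑ l, D q l = rejProp g₀ g θ' θ t - rejProp g₀ g θ' θ s := by
      simp only [rejProp, ← Finset.sum_sub_distrib, hD]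
      exact Finset.sum_congr rfl fun q _ => Finset.sum_congr rfl fun l _ => by ring
    rw [this, h, sub_self]
  have h1 := (Finset.sum_eq_zero_iff_of_nonneg fun q _ =>
    Finset.sum_nonneg fun l _ => hD0 q l).1 hsum q (Finset.mem_univ q)
  have h2 := (Finset.sum_eq_zero_iff_of_nonneg fun l _ => hD0 q l).1 h1 l (Finset.mem_univ l)
  have hpp := mul_pos (hθ'.1 q) (hθ'.1 l)
  have h3 := (mul_eq_zero.1 h2).resolve_left hpp.ne'
  have ha := mul_nonneg (sub_nonneg.2 (hw q l).2.le) (hq false q l)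
  have hb := mul_nonneg (hw q l).1.le (hq true q l)
  cases δ
  · have : (1 - θ'.conn q l) * (qFun g₀ g false t q l θ' θ - qFun g₀ g false s q l θ' θ) = 0 := by
      linarith
    have := (mul_eq_zero.1 this).resolve_left (sub_pos.2 (hw q l).2).ne'
    linarith
  · have : θ'.conn q l * (qFun g₀ g true t q l θ' θ - qFun g₀ g true s q l θ' θ) = 0 := by
      linarith
    have := (mul_eq_zero.1 this).resolve_left (hw q l).1.ne'
    linarith

lemma mFDR_one {θ : Param Q d₀ d₁} (hθ : θ ∈ fullParamSet Q g₀ g) :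
    mFDR g₀ g θ θ 1 = nullProp θ := by
  have hq : ∀ δ q l, qFun g₀ g δ 1 q l θ θ = 1 := fun δ q l => by
    have := isProbabilityMeasure_condLaw hθ δ q l
    have h : {x | lValue g₀ g θ x q l ≤ 1} = univ :=
      eq_univ_of_forall fun x => (lValue_mem_Icc hθ x q l).2
    rw [qFun, h, probReal_univ]
  have hF : rejProp g₀ g θ θ 1 = 1 := by
    simp only [rejProp, hq, mul_one, sub_add_cancel, ← Finset.mul_sum, hθ.2.1]
  rw [mFDR_eq, hF, div_one, nullRejProp, nullProp]
  simp only [hq, mul_one]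

/-! ### The threshold -/

section Threshold

variable {Θ : Set (Param Q d₀ d₁)} {t₁ t₂ : Param Q d₀ d₁ → Fin Q → Fin Q → ℝ}

lemma Regularity.continuousOn_rejProp (hreg : Regularity g₀ g Θ t₁ t₂) {θ' θ : Param Q d₀ d₁}
    (hθ' : θ' ∈ Θ) (hθ : θ ∈ Θ) : ContinuousOn (rejProp g₀ g θ' θ) (Icc 0 1) := by
  unfold rejProp
  refine continuousOn_finsetSum _ fun q _ => continuousOn_finsetSum _ fun l _ => ?_
  exact continuousOn_const.mul
    ((continuousOn_const.mul (hreg.continuousOn_t θ hθ θ' hθ' _ q l)).add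
      (continuousOn_const.mul (hreg.continuousOn_t θ hθ θ' hθ' _ q l)))

lemma Regularity.continuousOn_nullRejProp (hreg : Regularity g₀ g Θ t₁ t₂)
    {θ' θ : Param Q d₀ d₁} (hθ' : θ' ∈ Θ) (hθ : θ ∈ Θ) :
    ContinuousOn (nullRejProp g₀ g θ' θ) (Icc 0 1) := by
  unfold nullRejProp
  refine continuousOn_finsetSum _ fun q _ => continuousOn_finsetSum _ fun l _ => ?_
  exact continuousOn_const.mul (hreg.continuousOn_t θ hθ θ' hθ' _ q l)

lemma Regularity.continuousWithinAt_mFDR (hreg : Regularity g₀ g Θ t₁ t₂) {θ : Param Q d₀ d₁}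
    (hθ : θ ∈ Θ) {t : ℝ} (ht : t ∈ Icc (0 : ℝ) 1) (hF : rejProp g₀ g θ θ t ≠ 0) :
    ContinuousWithinAt (mFDR g₀ g θ θ) (Icc 0 1) t :=
  (hreg.continuousOn_nullRejProp hθ hθ t ht).div (hreg.continuousOn_rejProp hθ hθ t ht) hF

/-- Continuity of the `q`-value in the parameter, at a fixed threshold. -/
lemma Regularity.continuousWithinAt_mFDR_param (hreg : Regularity g₀ g Θ t₁ t₂)
    {θ : Param Q d₀ d₁} (hθ : θ ∈ Θ) {t : ℝ} (ht : t ∈ Icc (0 : ℝ) 1)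
    (hF : rejProp g₀ g θ θ t ≠ 0) :
    ContinuousWithinAt (fun θ' => mFDR g₀ g θ' θ' t) Θ θ := by
  have hq : ∀ δ q l, ContinuousWithinAt (fun θ' => qFun g₀ g δ t q l θ' θ') Θ θ := by
    intro δ q l
    have h := hreg.continuousOn δ q l (t, θ, θ) ⟨ht, hθ, hθ⟩
    exact ContinuousWithinAt.comp (f := fun θ' : Param Q d₀ d₁ => (t, θ', θ')) (x := θ) h
      (by fun_prop) fun θ' hθ' => ⟨ht, hθ', hθ'⟩
  have hp : ∀ q, ContinuousWithinAt (fun θ' : Param Q d₀ d₁ => θ'.prob q) Θ θ := fun q => by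
    unfold Param.prob; fun_prop
  have hw : ∀ q l, ContinuousWithinAt (fun θ' : Param Q d₀ d₁ => θ'.conn q l) Θ θ := fun q l => by
    unfold Param.conn; fun_prop
  refine ContinuousWithinAt.div ?_ ?_ hF
  · refine tendsto_finsetSum _ fun q _ => tendsto_finsetSum _ fun l _ => ?_
    exact (((hp q).mul (hp l)).mul (continuousWithinAt_const.sub (hw q l))).mul (hq _ q l)
  · refine tendsto_finsetSum _ fun q _ => tendsto_finsetSum _ fun l _ => ?_
    exact ((hp q).mul (hp l)).mul (((continuousWithinAt_const.sub (hw q l)).mul (hq _ q l)).add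
      ((hw q l).mul (hq _ q l)))

lemma Regularity.rejProp_zero (hreg : Regularity g₀ g Θ t₁ t₂) {θ : Param Q d₀ d₁}
    (hθ : θ ∈ Θ) : rejProp g₀ g θ θ 0 = 0 := by
  refine Finset.sum_eq_zero fun q _ => Finset.sum_eq_zero fun l _ => ?_
  have h := fun δ => hreg.eq_zero θ hθ θ hθ δ q l 0 ⟨le_rfl, (hreg.t₁_mem θ hθ q l).1⟩
  rw [h, h]; ring

lemma Regularity.zero_mem (hreg : Regularity g₀ g Θ t₁ t₂) {θ : Param Q d₀ d₁}
    (hθ : θ ∈ Θ) {y : ℝ} (hy : 0 ≤ y) :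
    (0 : ℝ) ∈ {t | t ∈ Icc (0 : ℝ) 1 ∧ mFDR g₀ g θ θ t ≤ y} := by
  refine ⟨⟨le_rfl, zero_le_one⟩, ?_⟩
  rw [mFDR_eq, hreg.rejProp_zero hθ, div_zero]
  exact hy

lemma bddAbove_threshold_set (g₀ : DensityFamily d₀) (g : DensityFamily d₁) (θ : Param Q d₀ d₁)
    (y : ℝ) : BddAbove {t | t ∈ Icc (0 : ℝ) 1 ∧ mFDR g₀ g θ θ t ≤ y} :=
  ⟨1, fun _ ht => ht.1.2⟩

lemma Regularity.threshold_mem_Icc (hreg : Regularity g₀ g Θ t₁ t₂) {θ : Param Q d₀ d₁}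
    (hθ : θ ∈ Θ) {y : ℝ} (hy : 0 ≤ y) : threshold g₀ g θ y ∈ Icc (0 : ℝ) 1 :=
  ⟨le_csSup (bddAbove_threshold_set g₀ g θ y) (hreg.zero_mem hθ hy),
    csSup_le ⟨0, hreg.zero_mem hθ hy⟩ fun _ ht => ht.1.2⟩

lemma Regularity.mFDR_threshold_le (hreg : Regularity g₀ g Θ t₁ t₂) {θ : Param Q d₀ d₁}
    (hθ : θ ∈ Θ) {y : ℝ} (hy : 0 ≤ y) : mFDR g₀ g θ θ (threshold g₀ g θ y) ≤ y := by
  by_cases hF : rejProp g₀ g θ θ (threshold g₀ g θ y) = 0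
  · rw [mFDR_eq, hF, div_zero]; exact hy
  · have hcl : threshold g₀ g θ y ∈ closure {t | t ∈ Icc (0 : ℝ) 1 ∧ mFDR g₀ g θ θ t ≤ y} :=
      csSup_mem_closure ⟨0, hreg.zero_mem hθ hy⟩ (bddAbove_threshold_set g₀ g θ y)
    have hc := (hreg.continuousWithinAt_mFDR hθ (hreg.threshold_mem_Icc hθ hy) hF).mono
      (show {t | t ∈ Icc (0 : ℝ) 1 ∧ mFDR g₀ g θ θ t ≤ y} ⊆ Icc 0 1 from fun _ ht => ht.1)
    exact hc.closure_le hcl continuousWithinAt_const fun _ ht => ht.2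

lemma Regularity.mFDR_le_iff (hreg : Regularity g₀ g Θ t₁ t₂) (hΘ : Θ ⊆ fullParamSet Q g₀ g)
    {θ : Param Q d₀ d₁} (hθ : θ ∈ Θ) {y : ℝ} (hy : 0 ≤ y) {t : ℝ} (ht : t ∈ Icc (0 : ℝ) 1) :
    mFDR g₀ g θ θ t ≤ y ↔ t ≤ threshold g₀ g θ y :=
  ⟨fun h => le_csSup (bddAbove_threshold_set g₀ g θ y) ⟨ht, h⟩,
    fun h => (mFDR_mono (hΘ hθ) h).trans (hreg.mFDR_threshold_le hθ hy)⟩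

lemma nonempty_fin_of_mem (hΘ : Θ ⊆ fullParamSet Q g₀ g) {θ : Param Q d₀ d₁} (hθ : θ ∈ Θ) :
    Nonempty (Fin Q) := by
  by_contra h
  rw [not_nonempty_iff] at h
  have := (hΘ hθ).2.1
  simp at this

lemma exists_t₁_eq_iInf (hΘ : Θ ⊆ fullParamSet Q g₀ g) {θ : Param Q d₀ d₁} (hθ : θ ∈ Θ) :
    ∃ q l, t₁ θ q l = ⨅ p : Fin Q × Fin Q, t₁ θ p.1 p.2 := by
  have := nonempty_fin_of_mem hΘ hθ
  obtain ⟨p, hp⟩ := exists_eq_ciInf_of_finite (f := fun p : Fin Q × Fin Q => t₁ θ p.1 p.2)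
  exact ⟨p.1, p.2, hp⟩

lemma Regularity.rejProp_pos (hreg : Regularity g₀ g Θ t₁ t₂) (hΘ : Θ ⊆ fullParamSet Q g₀ g)
    {θ : Param Q d₀ d₁} (hθ : θ ∈ Θ) {t : ℝ}
    (ht : (⨅ p : Fin Q × Fin Q, t₁ θ p.1 p.2) < t) : 0 < rejProp g₀ g θ θ t := by
  obtain ⟨q, l, hql⟩ := exists_t₁_eq_iInf (t₁ := t₁) hΘ hθ
  rw [← hql] at ht
  have hlt := hreg.t₁_lt_t₂ θ hθ q l
  have hq : ∀ δ, 0 < qFun g₀ g δ t q l θ θ := by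
    intro δ
    have h0 := hreg.eq_zero θ hθ θ hθ δ q l (t₁ θ q l) ⟨(hreg.t₁_mem θ hθ q l).1, le_rfl⟩
    have h1 := hreg.strictMonoOn θ hθ θ hθ δ q l (left_mem_Icc.2 hlt.le)
      (⟨le_min ht.le hlt.le, min_le_right _ _⟩ : min t (t₂ θ q l) ∈ Icc (t₁ θ q l) (t₂ θ q l))
      (lt_min ht hlt)
    have h2 := qFun_mono (g₀ := g₀) (g := g) (hΘ hθ) θ δ q l (min_le_left t (t₂ θ q l))
    dsimp only at h1 h2
    linarith
  have hw := (hΘ hθ).2.2.1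
  have hp := (hΘ hθ).1
  have hterm : ∀ q l, 0 ≤ θ.prob q * θ.prob l * ((1 - θ.conn q l) * qFun g₀ g false t q l θ θ
      + θ.conn q l * qFun g₀ g true t q l θ θ) := fun q l =>
    mul_nonneg (mul_nonneg (hp q).le (hp l).le) (add_nonneg
      (mul_nonneg (sub_nonneg.2 (hw q l).2.le) (qFun_nonneg _ _ _ _ _ _))
      (mul_nonneg (hw q l).1.le (qFun_nonneg _ _ _ _ _ _)))
  refine Finset.sum_pos' (fun q _ => Finset.sum_nonneg fun l _ => hterm q l)
    ⟨q, Finset.mem_univ q, Finset.sum_pos' (fun l _ => hterm q l) ⟨l, Finset.mem_univ l, ?_⟩⟩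
  exact mul_pos (mul_pos (hp q) (hp l)) (add_pos (mul_pos (sub_pos.2 (hw q l).2) (hq _))
    (mul_pos (hw q l).1 (hq _)))

lemma criticalLevel_nonneg (hΘ : Θ ⊆ fullParamSet Q g₀ g)
    {θ : Param Q d₀ d₁} (hθ : θ ∈ Θ) : 0 ≤ criticalLevel g₀ g t₁ θ :=
  (mFDR_nonneg (hΘ hθ) θ _).trans (Monotone.le_rightLim (mFDR_mono (hΘ hθ)) le_rfl)

lemma Regularity.rejProp_threshold_pos (hreg : Regularity g₀ g Θ t₁ t₂)
    (hΘ : Θ ⊆ fullParamSet Q g₀ g) {θ : Param Q d₀ d₁} (hθ : θ ∈ Θ) {y : ℝ}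
    (hy : criticalLevel g₀ g t₁ θ < y) : 0 < rejProp g₀ g θ θ (threshold g₀ g θ y) := by
  have hy0 := (criticalLevel_nonneg (t₁ := t₁) hΘ hθ).trans hy.le
  obtain ⟨q, l, hql⟩ := exists_t₁_eq_iInf (t₁ := t₁) hΘ hθ
  have h1 : (⨅ p : Fin Q × Fin Q, t₁ θ p.1 p.2) < 1 := by
    rw [← hql]; exact (hreg.t₁_lt_t₂ θ hθ q l).trans_le (hreg.t₂_mem θ hθ q l).2
  have h0 : 0 ≤ (⨅ p : Fin Q × Fin Q, t₁ θ p.1 p.2) := by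
    rw [← hql]; exact (hreg.t₁_mem θ hθ q l).1
  have hlim := Monotone.tendsto_rightLim (mFDR_mono (g₀ := g₀) (g := g) (hΘ hθ))
    (⨅ p : Fin Q × Fin Q, t₁ θ p.1 p.2)
  obtain ⟨t, ⟨hty, ht1⟩, ht⟩ := (((hlim.eventually (gt_mem_nhds hy)).and
    (nhdsWithin_le_nhds (gt_mem_nhds h1))).and self_mem_nhdsWithin).exists
  have htT := (hreg.mFDR_le_iff hΘ hθ hy0 ⟨h0.trans (le_of_lt ht), ht1.le⟩).1 (le_of_lt hty)
  exact (hreg.rejProp_pos hΘ hθ ht).trans_le (rejProp_mono (hΘ hθ) θ htT)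

lemma Regularity.mFDR_threshold (hreg : Regularity g₀ g Θ t₁ t₂)
    (hΘ : Θ ⊆ fullParamSet Q g₀ g) {θ : Param Q d₀ d₁} (hθ : θ ∈ Θ) {y : ℝ}
    (hy : criticalLevel g₀ g t₁ θ < y) (hy' : y < nullProp θ) :
    mFDR g₀ g θ θ (threshold g₀ g θ y) = y := by
  have hy0 := (criticalLevel_nonneg (t₁ := t₁) hΘ hθ).trans hy.le
  have hT := hreg.threshold_mem_Icc hθ hy0
  refine (hreg.mFDR_threshold_le hθ hy0).antisymm (not_lt.1 fun hlt => ?_)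
  have hT1 : threshold g₀ g θ y < 1 := by
    refine lt_of_le_of_ne hT.2 fun h => ?_
    rw [h, mFDR_one (hΘ hθ)] at hlt
    linarith
  have hc := (hreg.continuousWithinAt_mFDR hθ hT (hreg.rejProp_threshold_pos hΘ hθ hy).ne').mono
    (show Ioo (threshold g₀ g θ y) 1 ⊆ Icc 0 1 from fun t ht => ⟨hT.1.trans ht.1.le, ht.2.le⟩)
  have hne : (𝓝[Ioo (threshold g₀ g θ y) 1] (threshold g₀ g θ y)).NeBot := by
    rw [nhdsWithin_Ioo_eq_nhdsGT hT1]; infer_instance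
  obtain ⟨t, hty, ht⟩ := ((hc.eventually (gt_mem_nhds hlt)).and self_mem_nhdsWithin).exists
  have := (hreg.mFDR_le_iff hΘ hθ hy0 ⟨hT.1.trans ht.1.le, ht.2.le⟩).1 (le_of_lt hty)
  exact absurd ht.1 (not_lt.2 this)

/-! ### The modulus over the range of thresholds -/

lemma le_modulus (hΘ : Θ ⊆ fullParamSet Q g₀ g) {θ₀ : Param Q d₀ d₁} (hθ₀ : θ₀ ∈ Θ)
    {𝒦 : Set ℝ} {u : ℝ} {y : ℝ} (hy : y ∈ 𝒦) {θ θ' : Param Q d₀ d₁} (hθ : θ ∈ Θ) (hθ' : θ' ∈ Θ)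
    (h : ‖θ - θ₀‖ ≤ u) (h' : ‖θ' - θ₀‖ ≤ u) (δ : Bool) (q l : Fin Q) :
    |qFun g₀ g δ (threshold g₀ g θ₀ y) q l θ' θ - qFun g₀ g δ (threshold g₀ g θ₀ y) q l θ₀ θ₀|
      ≤ modulus g₀ g Θ θ₀ 𝒦 u := by
  refine le_csSup ⟨1, ?_⟩ ⟨q, l, δ, _, mem_image_of_mem _ hy, θ, hθ, θ', hθ', h, h', rfl⟩
  rintro r ⟨q, l, δ, t, -, θ, -, θ', hθ', -, -, rfl⟩
  have h1 := qFun_nonneg (g₀ := g₀) (g := g) δ t q l θ' θ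
  have h2 := qFun_le_one (g₀ := g₀) (g := g) (hΘ hθ') θ δ t q l
  have h3 := qFun_nonneg (g₀ := g₀) (g := g) δ t q l θ₀ θ₀
  have h4 := qFun_le_one (g₀ := g₀) (g := g) (hΘ hθ₀) θ₀ δ t q l
  rw [abs_le]
  constructor <;> linarith

lemma modulus_nonneg (g₀ : DensityFamily d₀) (g : DensityFamily d₁) (Θ : Set (Param Q d₀ d₁))
    (θ₀ : Param Q d₀ d₁) (𝒦 : Set ℝ) (u : ℝ) : 0 ≤ modulus g₀ g Θ θ₀ 𝒦 u := by
  refine Real.sSup_nonneg ?_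
  rintro r ⟨q, l, δ, t, -, θ, -, θ', -, -, -, rfl⟩
  exact abs_nonneg _

/-- Although the threshold may jump over flat pieces of the rejection proportion, the modulus
controls the conditional distribution functions on the whole interval spanned by its range: a point
missed by the threshold lies on a flat piece, whose right end is a threshold and whose left end is a
limit of thresholds, and the functions are monotone. -/
lemma Regularity.abs_qFun_sub_le_modulus (hreg : Regularity g₀ g Θ t₁ t₂)
    (hΘ : Θ ⊆ fullParamSet Q g₀ g) {θ₀ : Param Q d₀ d₁} (hθ₀ : θ₀ ∈ Θ) {a b : ℝ} (hab : a ≤ b)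
    (ha : criticalLevel g₀ g t₁ θ₀ < a) (hb : b < nullProp θ₀) {u : ℝ}
    {θ θ' : Param Q d₀ d₁} (hθ : θ ∈ Θ) (hθ' : θ' ∈ Θ)
    (h : ‖θ - θ₀‖ ≤ u) (h' : ‖θ' - θ₀‖ ≤ u) {t : ℝ}
    (hta : threshold g₀ g θ₀ a ≤ t) (htb : t ≤ threshold g₀ g θ₀ b) (δ : Bool) (q l : Fin Q) :
    |qFun g₀ g δ t q l θ' θ - qFun g₀ g δ t q l θ₀ θ₀| ≤ modulus g₀ g Θ θ₀ (Icc a b) u := by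
  set T := threshold g₀ g θ₀ with hT
  set f := mFDR g₀ g θ₀ θ₀ with hf
  have hfull := hΘ hθ₀
  have hmono : Monotone f := mFDR_mono hfull
  have ha0 : 0 ≤ a := (criticalLevel_nonneg (t₁ := t₁) hΘ hθ₀).trans ha.le
  have hTI : ∀ y ∈ Icc a b, T y ∈ Icc (0 : ℝ) 1 := fun y hy =>
    hreg.threshold_mem_Icc hθ₀ (ha0.trans hy.1)
  have hfT : ∀ y ∈ Icc a b, f (T y) = y := fun y hy =>
    hreg.mFDR_threshold hΘ hθ₀ (ha.trans_le hy.1) (hy.2.trans_lt hb)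
  have haI : a ∈ Icc a b := left_mem_Icc.2 hab
  have hbI : b ∈ Icc a b := right_mem_Icc.2 hab
  have ht01 : t ∈ Icc (0 : ℝ) 1 := ⟨(hTI a haI).1.trans hta, htb.trans (hTI b hbI).2⟩
  have hy : f t ∈ Icc a b := ⟨(hfT a haI) ▸ hmono hta, (hfT b hbI) ▸ hmono htb⟩
  -- points with the same `q`-value have the same conditional distribution functions
  have hflat : ∀ {s r : ℝ}, s ∈ Icc (0 : ℝ) 1 → r ∈ Icc (0 : ℝ) 1 → T a ≤ s → s ≤ r → f s = f r →
      qFun g₀ g δ s q l θ₀ θ₀ = qFun g₀ g δ r q l θ₀ θ₀ := by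
    intro s r hs hr hTs hsr hfsr
    refine qFun_eq_of_rejProp_eq hfull θ₀ hsr ?_ δ q l
    refine (rejProp_mono hfull θ₀ hsr).antisymm (not_lt.1 fun hlt => ?_)
    have hsr' : s < r := lt_of_le_of_ne hsr fun h => by rw [h] at hlt; exact lt_irrefl _ hlt
    have hpos : 0 < rejProp g₀ g θ₀ θ₀ s :=
      (hreg.rejProp_threshold_pos hΘ hθ₀ ha).trans_le (rejProp_mono hfull θ₀ hTs)
    exact (mFDR_lt_mFDR hfull hsr' hpos hlt ((hreg.continuousOn_rejProp hθ₀ hθ₀ s hs).mono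
      fun v hv => ⟨hs.1.trans hv.1.le, hv.2.le.trans hr.2⟩)).ne hfsr
  have hq' := qFun_mono (g₀ := g₀) (g := g) (hΘ hθ') θ δ q l
  -- the right end of the flat piece through `t`
  have hright : t ≤ T (f t) := (hreg.mFDR_le_iff hΘ hθ₀ (ha0.trans hy.1) ht01).1 le_rfl
  have hupper := le_modulus (g₀ := g₀) (g := g) hΘ hθ₀ hy hθ hθ' h h' δ q l
  rw [← hT, ← hflat ht01 (hTI _ hy) hta hright (hfT _ hy).symm] at hupper
  -- the left end, as a supremum of thresholds
  set S : Set ℝ := {s | ∃ y ∈ Icc a b, T y = s ∧ s ≤ t} with hS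
  have hSne : (T a) ∈ S := ⟨a, haI, rfl, hta⟩
  have hSb : BddAbove S := ⟨t, by rintro s ⟨_, _, _, hs⟩; exact hs⟩
  have hst : sSup S ≤ t := csSup_le ⟨_, hSne⟩ (by rintro s ⟨_, _, _, hs⟩; exact hs)
  have hTs : T a ≤ sSup S := le_csSup hSb hSne
  have hs01 : sSup S ∈ Icc (0 : ℝ) 1 := ⟨(hTI a haI).1.trans hTs, hst.trans ht01.2⟩
  have hfs : f (sSup S) = f t := by
    refine (hmono hst).antisymm (not_lt.1 fun hlt => ?_)
    have h1 : a ≤ f (sSup S) := (hfT a haI) ▸ hmono hTs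
    have hmid : (f (sSup S) + f t) / 2 ∈ Icc a b := ⟨by linarith, by linarith [hy.2]⟩
    have h2 : T ((f (sSup S) + f t) / 2) ≤ t := by
      refine not_lt.1 fun hlt' => ?_
      have := hmono hlt'.le
      rw [hfT _ hmid] at this
      linarith
    have h3 := hmono (le_csSup hSb ⟨_, hmid, rfl, h2⟩)
    rw [hfT _ hmid] at h3
    linarith
  have hleft : |qFun g₀ g δ (sSup S) q l θ' θ - qFun g₀ g δ (sSup S) q l θ₀ θ₀|
      ≤ modulus g₀ g Θ θ₀ (Icc a b) u := by
    have hc : ContinuousWithinAt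
        (fun s => |qFun g₀ g δ s q l θ' θ - qFun g₀ g δ s q l θ₀ θ₀|) S (sSup S) :=
      (((hreg.continuousOn_t θ hθ θ' hθ' δ q l).sub
        (hreg.continuousOn_t θ₀ hθ₀ θ₀ hθ₀ δ q l)).abs _ hs01).mono (by
          rintro s ⟨y, hyI, rfl, -⟩
          exact hTI y hyI)
    refine hc.closure_le (csSup_mem_closure ⟨_, hSne⟩ hSb) continuousWithinAt_const ?_
    rintro s ⟨y, hyI, rfl, -⟩
    exact le_modulus hΘ hθ₀ hyI hθ hθ' h h' δ q l
  rw [hflat hs01 ht01 hTs hst hfs] at hleft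
  have m1 := hq' hright
  have m2 := hq' hst
  dsimp only at m1 m2
  rw [abs_le] at hupper hleft ⊢
  constructor <;> linarith [hupper.2, hleft.1]

/-- For parameters close to `θ₀`, the threshold at an interior level lies between the thresholds of
`θ₀` at the end points. -/
lemma Regularity.exists_threshold_mem (hreg : Regularity g₀ g Θ t₁ t₂)
    (hΘ : Θ ⊆ fullParamSet Q g₀ g) {θ₀ : Param Q d₀ d₁} (hθ₀ : θ₀ ∈ Θ) {a b α : ℝ}
    (hα : α ∈ Ioo a b) (ha : criticalLevel g₀ g t₁ θ₀ < a) (hb : b < nullProp θ₀) :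
    ∃ e ∈ Ioo (0 : ℝ) 1, ∀ θ ∈ Θ, ‖θ - θ₀‖ < e →
      threshold g₀ g θ₀ a ≤ threshold g₀ g θ α ∧ threshold g₀ g θ α ≤ threshold g₀ g θ₀ b := by
  have ha0 : 0 ≤ a := (criticalLevel_nonneg (t₁ := t₁) hΘ hθ₀).trans ha.le
  have hα0 : 0 ≤ α := ha0.trans hα.1.le
  have hab := hα.1.trans hα.2
  have hTa := hreg.threshold_mem_Icc hθ₀ ha0
  have hTb := hreg.threshold_mem_Icc hθ₀ (ha0.trans hab.le)
  have hca := hreg.continuousWithinAt_mFDR_param hθ₀ hTa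
    (hreg.rejProp_threshold_pos hΘ hθ₀ ha).ne'
  have hcb := hreg.continuousWithinAt_mFDR_param hθ₀ hTb
    (hreg.rejProp_threshold_pos hΘ hθ₀ (ha.trans hab)).ne'
  have hfa := hreg.mFDR_threshold hΘ hθ₀ ha (hab.trans hb)
  have hfb := hreg.mFDR_threshold hΘ hθ₀ (ha.trans hab) hb
  have ev := (hca.eventually (gt_mem_nhds (hfa.trans_lt hα.1))).and
    (hcb.eventually (lt_mem_nhds (hα.2.trans_eq hfb.symm)))
  obtain ⟨r, hr, hball⟩ := Metric.mem_nhdsWithin_iff.1 ev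
  refine ⟨min r (1 / 2), ⟨lt_min hr (by norm_num), (min_le_right _ _).trans_lt (by norm_num)⟩,
    fun θ hθ hd => ?_⟩
  obtain ⟨h1, h2⟩ := hball ⟨by
    rw [Metric.mem_ball, dist_eq_norm]; exact hd.trans_le (min_le_left _ _), hθ⟩
  refine ⟨(hreg.mFDR_le_iff hΘ hθ hα0 hTa).1 (le_of_lt h1), le_of_lt (not_le.1 fun h => ?_)⟩
  exact absurd ((hreg.mFDR_le_iff hΘ hθ hα0 hTb).2 h) (not_le.2 h2)

end Threshold

end Analysis

/-! ### The rejection counts on the typical event -/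

section Counts

variable {g₀ : DensityFamily d₀} {g : DensityFamily d₁}

lemma sum_edgesOfType (z : Fin n → Fin Q) (f : Edge n → ℝ) :
    ∑ e, f e = ∑ q, ∑ l, ∑ e ∈ edgesOfType z q l, f e := by
  rw [← Finset.sum_fiberwise Finset.univ (fun e : Edge n => (z e.1.1, z e.1.2)) f,
    Fintype.sum_prod_type]
  simp only [edgesOfType, Prod.mk.injEq]

lemma sum_card_edgesOfType (z : Fin n → Fin Q) :
    ∑ q, ∑ l, ((edgesOfType z q l).card : ℝ) = Fintype.card (Edge n) := by
  have := sum_edgesOfType z fun _ => (1 : ℝ)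
  simpa using this.symm

/-- On the typical event, the numbers of rejected null edges and of rejected edges of type `(q, l)`
are close to their expectations, uniformly over the rejection regions `C` that are unions of `K`
intervals. -/
lemma abs_count_sub_le {θ₀ θ : Param Q d₀ d₁} (hθ₀ : θ₀ ∈ fullParamSet Q g₀ g)
    {K : ℕ} (hK : 0 < K) {y τ t : ℝ} {z : Fin n → Fin Q} {a : Edge n → Bool} {x : Edge n → ℝ}
    (hL : TypicalLabels θ₀ y z) (hA : TypicalEdges θ₀ τ z a)
    (hX : TypicalObs g₀ g θ₀ (τ / (2 * K)) z a x) (q l : Fin Q)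
    (hC : {x | lValue g₀ g θ x q l ≤ t} ∈ intervalUnions K) :
    |∑ e ∈ edgesOfType z q l, (if a e then 0 else
        if lValue g₀ g θ (x e) (z e.1.1) (z e.1.2) ≤ t then (1 : ℝ) else 0)
      - Fintype.card (Edge n) *
        (θ₀.prob q * θ₀.prob l * (1 - θ₀.conn q l) * qFun g₀ g false t q l θ₀ θ)|
      ≤ 2 * (edgesOfType z q l).card * τ + Fintype.card (Edge n) * y ∧
    |∑ e ∈ edgesOfType z q l,
        (if lValue g₀ g θ (x e) (z e.1.1) (z e.1.2) ≤ t then (1 : ℝ) else 0)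
      - Fintype.card (Edge n) * (θ₀.prob q * θ₀.prob l *
        ((1 - θ₀.conn q l) * qFun g₀ g false t q l θ₀ θ
          + θ₀.conn q l * qFun g₀ g true t q l θ₀ θ))|
      ≤ 2 * (edgesOfType z q l).card * τ + Fintype.card (Edge n) * y := by
  have hprob := fun δ q l => isProbabilityMeasure_condLaw hθ₀ δ q l
  set C : Set ℝ := {x | lValue g₀ g θ x q l ≤ t} with hCdef
  set E := edgesOfType z q l with hE
  set m : ℝ := (Fintype.card (Edge n) : ℝ) with hm
  set N : ℝ := (E.card : ℝ) with hN
  set μ : Edge n → Measure ℝ := fun e => condLaw g₀ g θ₀ (a e) (z e.1.1) (z e.1.2) with hμ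
  set q0 := qFun g₀ g false t q l θ₀ θ with hq0
  set q1 := qFun g₀ g true t q l θ₀ θ with hq1
  set w := θ₀.conn q l with hw
  set A : ℝ := ∑ e ∈ E, if a e then (1 : ℝ) else 0 with hAdef
  have hK' : (0 : ℝ) < K := by exact_mod_cast hK
  have htype : ∀ e ∈ E, z e.1.1 = q ∧ z e.1.2 = l := fun e he => (Finset.mem_filter.1 he).2
  have hind : ∀ e ∈ E, (if lValue g₀ g θ (x e) (z e.1.1) (z e.1.2) ≤ t then (1 : ℝ) else 0)
      = C.indicator (fun _ => (1 : ℝ)) (x e) := by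
    intro e he
    obtain ⟨h1, h2⟩ := htype e he
    rw [h1, h2, indicator_apply]
    rfl
  have hμC : ∀ e ∈ E, (μ e).real C = if a e then q1 else q0 := by
    intro e he
    obtain ⟨h1, h2⟩ := htype e he
    simp only [hμ, h1, h2]
    cases a e <;> rfl
  have hcancel : 2 * (K : ℝ) * (N * (τ / (2 * K))) = N * τ := by field_simp
  have d1 := abs_centredCount_le_of_mem_intervalUnions μ (hX q l).1 hC
  have d1' := abs_centredCount_le_of_mem_intervalUnions μ (hX q l).2 hC
  rw [hcancel] at d1 d1'
  have e1 : centredCount μ (nullEdgesOfType z a q l) C x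
      = ∑ e ∈ E, (if a e then 0 else
          if lValue g₀ g θ (x e) (z e.1.1) (z e.1.2) ≤ t then (1 : ℝ) else 0) - (N - A) * q0 := by
    have hNA : (N - A) * q0 = ∑ e ∈ E, if a e then 0 else q0 := by
      have : N = ∑ _e ∈ E, (1 : ℝ) := by simp [hN]
      rw [this, hAdef, ← Finset.sum_sub_distrib, Finset.sum_mul]
      refine Finset.sum_congr rfl fun e _ => ?_
      cases a e <;> simp
    rw [hNA, centredCount, nullEdgesOfType, Finset.sum_filter, ← Finset.sum_sub_distrib]
    refine Finset.sum_congr rfl fun e he => ?_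
    rw [hind e he, hμC e he]
    cases a e <;> simp
  have e1' : centredCount μ E C x
      = ∑ e ∈ E, (if lValue g₀ g θ (x e) (z e.1.1) (z e.1.2) ≤ t then (1 : ℝ) else 0)
        - ((N - A) * q0 + A * q1) := by
    have hNA : (N - A) * q0 + A * q1 = ∑ e ∈ E, if a e then q1 else q0 := by
      have : N = ∑ _e ∈ E, (1 : ℝ) := by simp [hN]
      rw [this, hAdef, ← Finset.sum_sub_distrib, Finset.sum_mul, Finset.sum_mul,
        ← Finset.sum_add_distrib]
      refine Finset.sum_congr rfl fun e _ => ?_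
      cases a e <;> simp
    rw [hNA, centredCount, ← Finset.sum_sub_distrib]
    exact Finset.sum_congr rfl fun e he => by rw [hind e he, hμC e he]
  rw [e1] at d1
  rw [e1'] at d1'
  have d2 : |A - N * w| ≤ N * τ := by
    have := hA q l
    rw [Finset.sum_sub_distrib, Finset.sum_const, nsmul_eq_mul] at this
    exact this
  have d3 : |N - m * (θ₀.prob q * θ₀.prob l)| ≤ m * y := hL q l
  have hw0 : 0 < w := (hθ₀.2.2.1 q l).1
  have hw1 : w < 1 := (hθ₀.2.2.1 q l).2
  have q0n : 0 ≤ q0 := qFun_nonneg _ _ _ _ _ _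
  have q1n : 0 ≤ q1 := qFun_nonneg _ _ _ _ _ _
  have q0l : q0 ≤ 1 := qFun_le_one hθ₀ _ _ _ _ _
  have q1l : q1 ≤ 1 := qFun_le_one hθ₀ _ _ _ _ _
  have key : ∀ u v r : ℝ, |v| ≤ 1 → |u| ≤ r → |u * v| ≤ r := fun u v r hv hu => by
    rw [abs_mul]
    exact (mul_le_of_le_one_right (abs_nonneg _) hv).trans hu
  have hsum3 : ∀ u v r s : ℝ, |u| ≤ N * τ → |v| ≤ N * τ → |r| ≤ m * y → s = u + v + r →
      |s| ≤ 2 * N * τ + m * y := fun u v r s hu hv hr hs => by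
    rw [hs]
    linarith [abs_add_three u v r]
  constructor
  · have t2 := key _ q0 _ (by rw [abs_of_nonneg q0n]; exact q0l) d2
    have t3 := key _ ((1 - w) * q0) _ (by rw [abs_le]; constructor <;> nlinarith) d3
    refine hsum3 _ _ _ _ d1 (by rwa [← abs_neg] at t2) t3 ?_
    ring
  · have t2 := key _ (q1 - q0) _ (by rw [abs_le]; constructor <;> linarith) d2
    have t3 := key _ ((1 - w) * q0 + w * q1) _ (by rw [abs_le]; constructor <;> nlinarith) d3
    refine hsum3 _ _ _ _ d1' t2 t3 ?_
    ring

lemma abs_sum_types_sub_le {z : Fin n → Fin Q} {f : Edge n → ℝ} {c : Fin Q → Fin Q → ℝ}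
    {y τ : ℝ} (h : ∀ q l, |∑ e ∈ edgesOfType z q l, f e - Fintype.card (Edge n) * c q l|
      ≤ 2 * (edgesOfType z q l).card * τ + Fintype.card (Edge n) * y) :
    |∑ e, f e - Fintype.card (Edge n) * ∑ q, ∑ l, c q l|
      ≤ Fintype.card (Edge n) * (2 * τ + (Q : ℝ) ^ 2 * y) := by
  rw [sum_edgesOfType z]
  simp only [Finset.mul_sum, ← Finset.sum_sub_distrib]
  calc _ ≤ ∑ q, ∑ l, |∑ e ∈ edgesOfType z q l, f e - Fintype.card (Edge n) * c q l| :=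
        (Finset.abs_sum_le_sum_abs _ _).trans
          (Finset.sum_le_sum fun q _ => Finset.abs_sum_le_sum_abs _ _)
    _ ≤ ∑ q, ∑ l, (((edgesOfType z q l).card : ℝ) * (2 * τ) + Fintype.card (Edge n) * y) :=
        Finset.sum_le_sum fun q _ => Finset.sum_le_sum fun l _ => (h q l).trans (by linarith)
    _ = _ := by
        simp only [Finset.sum_add_distrib, ← Finset.sum_mul, sum_card_edgesOfType]
        simp
        ring

/-! ### Perturbation of the parameter -/

lemma abs_prob_sub_le (θ θ₀ : Param Q d₀ d₁) (q : Fin Q) :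
    |θ.prob q - θ₀.prob q| ≤ ‖θ - θ₀‖ :=
  (norm_le_pi_norm (θ - θ₀).1 q).trans (norm_fst_le _)

lemma abs_conn_sub_le (θ θ₀ : Param Q d₀ d₁) (q l : Fin Q) :
    |θ.conn q l - θ₀.conn q l| ≤ ‖θ - θ₀‖ :=
  (norm_le_pi_norm ((θ - θ₀).2.1 q) l).trans <| (norm_le_pi_norm (θ - θ₀).2.1 q).trans <|
    (norm_fst_le (θ - θ₀).2).trans (norm_snd_le _)

lemma sum_sum_prob {θ : Param Q d₀ d₁} (hθ : θ ∈ fullParamSet Q g₀ g) :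
    ∑ q, ∑ l, θ.prob q * θ.prob l = 1 := by
  simp only [← Finset.mul_sum, hθ.2.1, mul_one]

lemma rejProp_le_one {θ' : Param Q d₀ d₁} (hθ' : θ' ∈ fullParamSet Q g₀ g)
    (θ : Param Q d₀ d₁) (t : ℝ) : rejProp g₀ g θ' θ t ≤ 1 := by
  rw [← sum_sum_prob hθ']
  refine Finset.sum_le_sum fun q _ => Finset.sum_le_sum fun l _ => ?_
  refine mul_le_of_le_one_right (mul_nonneg (hθ'.1 q).le (hθ'.1 l).le) ?_
  have h0 := qFun_le_one (g₀ := g₀) (g := g) hθ' θ false t q l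
  have h1 := qFun_le_one (g₀ := g₀) (g := g) hθ' θ true t q l
  obtain ⟨hw0, hw1⟩ := hθ'.2.2.1 q l
  nlinarith

lemma abs_sum_sum_sub_le {θ : Param Q d₀ d₁} (hθ : θ ∈ fullParamSet Q g₀ g)
    {c c' : Fin Q → Fin Q → ℝ} {W ε : ℝ}
    (h : ∀ q l, |c q l - c' q l| ≤ θ.prob q * θ.prob l * W + 3 * ε) :
    |∑ q, ∑ l, c q l - ∑ q, ∑ l, c' q l| ≤ W + 3 * (Q : ℝ) ^ 2 * ε := by
  simp only [← Finset.sum_sub_distrib]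
  calc _ ≤ ∑ q, ∑ l, |c q l - c' q l| := (Finset.abs_sum_le_sum_abs _ _).trans
          (Finset.sum_le_sum fun q _ => Finset.abs_sum_le_sum_abs _ _)
    _ ≤ ∑ q, ∑ l, (θ.prob q * θ.prob l * W + 3 * ε) :=
        Finset.sum_le_sum fun q _ => Finset.sum_le_sum fun l _ => h q l
    _ = _ := by
        simp only [Finset.sum_add_distrib, ← Finset.sum_mul, sum_sum_prob hθ, Finset.sum_const,
          Finset.card_univ, Fintype.card_fin, nsmul_eq_mul]
        ring

lemma abs_mul_sub_mul_le {p r p' r' ε : ℝ} (hr : |r| ≤ 1) (hp' : |p'| ≤ 1) (h : |p - p'| ≤ ε)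
    (h' : |r - r'| ≤ ε) : |p * r - p' * r'| ≤ 2 * ε := by
  have : p * r - p' * r' = (p - p') * r + p' * (r - r') := by ring
  rw [this]
  refine (abs_add_le _ _).trans ?_
  rw [abs_mul, abs_mul]
  have h1 := mul_le_of_le_one_right (abs_nonneg (p - p')) hr
  have h2 := mul_le_of_le_one_left (abs_nonneg (r - r')) hp'
  linarith

lemma abs_prob_mul_sub_le {θ θ₀ : Param Q d₀ d₁} (hθ : θ ∈ fullParamSet Q g₀ g)
    (hθ₀ : θ₀ ∈ fullParamSet Q g₀ g) (q l : Fin Q) :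
    |θ.prob q * θ.prob l - θ₀.prob q * θ₀.prob l| ≤ 2 * ‖θ - θ₀‖ := by
  refine abs_mul_sub_mul_le ?_ ?_ (abs_prob_sub_le θ θ₀ q) (abs_prob_sub_le θ θ₀ l)
  · rw [abs_of_pos (hθ.1 l)]; exact prob_le_one hθ l
  · rw [abs_of_pos (hθ₀.1 q)]; exact prob_le_one hθ₀ q

lemma abs_rejProp_term_sub_le {p p₀ w w₀ q r q₀ r₀ W ε : ℝ} (hp : 0 ≤ p) (hp1 : p ≤ 1)
    (hw : w ∈ Ioo (0 : ℝ) 1) (hw₀ : w₀ ∈ Ioo (0 : ℝ) 1)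
    (hq₀ : q₀ ∈ Icc (0 : ℝ) 1) (hr₀ : r₀ ∈ Icc (0 : ℝ) 1)
    (hpp : |p - p₀| ≤ 2 * ε) (hww : |w - w₀| ≤ ε) (hq : |q - q₀| ≤ W) (hr : |r - r₀| ≤ W) :
    |p * ((1 - w) * q + w * r) - p₀ * ((1 - w₀) * q₀ + w₀ * r₀)| ≤ p * W + 3 * ε := by
  obtain ⟨hw0, hw1⟩ := hw
  obtain ⟨hw₀0, hw₀1⟩ := hw₀
  obtain ⟨hq₀0, hq₀1⟩ := hq₀
  obtain ⟨hr₀0, hr₀1⟩ := hr₀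
  have e : p * ((1 - w) * q + w * r) - p₀ * ((1 - w₀) * q₀ + w₀ * r₀)
      = p * ((1 - w) * (q - q₀) + w * (r - r₀)) + (w - w₀) * (p * (r₀ - q₀))
        + (p - p₀) * ((1 - w₀) * q₀ + w₀ * r₀) := by ring
  have b1 : |p * ((1 - w) * (q - q₀) + w * (r - r₀))| ≤ p * W := by
    rw [abs_mul, abs_of_nonneg hp]
    refine mul_le_mul_of_nonneg_left ?_ hp
    refine (abs_add_le _ _).trans ?_
    rw [abs_mul, abs_mul, abs_of_pos hw0, abs_of_pos (sub_pos.2 hw1)]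
    nlinarith
  have b2 : |(w - w₀) * (p * (r₀ - q₀))| ≤ ε := by
    rw [abs_mul]
    refine (mul_le_of_le_one_right (abs_nonneg _) ?_).trans hww
    rw [abs_mul, abs_of_nonneg hp]
    refine mul_le_one₀ hp1 (abs_nonneg _) ?_
    rw [abs_le]; constructor <;> linarith
  have b3 : |(p - p₀) * ((1 - w₀) * q₀ + w₀ * r₀)| ≤ 2 * ε := by
    rw [abs_mul]
    refine (mul_le_of_le_one_right (abs_nonneg _) ?_).trans hpp
    rw [abs_le]; constructor <;> nlinarith
  rw [e]
  refine (abs_add_le _ _).trans ?_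
  linarith [abs_add_le (p * ((1 - w) * (q - q₀) + w * (r - r₀))) ((w - w₀) * (p * (r₀ - q₀)))]

lemma abs_rejProp_sub_le {θ θ₀ η η₀ : Param Q d₀ d₁} (hθ : θ ∈ fullParamSet Q g₀ g)
    (hθ₀ : θ₀ ∈ fullParamSet Q g₀ g) {t W ε : ℝ} (hε : ‖θ - θ₀‖ ≤ ε)
    (hW : ∀ δ q l, |qFun g₀ g δ t q l θ η - qFun g₀ g δ t q l θ₀ η₀| ≤ W) :
    |rejProp g₀ g θ η t - rejProp g₀ g θ₀ η₀ t| ≤ W + 3 * (Q : ℝ) ^ 2 * ε := by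
  refine abs_sum_sum_sub_le hθ fun q l => ?_
  exact abs_rejProp_term_sub_le (mul_nonneg (hθ.1 q).le (hθ.1 l).le)
    (mul_le_one₀ (prob_le_one hθ q) (hθ.1 l).le (prob_le_one hθ l)) (hθ.2.2.1 q l)
    (hθ₀.2.2.1 q l) ⟨qFun_nonneg _ _ _ _ _ _, qFun_le_one hθ₀ _ _ _ _ _⟩
    ⟨qFun_nonneg _ _ _ _ _ _, qFun_le_one hθ₀ _ _ _ _ _⟩
    ((abs_prob_mul_sub_le hθ hθ₀ q l).trans (by linarith))
    ((abs_conn_sub_le θ θ₀ q l).trans hε) (hW _ q l) (hW _ q l)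

lemma abs_nullRejProp_sub_le {θ θ₀ η η₀ : Param Q d₀ d₁} (hθ : θ ∈ fullParamSet Q g₀ g)
    (hθ₀ : θ₀ ∈ fullParamSet Q g₀ g) {t W ε : ℝ} (hε : ‖θ - θ₀‖ ≤ ε)
    (hW : ∀ δ q l, |qFun g₀ g δ t q l θ η - qFun g₀ g δ t q l θ₀ η₀| ≤ W) :
    |nullRejProp g₀ g θ η t - nullRejProp g₀ g θ₀ η₀ t| ≤ W + 3 * (Q : ℝ) ^ 2 * ε := by
  refine abs_sum_sum_sub_le hθ fun q l => ?_
  have hW0 : 0 ≤ W := (abs_nonneg _).trans (hW false q l)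
  have := abs_rejProp_term_sub_le (r := 0) (r₀ := 0) (mul_nonneg (hθ.1 q).le (hθ.1 l).le)
    (mul_le_one₀ (prob_le_one hθ q) (hθ.1 l).le (prob_le_one hθ l)) (hθ.2.2.1 q l)
    (hθ₀.2.2.1 q l) ⟨qFun_nonneg false t q l θ₀ η₀, qFun_le_one hθ₀ _ _ _ _ _⟩
    ⟨le_rfl, zero_le_one⟩
    ((abs_prob_mul_sub_le hθ hθ₀ q l).trans (by linarith))
    ((abs_conn_sub_le θ θ₀ q l).trans hε) (hW false q l) (by simpa using hW0)
  simpa only [mul_zero, add_zero, ← mul_assoc] using this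

/-! ### The false discovery proportion on the typical event -/

/-- If the numbers `V` and `R` of false and of all rejections are close to `m` times proportions
with `N₀ ≤ α F₀` up to an error, then `V / R` exceeds `α` by little, as `F₀ ≥ κ`. -/
lemma div_max_le {V R m N₀ F₀ α x κ η : ℝ} (hVR : V ≤ R) (hm : 0 < m)
    (hκ : 0 < κ) (hx : 0 < x) (hx1 : x ≤ 1) (hα : 0 ≤ α) (hα1 : α ≤ 1) (hη : 0 ≤ η)
    (hVN : V ≤ m * (N₀ + η + κ * x / 4)) (hRF : m * (F₀ - η - κ * x / 4) ≤ R)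
    (hNF : N₀ ≤ α * F₀ + 2 * η) (hF : κ ≤ F₀) :
    V / max R 1 ≤ α + x + 16 * κ⁻¹ * η := by
  have hmax : 0 < max R 1 := lt_max_of_lt_right one_pos
  have hη' : 0 ≤ 16 * κ⁻¹ * η := by positivity
  -- if `η` is not small compared with `κ`, the right-hand side exceeds `1`
  rcases le_or_gt κ (16 * η) with hbig | hsmall
  · have h1 : V / max R 1 ≤ 1 := div_le_one_of_le₀ (hVR.trans (le_max_left _ _)) hmax.le
    have h2 : 1 ≤ 16 * κ⁻¹ * η := by
      have : 16 * κ⁻¹ * η = 16 * η / κ := by field_simp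
      rw [this, le_div_iff₀ hκ]; linarith
    linarith
  · have hRκ : m * (κ / 2) ≤ R := by
      refine le_trans (mul_le_mul_of_nonneg_left ?_ hm.le) hRF
      nlinarith
    rw [div_le_iff₀ hmax]
    refine le_trans ?_ (mul_le_mul_of_nonneg_left (le_max_left R 1) (by linarith))
    have h1 : m * (κ * x / 2 + 8 * η) ≤ R * (x + 16 * κ⁻¹ * η) := by
      have : m * (κ * x / 2 + 8 * η) = m * (κ / 2) * (x + 16 * κ⁻¹ * η) := by field_simp; ring
      rw [this]
      exact mul_le_mul_of_nonneg_right hRκ (by linarith)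
    have h2 : V ≤ α * R + m * (4 * η + κ * x / 2) := by
      have h3 := mul_le_mul_of_nonneg_left hRF hα
      have h4 := mul_le_mul_of_nonneg_left hNF hm.le
      have h5 : α * (m * (η + κ * x / 4)) ≤ m * (η + κ * x / 4) :=
        mul_le_of_le_one_left (by positivity) hα1
      linarith
    have h6 : 0 ≤ m * η := by positivity
    linarith

/-- On the typical event, a procedure that rejects the edges with `ℓ`-value at `θ` at most `t` has a
false discovery proportion close to `α` as soon as its marginal false discovery rate under `θ` is
at most `α` and `θ` is close to the true parameter `θ₀`. -/
lemma false_discovery_proportion_le {θ₀ θ : Param Q d₀ d₁} (hθ₀ : θ₀ ∈ fullParamSet Q g₀ g)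
    (hθ : θ ∈ fullParamSet Q g₀ g) {K : ℕ} (hK : 0 < K) (hn : 2 ≤ n)
    {t α u κ W ε : ℝ} {z : Fin n → Fin Q} {a : Edge n → Bool} {x : Edge n → ℝ}
    (hQ : 0 < Q) (hκ : 0 < κ) (hu : 0 < u) (hu1 : u ≤ 1) (hα : 0 ≤ α) (hα1 : α ≤ 1)
    (hL : TypicalLabels θ₀ (u * κ / (16 * (Q : ℝ) ^ 2)) z)
    (hA : TypicalEdges θ₀ (u * κ / 16) z a)
    (hX : TypicalObs g₀ g θ₀ (u * κ / 16 / (2 * K)) z a x)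
    (hC : ∀ q l, {x | lValue g₀ g θ x q l ≤ t} ∈ intervalUnions K)
    (hε : ‖θ - θ₀‖ ≤ ε) (ht : mFDR g₀ g θ θ t ≤ α) (hF : κ ≤ rejProp g₀ g θ₀ θ₀ t)
    (hW : ∀ δ q l, |qFun g₀ g δ t q l θ₀ θ - qFun g₀ g δ t q l θ₀ θ₀| ≤ W)
    (hW' : ∀ δ q l, |qFun g₀ g δ t q l θ θ - qFun g₀ g δ t q l θ₀ θ₀| ≤ W) :
    (∑ e, if a e then 0 else
        if lValue g₀ g θ (x e) (z e.1.1) (z e.1.2) ≤ t then (1 : ℝ) else 0)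
      / max (∑ e : Edge n, if lValue g₀ g θ (x e) (z e.1.1) (z e.1.2) ≤ t then (1 : ℝ) else 0) 1
      ≤ α + u + 16 * κ⁻¹ * (W + 3 * (Q : ℝ) ^ 2 * ε) := by
  have hQ' : (0 : ℝ) < Q := by exact_mod_cast hQ
  have hn' : (2 : ℝ) ≤ n := by exact_mod_cast hn
  have hε0 : 0 ≤ ε := (norm_nonneg _).trans hε
  have hcount := fun q l => abs_count_sub_le hθ₀ hK hL hA hX q l (hC q l)
  have hV := abs_sum_types_sub_le fun q l => (hcount q l).1
  have hR := abs_sum_types_sub_le fun q l => (hcount q l).2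
  set m : ℝ := (Fintype.card (Edge n) : ℝ) with hm
  have hm0 : 0 < m := by
    rw [hm, card_edge]
    have : (0 : ℝ) < n - 1 := by linarith
    positivity
  -- three deviations of size `u κ / 16` each: observations, edge indicators and labels
  have herr : 2 * (u * κ / 16) + (Q : ℝ) ^ 2 * (u * κ / (16 * (Q : ℝ) ^ 2)) ≤ κ * u / 4 := by
    have : (Q : ℝ) ^ 2 * (u * κ / (16 * (Q : ℝ) ^ 2)) = u * κ / 16 := by field_simp
    rw [this]
    nlinarith [mul_pos hu hκ]
  have herr' := mul_le_mul_of_nonneg_left herr hm0.le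
  set η := W + 3 * (Q : ℝ) ^ 2 * ε with hη
  have hW0 : 0 ≤ W := (abs_nonneg _).trans (hW false ⟨0, hQ⟩ ⟨0, hQ⟩)
  have hηW : W ≤ η := by have : 0 ≤ 3 * (Q : ℝ) ^ 2 * ε := by positivity
                         linarith
  have hN1 := abs_nullRejProp_sub_le (g₀ := g₀) (g := g) hθ₀ hθ₀ (ε := 0) (by simp) hW
  have hF1 := abs_rejProp_sub_le (g₀ := g₀) (g := g) hθ₀ hθ₀ (ε := 0) (by simp) hW
  have hN2 := abs_nullRejProp_sub_le (g₀ := g₀) (g := g) hθ hθ₀ hε hW'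
  have hF2 := abs_rejProp_sub_le (g₀ := g₀) (g := g) hθ hθ₀ hε hW'
  have hNF := nullRejProp_le_of_mFDR_le hθ ht
  rw [← hη, abs_le] at hN2 hF2
  rw [abs_le] at hN1 hF1 hV hR
  have h0 : ∀ e : Edge n, (0 : ℝ) ≤ if lValue g₀ g θ (x e) (z e.1.1) (z e.1.2) ≤ t then 1 else 0 :=
    fun e => by split_ifs <;> norm_num
  refine div_max_le (m := m) (N₀ := nullRejProp g₀ g θ₀ θ₀ t) (F₀ := rejProp g₀ g θ₀ θ₀ t)
    (Finset.sum_le_sum fun e _ => ?_) hm0 hκ hu hu1 hα hα1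
    (hW0.trans hηW) ?_ ?_ ?_ hF
  · cases a e
    · simp
    · simpa using h0 e
  · have h1 : m * nullRejProp g₀ g θ₀ θ t ≤ m * (nullRejProp g₀ g θ₀ θ₀ t + η) :=
      mul_le_mul_of_nonneg_left (by linarith [hN1.2]) hm0.le
    have h2 := hV.2
    change _ - m * nullRejProp g₀ g θ₀ θ t ≤ _ at h2
    linarith
  · have h1 : m * (rejProp g₀ g θ₀ θ₀ t - η) ≤ m * rejProp g₀ g θ₀ θ t :=
      mul_le_mul_of_nonneg_left (by linarith [hF1.1]) hm0.le
    have h2 := hR.1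
    change _ ≤ _ - m * rejProp g₀ g θ₀ θ t at h2
    linarith
  · have h1 : α * rejProp g₀ g θ θ t ≤ α * rejProp g₀ g θ₀ θ₀ t + η := by
      have h3 := mul_le_mul_of_nonneg_left hF2.2 hα
      have h4 := mul_le_of_le_one_left (hW0.trans hηW) hα1
      linarith
    linarith [hN2.1]

end Counts

/-! ### The plug-in procedure -/

section PlugIn

variable {g₀ : DensityFamily d₀} {g : DensityFamily d₁}

lemma mFDR_relabel (θ : Param Q d₀ d₁) (σ : Equiv.Perm (Fin Q)) (t : ℝ) :
    mFDR g₀ g (θ.relabel σ) (θ.relabel σ) t = mFDR g₀ g θ θ t := by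
  have hsum : ∀ f : Fin Q → Fin Q → ℝ, ∑ q, ∑ l, f (σ q) (σ l) = ∑ q, ∑ l, f q l := fun f => by
    rw [← Equiv.sum_comp σ fun q => ∑ l, f q l]
    exact Finset.sum_congr rfl fun q _ => Equiv.sum_comp σ (f (σ q))
  have h1 := hsum fun q l => θ.prob q * θ.prob l * (1 - θ.conn q l) * qFun g₀ g false t q l θ θ
  have h2 := hsum fun q l => θ.prob q * θ.prob l *
    ((1 - θ.conn q l) * qFun g₀ g false t q l θ θ + θ.conn q l * qFun g₀ g true t q l θ θ)
  rw [mFDR, rejProp, mFDR, rejProp, ← h1, ← h2]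
  rfl

/-- If the estimation error is less than `1`, the clustering is exact up to a permutation, which can
be transferred to the parameter. -/
lemma exists_relabel_of_discrepancy_le {θ' θ : Param Q d₀ d₁} {Z' Z : Fin n → Fin Q} {ε : ℝ}
    (hε : ε < 1) (h : discrepancy θ' Z' θ Z ≤ ε) :
    ∃ σ : Equiv.Perm (Fin Q), ‖θ'.relabel σ - θ‖ ≤ ε ∧ ∀ i, Z' i = σ (Z i) := by
  obtain ⟨σ, hσ⟩ := exists_eq_ciInf_of_finite (f := fun σ : Equiv.Perm (Fin Q) =>
    max ‖θ'.relabel σ - θ‖ ‖fun i => ((Z' i : ℕ) : ℝ) - ((σ (Z i) : ℕ) : ℝ)‖)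
  rw [discrepancy, ← hσ] at h
  refine ⟨σ, (le_max_left _ _).trans h, fun i => ?_⟩
  have h1 := (norm_le_pi_norm (fun i => ((Z' i : ℕ) : ℝ) - ((σ (Z i) : ℕ) : ℝ)) i).trans
    ((le_max_right _ _).trans h)
  have h2 : |(((Z' i : ℕ) : ℤ) - ((σ (Z i) : ℕ) : ℤ) : ℤ)| < 1 := by
    have : ((|(((Z' i : ℕ) : ℤ) - ((σ (Z i) : ℕ) : ℤ) : ℤ)| : ℤ) : ℝ) < 1 := by
      push_cast
      exact lt_of_le_of_lt h1 hε
    exact_mod_cast this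
  rw [Int.abs_lt_one_iff] at h2
  exact Fin.ext (by omega)

lemma Regularity.plugIn_eq {Θ : Set (Param Q d₀ d₁)} {t₁ t₂ : Param Q d₀ d₁ → Fin Q → Fin Q → ℝ}
    (hreg : Regularity g₀ g Θ t₁ t₂) (hΘ : Θ ⊆ fullParamSet Q g₀ g)
    {θhat : (Edge n → ℝ) → Param Q d₀ d₁} {Zhat : (Edge n → ℝ) → Fin n → Fin Q}
    {α : ℝ} (hα : 0 ≤ α) {x : Edge n → ℝ} {z : Fin n → Fin Q} {σ : Equiv.Perm (Fin Q)}
    (hσ : (θhat x).relabel σ ∈ Θ) (hz : ∀ i, Zhat x i = σ (z i)) (e : Edge n) :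
    plugIn g₀ g θhat Zhat α x e
      = if lValue g₀ g ((θhat x).relabel σ) (x e) (z e.1.1) (z e.1.2)
          ≤ threshold g₀ g ((θhat x).relabel σ) α then 1 else 0 := by
  rw [plugIn, hz, hz, ← mFDR_relabel _ σ]
  have hl : lValue g₀ g (θhat x) (x e) (σ (z e.1.1)) (σ (z e.1.2))
      = lValue g₀ g ((θhat x).relabel σ) (x e) (z e.1.1) (z e.1.2) := rfl
  rw [hl]
  exact if_congr (hreg.mFDR_le_iff hΘ hσ hα (lValue_mem_Icc (hΘ hσ) _ _ _)) rfl rfl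

lemma integral_le_add_measureReal {Ω : Type*} [MeasurableSpace Ω] (μ : Measure Ω)
    [IsProbabilityMeasure μ] {f : Ω → ℝ} {B : Set Ω} {c : ℝ} (hf0 : ∀ ω, 0 ≤ f ω)
    (hf1 : ∀ ω, f ω ≤ 1) (hc : 0 ≤ c) (h : ∀ ω, ω ∉ B → f ω ≤ c) :
    ∫ ω, f ω ∂μ ≤ c + μ.real B := by
  have hm := measurableSet_toMeasurable μ B
  calc ∫ ω, f ω ∂μ ≤ ∫ ω, (c + (toMeasurable μ B).indicator (fun _ => (1 : ℝ)) ω) ∂μ := by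
        refine integral_mono_of_nonneg (ae_of_all _ hf0)
          ((integrable_const c).add ((integrable_const 1).indicator hm)) (ae_of_all _ fun ω => ?_)
        by_cases hω : ω ∈ toMeasurable μ B
        · simp only [indicator_of_mem hω]
          linarith [hf1 ω]
        · simp only [indicator_of_notMem hω, add_zero]
          exact h ω fun hB => hω (subset_toMeasurable μ B hB)
    _ = c + μ.real B := by
        rw [integral_add (integrable_const c) ((integrable_const 1).indicator hm),
          integral_indicator hm]
        simp [measureReal_def]

end PlugIn

end NSBM

end

theorem theorem1 :
    ∃ c₁ c₁' c₂ c₂' : ℝ, 0 < c₁ ∧ 0 < c₁' ∧ 0 < c₂ ∧ 0 < c₂' ∧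
      ∀ (Q d₀ d₁ : ℕ) (g₀ : NSBM.DensityFamily d₀) (g : NSBM.DensityFamily d₁)
        (Θ : Set (NSBM.Param Q d₀ d₁)) (t₁ t₂ : NSBM.Param Q d₀ d₁ → Fin Q → Fin Q → ℝ),
        Θ ⊆ NSBM.fullParamSet Q g₀ g →
        (∀ θ ∈ Θ, ∀ σ : Equiv.Perm (Fin Q), θ.relabel σ ∈ Θ) →
        NSBM.Regularity g₀ g Θ t₁ t₂ →
        ∀ θ₀ ∈ Θ, ∀ α a b : ℝ,
          α ∈ Ioo a b →
          Icc a b ⊆ Ioo (NSBM.criticalLevel g₀ g t₁ θ₀) (NSBM.nullProp θ₀) →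
          ∃ e ∈ Ioo (0 : ℝ) 1, ∀ ε ∈ Ioo 0 e, ∀ x : ℝ, 0 < x →
            x < min ((⨅ q, θ₀.prob q) ^ 2) (1 - ⨆ p : Fin Q × Fin Q, θ₀.conn p.1 p.2) →
            ∀ K : ℕ, 0 < K → NSBM.Complexity g₀ g Θ K →
            ∀ n : ℕ, 2 ≤ n → Q ≤ n →
            ∀ (θhat : (NSBM.Edge n → ℝ) → NSBM.Param Q d₀ d₁)
              (Zhat : (NSBM.Edge n → ℝ) → Fin n → Fin Q),
              (∀ X, θhat X ∈ Θ) → Measurable θhat → Measurable Zhat →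
              Measurable (NSBM.plugIn g₀ g θhat Zhat α) →
              NSBM.FDR g₀ g θ₀ (NSBM.plugIn g₀ g θhat Zhat α) ≤
                α + x
                + 16 * (NSBM.kappa g₀ g θ₀ a)⁻¹ *
                    (NSBM.modulus g₀ g Θ θ₀ (Icc a b) ε + 3 * (Q : ℝ) ^ 2 * ε)
                + (NSBM.law n g₀ g θ₀).real
                    {ω | ε < NSBM.discrepancy (θhat ω.1) (Zhat ω.1) θ₀ ω.2.2}
                + c₁ * (Q : ℝ) ^ 2 *
                    Real.exp (-c₁' * ((n / 2 : ℕ) : ℝ) * NSBM.kappa g₀ g θ₀ a ^ 2 * x ^ 2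
                      / (Q : ℝ) ^ 4)
                + c₂ * (K : ℝ) * (Q : ℝ) ^ 2 *
                    Real.exp (-c₂' * ((n : ℝ) * ((n : ℝ) - 1) / 2) * (⨅ q, θ₀.prob q) ^ 2 *
                      (1 - ⨆ p : Fin Q × Fin Q, θ₀.conn p.1 p.2) *
                      NSBM.kappa g₀ g θ₀ a ^ 2 * x ^ 2 / (K : ℝ) ^ 2) := by
  refine ⟨4, 1 / 16384, 18, 1 / 65536, by norm_num, by norm_num, by norm_num, by norm_num, ?_⟩
  intro Q d₀ d₁ g₀ g Θ t₁ t₂ hΘ hperm hreg θ₀ hθ₀ α a b hα hab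
  have hαab : a ≤ b := (hα.1.trans hα.2).le
  have ha := (hab (left_mem_Icc.2 hαab)).1
  have hb := (hab (right_mem_Icc.2 hαab)).2
  have hfull := hΘ hθ₀
  have ha0 : 0 ≤ a := (NSBM.criticalLevel_nonneg (t₁ := t₁) hΘ hθ₀).trans ha.le
  have hα0 : 0 ≤ α := ha0.trans hα.1.le
  have hα1 : α ≤ 1 := by
    have h1 : NSBM.nullProp θ₀ ≤ 1 := by
      rw [← NSBM.mFDR_one hfull, NSBM.mFDR_eq]
      have := NSBM.nullRejProp_le_mul hfull 1
      exact div_le_one_of_le₀ (by linarith) (NSBM.rejProp_nonneg hfull _ _)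
    exact (hα.2.trans hb).le.trans h1
  obtain ⟨e, he, hthr⟩ := hreg.exists_threshold_mem hΘ hθ₀ hα ha hb
  refine ⟨e, he, ?_⟩
  intro ε hε x hx0 hx K hK hcomp n hn _ θhat Zhat hθhat _ _ _
  have : Nonempty (Fin Q) := NSBM.nonempty_fin_of_mem hΘ hθ₀
  have hQ : 0 < Q := Fin.pos_iff_nonempty.2 this
  have hQ' : (1 : ℝ) ≤ Q := by exact_mod_cast hQ
  have hK' : (1 : ℝ) ≤ K := by exact_mod_cast hK
  have hn' : (2 : ℝ) ≤ n := by exact_mod_cast hn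
  set κ := NSBM.kappa g₀ g θ₀ a with hκdef
  have hκ : 0 < κ := hreg.rejProp_threshold_pos hΘ hθ₀ ha
  have hκ1 : κ ≤ 1 := NSBM.rejProp_le_one hfull _ _
  set pm := ⨅ q, θ₀.prob q with hpm
  set wm := ⨆ p : Fin Q × Fin Q, θ₀.conn p.1 p.2 with hwm
  have hpmle : ∀ q, pm ≤ θ₀.prob q := fun q => ciInf_le (finite_range _).bddBelow q
  have hpm0 : 0 < pm := by
    obtain ⟨q, hq⟩ := exists_eq_ciInf_of_finite (f := fun q => θ₀.prob q)
    rw [hpm, ← hq]; exact hfull.1 q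
  have hpm1 : pm ≤ 1 := (hpmle ⟨0, hQ⟩).trans (NSBM.prob_le_one hfull _)
  have hwm0 : 0 ≤ wm := (hfull.2.2.1 ⟨0, hQ⟩ ⟨0, hQ⟩).1.le.trans
    (le_ciSup (f := fun p : Fin Q × Fin Q => θ₀.conn p.1 p.2) (finite_range _).bddAbove
      (⟨0, hQ⟩, ⟨0, hQ⟩))
  have hxpm : x < pm ^ 2 := hx.trans_le (min_le_left _ _)
  have hx1 : x ≤ 1 := hxpm.le.trans (pow_le_one₀ hpm0.le hpm1)
  set W := NSBM.modulus g₀ g Θ θ₀ (Icc a b) ε with hWdef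
  have hW0 : 0 ≤ W := NSBM.modulus_nonneg _ _ _ _ _ _
  set m : ℝ := (Fintype.card (NSBM.Edge n) : ℝ) with hm
  have hmn : m = n * (n - 1) / 2 := NSBM.card_edge
  have hm0 : 0 < m := by
    rw [hmn]
    have : (0 : ℝ) < n - 1 := by linarith
    positivity
  set y := x * κ / (16 * (Q : ℝ) ^ 2) with hy
  have hy0 : 0 ≤ y := by positivity
  have := NSBM.isProbabilityMeasure_law (n := n) g₀ g hfull
  -- typical labels leave at least `m pm ^ 2 / 2` edges of each type, because `x < pm ^ 2`
  have hz : ∀ z : Fin n → Fin Q, NSBM.TypicalLabels θ₀ y z →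
      ∀ q l, m * pm ^ 2 / 2 ≤ (NSBM.edgesOfType z q l).card := by
    intro z hz q l
    have h1 := (abs_le.1 (hz q l)).1
    have h2 : pm ^ 2 ≤ θ₀.prob q * θ₀.prob l := by
      rw [sq]; exact mul_le_mul (hpmle q) (hpmle l) hpm0.le (hfull.1 q).le
    have h3 : y ≤ pm ^ 2 / 2 := by
      rw [hy, div_le_div_iff₀ (by positivity) (by norm_num)]
      have : x * κ ≤ pm ^ 2 := (mul_le_of_le_one_right hx0.le hκ1).trans hxpm.le
      nlinarith [one_le_pow₀ (n := 2) hQ', sq_nonneg pm]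
    have h4 := mul_le_mul_of_nonneg_left h2 hm0.le
    have h5 := mul_le_mul_of_nonneg_left h3 hm0.le
    linarith
  set B₀ : Set ((NSBM.Edge n → ℝ) × (NSBM.Edge n → Bool) × (Fin n → Fin Q)) :=
    {ω | ε < NSBM.discrepancy (θhat ω.1) (Zhat ω.1) θ₀ ω.2.2} with hB₀
  set B₁ : Set ((NSBM.Edge n → ℝ) × (NSBM.Edge n → Bool) × (Fin n → Fin Q)) :=
    {ω | ¬ NSBM.TypicalLabels θ₀ y ω.2.2} with hB₁
  set B₂ : Set ((NSBM.Edge n → ℝ) × (NSBM.Edge n → Bool) × (Fin n → Fin Q)) :=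
    {ω | NSBM.TypicalLabels θ₀ y ω.2.2 ∧ ¬ (NSBM.TypicalEdges θ₀ (x * κ / 16) ω.2.2 ω.2.1 ∧
      NSBM.TypicalObs g₀ g θ₀ (x * κ / 16 / (2 * K)) ω.2.2 ω.2.1 ω.1)} with hB₂
  have hP₁ := NSBM.law_real_not_typicalLabels_le (n := n) hfull hn hy0
  have hP₂ := NSBM.law_real_not_typical_le (n := n) hfull (M := m * pm ^ 2 / 2) (y := y)
    (τ := x * κ / 16) (τ' := x * κ / 16 / (2 * K)) (by positivity) (by positivity)
    (div_le_self (by positivity) (by linarith)) hz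
  rw [← hB₁] at hP₁
  rw [← hB₂] at hP₂
  -- half of `n` is at least `⌊n / 2⌋`, which doubles the constant `1 / 32768`
  have hexp₁ : Real.exp (-(n * y ^ 2 / 128))
      ≤ Real.exp (-(1 / 16384) * ((n / 2 : ℕ) : ℝ) * κ ^ 2 * x ^ 2 / (Q : ℝ) ^ 4) := by
    refine Real.exp_le_exp.2 ?_
    have h1 : (2 : ℝ) * ((n / 2 : ℕ) : ℝ) ≤ n := by exact_mod_cast Nat.mul_div_le n 2
    have h2 : n * y ^ 2 / 128 = (1 / 32768) * n * (κ ^ 2 * x ^ 2 / (Q : ℝ) ^ 4) := by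
      rw [hy]; field_simp; norm_num
    have h3 : -(1 / 16384) * ((n / 2 : ℕ) : ℝ) * κ ^ 2 * x ^ 2 / (Q : ℝ) ^ 4
        = -((1 / 16384) * ((n / 2 : ℕ) : ℝ) * (κ ^ 2 * x ^ 2 / (Q : ℝ) ^ 4)) := by ring
    rw [h2, h3]
    refine neg_le_neg (mul_le_mul_of_nonneg_right ?_ (by positivity))
    linarith
  have hexp₂ : Real.exp (-(m * pm ^ 2 / 2 * (x * κ / 16 / (2 * K)) ^ 2 / 32))
      ≤ Real.exp (-(1 / 65536) * ((n : ℝ) * ((n : ℝ) - 1) / 2) * pm ^ 2 * (1 - wm) * κ ^ 2 * x ^ 2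
        / (K : ℝ) ^ 2) := by
    refine Real.exp_le_exp.2 ?_
    rw [← hmn]
    have h2 : m * pm ^ 2 / 2 * (x * κ / 16 / (2 * K)) ^ 2 / 32
        = (1 / 65536) * (m * pm ^ 2 * κ ^ 2 * x ^ 2 / (K : ℝ) ^ 2) := by
      field_simp; norm_num
    have h3 : -(1 / 65536) * m * pm ^ 2 * (1 - wm) * κ ^ 2 * x ^ 2 / (K : ℝ) ^ 2
        = -((1 / 65536) * (m * pm ^ 2 * κ ^ 2 * x ^ 2 / (K : ℝ) ^ 2) * (1 - wm)) := by ring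
    rw [h2, h3]
    exact neg_le_neg (mul_le_of_le_one_right (by positivity) (by linarith))
  have hmain : NSBM.FDR g₀ g θ₀ (NSBM.plugIn g₀ g θhat Zhat α)
      ≤ (α + x + 16 * κ⁻¹ * (W + 3 * (Q : ℝ) ^ 2 * ε))
        + (NSBM.law n g₀ g θ₀).real (B₀ ∪ B₁ ∪ B₂) := by
    have hφ : ∀ X e, 0 ≤ NSBM.plugIn g₀ g θhat Zhat α X e := fun X e => by
      unfold NSBM.plugIn; split_ifs <;> norm_num
    have hnum : ∀ ω : (NSBM.Edge n → ℝ) × (NSBM.Edge n → Bool) × (Fin n → Fin Q),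
        0 ≤ ∑ e, (if ω.2.1 e then 0 else NSBM.plugIn g₀ g θhat Zhat α ω.1 e) := fun ω =>
      Finset.sum_nonneg fun e _ => by split_ifs <;> simp [hφ]
    have hle : ∀ ω : (NSBM.Edge n → ℝ) × (NSBM.Edge n → Bool) × (Fin n → Fin Q),
        ∑ e, (if ω.2.1 e then 0 else NSBM.plugIn g₀ g θhat Zhat α ω.1 e)
          ≤ ∑ e, NSBM.plugIn g₀ g θhat Zhat α ω.1 e := fun ω =>
      Finset.sum_le_sum fun e _ => by split_ifs <;> simp [hφ]
    have hε0 := hε.1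
    refine NSBM.integral_le_add_measureReal _
      (fun ω => div_nonneg (hnum ω) (le_max_of_le_right zero_le_one))
      (fun ω => div_le_one_of_le₀ ((hle ω).trans (le_max_left _ _))
        (le_max_of_le_right zero_le_one)) (by positivity) ?_
    rintro ⟨X, A, z⟩ hω
    simp only [mem_union, not_or, hB₀, hB₁, hB₂, mem_ofPred_eq, not_lt, not_not,
      not_and_not_right] at hω
    obtain ⟨⟨hd, hL⟩, hAX⟩ := hω
    obtain ⟨hA, hX⟩ := hAX hL
    obtain ⟨σ, hσ, hzσ⟩ := NSBM.exists_relabel_of_discrepancy_le (hε.2.trans he.2) hd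
    set θ := (θhat X).relabel σ with hθdef
    have hθ : θ ∈ Θ := hperm _ (hθhat X) σ
    obtain ⟨hTa, hTb⟩ := hthr θ hθ (hσ.trans_lt hε.2)
    have hplug := hreg.plugIn_eq (θhat := θhat) (Zhat := Zhat) hΘ hα0 hθ hzσ
    simp only [hplug]
    refine NSBM.false_discovery_proportion_le hfull (hΘ hθ) hK hn hQ hκ hx0 hx1 hα0 hα1 hL hA hX
      (fun q l => hcomp _ (hreg.threshold_mem_Icc hθ hα0) θ hθ q l) hσ
      (hreg.mFDR_threshold_le hθ hα0) (NSBM.rejProp_mono hfull θ₀ hTa) (fun δ q l => ?_)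
      (fun δ q l => ?_)
    · exact hreg.abs_qFun_sub_le_modulus hΘ hθ₀ hαab ha hb hθ hθ₀ hσ (by simpa using hε0.le)
        hTa hTb δ q l
    · exact hreg.abs_qFun_sub_le_modulus hΘ hθ₀ hαab ha hb hθ hθ hσ hσ hTa hTb δ q l
  have hunion := (measureReal_union_le (μ := NSBM.law n g₀ g θ₀) (B₀ ∪ B₁) B₂).trans
    (add_le_add_left (measureReal_union_le B₀ B₁) _)
  have hQ2 : (0 : ℝ) ≤ (Q : ℝ) ^ 2 := by positivity
  have hP₁' := hP₁.trans (mul_le_mul_of_nonneg_left hexp₁ (by positivity))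
  have hP₂' := hP₂.trans (mul_le_mul_of_nonneg_left hexp₂ (by positivity))
  have hP₂'' := hP₂'.trans (mul_le_mul_of_nonneg_right
    (show 18 * (Q : ℝ) ^ 2 ≤ 18 * (K : ℝ) * (Q : ℝ) ^ 2 by nlinarith) (Real.exp_pos _).le)
  linarith
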